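/- Let $k$ be an algebraically closed field. A variety over $k$ is an integral separated scheme of finite type over $k$; points are closed points, and $T_p$ denotes the Zariski tangent space. An arrangement on a variety $X$ is a finite set $S$ of effective (Cartier) divisors on $X$ such that for every subset $T\subseteq S$ (including $T=\emptyset$, whose intersection is $X$) the scheme-theoretic intersection $\bigcap T$ is smooth over $k$. A finite set $I$ of divisors is splayed at a point $p\in\bigcap I$ if $I=I_1\cup I_2$ with $I_1,I_2$ nonempty and $$\bigcap_{D\in I_1}T_pD+\bigcap_{D\in I_2}T_pD=T_pX .$$ $I$ is splayed if it is splayed at every point of $\bigcap I$ (in particular if $\bigcap I=\emptyset$). A non-splayed component of $S$ is an irreducible closed subset $C\subseteq X$ that is an irreducible component of $\bigcap I$ for some nonempty $I\subseteq S$ which is not splayed at some point of $C$. Theorem. Let $S$ be an arrangement on a variety $X$ over $k$, and let $C$ be a non-splayed component of $S$ that is minimal with respect to inclusion among the non-splayed components of $S$. Let $\pi:\tilde X\to X$ be the blowup of $X$ along $C$ (with its reduced structure), let $E=\pi^{-1}(C)$ be the exceptional divisor, and let $\tilde S=\{\tilde D : D\in S\}$ be the set of strict transforms, where $\tilde D$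 is the scheme-theoretic closure of $\pi^{-1}(D)\setminus E$ in $\tilde X$. Then: 1. The number of non-splayed components of $S$ is finite, and $\tilde S$ has strictly fewer non-splayed components than $S$. 2. For every nonempty subset $U\subseteq\tilde S$, the set $U\cup\{E\}$ is splayed. 3. $\tilde X$ is a variety over $k$ and $\tilde S\cup\{E\}$ is an arrangement on $\tilde X$. -/

import Mathlib

universe u

open CategoryTheory AlgebraicGeometry TopologicalSpace

noncomputable section

namespace DivisorArrangement

/-! Closed subschemes of a scheme `X` are represented by their quasi-coherent ideal sheaves
`I : X.IdealSheafData`; the scheme-theoretic intersection of a set of closed subschemes is the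
supremum (sum) of the ideal sheaves. -/

/-- `f : X ⟶ Spec k` is a variety over `k`: integral, separated and of finite type. -/
structure IsVariety {k : Type u} [Field k] {X : Scheme.{u}} (f : X ⟶ Spec (.of k)) : Prop where
  isIntegral : IsIntegral X
  isSeparated : IsSeparated f
  locallyOfFiniteType : LocallyOfFiniteType f
  quasiCompact : QuasiCompact f

/-- The closed subscheme `D` is an effective Cartier divisor: locally it is cut out by a single
nonzerodivisor. -/
def IsEffectiveCartier {X : Scheme.{u}} (D : X.IdealSheafData) : Prop :=
  ∀ x : X, ∃ U : X.affineOpens, x ∈ U.1 ∧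
    ∃ g ∈ nonZeroDivisors Γ(X, U.1), D.ideal U = Ideal.span {g}

/-- `S` is an arrangement of divisors on the variety `X`: a finite set of effective divisors such
that the scheme-theoretic intersection of every subset of `S` is smooth over `k`. The empty subset
has intersection `X`. -/
structure IsArrangement {k : Type u} [Field k] {X : Scheme.{u}} (f : X ⟶ Spec (.of k))
    (S : Set X.IdealSheafData) : Prop where
  isVariety : IsVariety f
  finite : S.Finite
  isEffectiveCartier : ∀ D ∈ S, IsEffectiveCartier D
  smooth : ∀ T ⊆ S, Smooth ((sSup T).subschemeι ≫ f)

/-- The ideal of the local ring of `X` at `p` defined by the closed subscheme `D`. -/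
def stalkIdeal {X : Scheme.{u}} (D : X.IdealSheafData) (p : X) : Ideal (X.presheaf.stalk p) :=
  ⨆ (U : X.affineOpens) (hp : p ∈ U.1), (D.ideal U).map (X.presheaf.germ U.1 p hp).hom

/-- The Zariski tangent space `T_p X`, the dual of `𝔪 / 𝔪²`. -/
abbrev TangentSpaceAt (X : Scheme.{u}) (p : X) : Type u :=
  Module.Dual (IsLocalRing.ResidueField (X.presheaf.stalk p))
    (IsLocalRing.CotangentSpace (X.presheaf.stalk p))

/-- The tangent space `T_p D` at a point `p` of the closed subscheme `D`, as a subspace of `T_p X`: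
the tangent vectors that kill the differentials of the local equations of `D`. -/
def tangentSubspace {X : Scheme.{u}} (D : X.IdealSheafData) (p : X) :
    Submodule (IsLocalRing.ResidueField (X.presheaf.stalk p)) (TangentSpaceAt X p) :=
  (Submodule.span (IsLocalRing.ResidueField (X.presheaf.stalk p))
    ((IsLocalRing.maximalIdeal (X.presheaf.stalk p)).toCotangent ''
      {x | (x : X.presheaf.stalk p) ∈ stalkIdeal D p})).dualAnnihilator

/-- The set of divisors `S` is splayed at the point `p`. -/
def IsSplayedAt {X : Scheme.{u}} (S : Set X.IdealSheafData) (p : X) : Prop :=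
  ∃ S₁ S₂ : Set X.IdealSheafData, S₁.Nonempty ∧ S₂.Nonempty ∧ S = S₁ ∪ S₂ ∧
    (⨅ D ∈ S₁, tangentSubspace D p) ⊔ (⨅ D ∈ S₂, tangentSubspace D p) = ⊤

/-- The set of divisors `S` is splayed at every (closed) point of `C`. -/
def IsSplayedAlong {X : Scheme.{u}} (S : Set X.IdealSheafData) (C : Set X) : Prop :=
  ∀ p ∈ C, IsClosed {p} → IsSplayedAt S p

/-- The set of divisors `S` is splayed at every point of its intersection; in particular this
holds if the intersection is empty. -/
def IsSplayed {X : Scheme.{u}} (S : Set X.IdealSheafData) : Prop :=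
  IsSplayedAlong S (sSup S).support

/-- `C` is (the underlying set of) an irreducible component of the closed subscheme `Z`. -/
def IsComponent {X : Scheme.{u}} (Z : X.IdealSheafData) (C : Set X) : Prop :=
  Maximal (fun s : Set X => IsIrreducible s ∧ s ⊆ Z.support) C

/-- The non-splayed components of intersections of nonempty subsets of `S`. -/
def nonSplayedComponents {X : Scheme.{u}} (S : Set X.IdealSheafData) : Set (Set X) :=
  {C | ∃ I ⊆ S, I.Nonempty ∧ IsComponent (sSup I) C ∧ ¬ IsSplayedAlong I C}

/-- The ideal sheaf of the reduced closed subscheme supported on the closure of `C`. -/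
def reducedIdeal {X : Scheme.{u}} (C : Set X) : X.IdealSheafData :=
  Scheme.IdealSheafData.vanishingIdeal (Closeds.closure C)

/-- The exceptional divisor of `π` with respect to the centre `Z`: the scheme-theoretic inverse
image of `Z`. -/
abbrev exceptionalDivisor {X X' : Scheme.{u}} (π : X' ⟶ X) (Z : X.IdealSheafData) :
    X'.IdealSheafData :=
  Z.comap π

/-- `π : X' ⟶ X` is the blowup of `X` along the closed subscheme `Z`: the inverse image of `Z` is
an effective Cartier divisor, and `π` is universal among morphisms to `X` with this property. -/
structure IsBlowup {X X' : Scheme.{u}} (π : X' ⟶ X) (Z : X.IdealSheafData) : Prop where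
  isEffectiveCartier : IsEffectiveCartier (exceptionalDivisor π Z)
  existsUnique_lift : ∀ (Y : Scheme.{u}) (h : Y ⟶ X), IsEffectiveCartier (Z.comap h) →
    ∃! g : Y ⟶ X', g ≫ π = h

/-- The complement of the exceptional divisor. -/
def exceptionalCompl {X X' : Scheme.{u}} (π : X' ⟶ X) (Z : X.IdealSheafData) : X'.Opens :=
  (exceptionalDivisor π Z).support.compl

/-- The strict transform of `D` under the blowup `π` along `Z`: the scheme-theoretic closure in
`X'` of the inverse image of `D` in the complement of the exceptional divisor. -/
def strictTransform {X X' : Scheme.{u}} (π : X' ⟶ X) (Z D : X.IdealSheafData) :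
    X'.IdealSheafData :=
  (D.comap ((exceptionalCompl π Z).ι ≫ π)).map (exceptionalCompl π Z).ι

end DivisorArrangement

end

/-! Everything is checked in the local rings at closed points, which are essentially of finite type
over `k` with residue field `k`. For such rings formal smoothness plays the role of regularity.
Elements of the maximal ideal independent modulo its square have dual derivations; hence they cut
out a formally smooth quotient, and formally smooth rings are domains. A divisor or an intersection
is recorded by the image `cot` of its ideal in `R ⧸ 𝔪²`, and dually, being splayed means that the
images of the two parts meet only in zero.

The geometric input is `IsLocalArrangement.minimal_nonSplayed`. Near a closed point `p` of a minimal
non-splayed component `C`, the divisors containing `C` cut out exactly `C`, and their cotangent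
image is disjoint from that of the remaining divisors through `p`. Otherwise a larger set of
divisors, still non-splayed at `p`, would give a smaller non-splayed component. Here it matters that
splayedness does not vary along a component: the relevant dimensions are ranks of conormal modules
and can be read off at a common generization. So there are independent parameters `x₁`, `x₂` such
that `x₁` generates the ideal of `C`, divisors containing `C` have equations in `(x₁)`, and the
other divisors through `p` have equations in `(x₂)`.

Since the blowup is known only through its universal property, its local rings are identified with
localizations of an explicit chart, the base change to `R` of the standard chart of the blowup of
affine space (`HasLocalBlowupProperty.exists_blowupCoordinates`). The chart is formally smooth
because `R` is formally smooth over the polynomial ring in the parameters, and it carries tangent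
vectors dual to the new coordinates. If `t` is the equation of `E`, an equation in `(x₁)` is divided
by `t` in passing to the strict transform, and one in `(x₂)` is unchanged. Testing with the tangent
vectors shows that `t` together with a minimal set of these equations is independent modulo `𝔪²`
(`BlowupCoordinates.strictTransform_formallySmooth`). Hence all intersections are smooth along `E`,
and `t` is transversal to the strict transforms; off `E` nothing changes. This gives the second and
third assertions (`IsBlowup.strictTransform_of_mem_exceptionalDivisor`).

For the first assertion, the same transversality keeps the generic point of a non-splayed component
of the strict transforms away from `E`, where `π` is an open immersion. Its image is therefore
generic in a non-splayed component of `S` other than `C`, and this assignment is injective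
(`IsBlowup.exists_nonSplayedComponent`).

The global properties of the blowup (finite type, separated, integral) also follow from the
universal property, by means of affine charts. -/

noncomputable section

namespace DivisorArrangement

/-! ### Formally smooth local algebras: dual derivations, smooth quotients, integrality. -/

section LocalAlgebra

open IsLocalRing KaehlerDifferential TensorProduct

/-- A local `k`-algebra essentially of finite type whose residue field is `k`. -/
class IsRationalLocal (k R : Type*) [Field k] [CommRing R] [Algebra k R] : Prop
    extends IsLocalRing R where
  essFiniteType : Algebra.EssFiniteType k R
  exists_sub_mem : ∀ r : R, ∃ c : k, r - algebraMap k R c ∈ maximalIdeal R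

attribute [instance] IsRationalLocal.essFiniteType

variable (k : Type*) {R : Type*} [Field k] [CommRing R] [Algebra k R]

lemma IsRationalLocal.isNoetherianRing (R : Type*) [CommRing R] [Algebra k R]
    [IsRationalLocal k R] : IsNoetherianRing R :=
  Algebra.EssFiniteType.isNoetherianRing k R

/-- The elements `x j` of the maximal ideal are linearly independent modulo its square. -/
def IndepModSq [IsLocalRing R] {ι : Type*} [Fintype ι] (x : ι → R) : Prop :=
  (∀ j, x j ∈ maximalIdeal R) ∧
    ∀ c : ι → k, ∑ j, algebraMap k R (c j) * x j ∈ maximalIdeal R ^ 2 → c = 0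

variable {k}

lemma algebraMap_residueField_bijective [IsRationalLocal k R] :
    Function.Bijective (algebraMap k (ResidueField R)) := by
  refine ⟨(algebraMap k (ResidueField R)).injective, fun a ↦ ?_⟩
  obtain ⟨r, rfl⟩ := IsLocalRing.residue_surjective a
  obtain ⟨c, hc⟩ := IsRationalLocal.exists_sub_mem (k := k) r
  refine ⟨c, ?_⟩
  rw [IsScalarTower.algebraMap_apply k R]
  exact ((Ideal.Quotient.mk_eq_mk_iff_sub_mem _ _).mpr hc).symm

instance [IsRationalLocal k R] : Algebra.FormallySmooth k (ResidueField R) :=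
  .of_equiv (AlgEquiv.ofBijective (Algebra.ofId k (ResidueField R))
    algebraMap_residueField_bijective)

/-- The residue field is formally smooth over `k`, so the conormal map from `𝔪 / 𝔪²` to the fibre of
`Ω[R⁄k]` is split injective and the differentials of the `x j` stay independent in the fibre. As
`Ω[R⁄k]` is finite free, they span a direct summand; the coordinates of a retraction, composed with
`D`, are the derivations. -/
lemma IndepModSq.exists_derivation [IsRationalLocal k R] [Algebra.FormallySmooth k R]
    {ι : Type*} [Fintype ι] [DecidableEq ι] {x : ι → R} (hx : IndepModSq k x) :
    ∃ d : ι → Derivation k R R, ∀ i j, d i (x j) = if i = j then 1 else 0 := by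
  have := IsRationalLocal.isNoetherianRing k R
  have hsurj : Function.Surjective (algebraMap R (ResidueField R)) := residue_surjective
  obtain ⟨s, hs⟩ := (Algebra.FormallySmooth.iff_split_injection (R := k) (P := R)
    (A := ResidueField R) hsurj).mp inferInstance
  have hker : RingHom.ker (algebraMap R (ResidueField R)) = maximalIdeal R :=
    IsLocalRing.ker_residue
  have : Module.Free R Ω[R⁄k] := Module.free_of_flat_of_isLocalRing
  let l : (ι → R) →ₗ[R] Ω[R⁄k] := Fintype.linearCombination R (fun j ↦ D k R (x j))
  have hl : Function.Injective (l.lTensor (ResidueField R)) := by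
    rw [← LinearMap.ker_eq_bot, LinearMap.ker_eq_bot']
    intro z hz
    obtain ⟨a, rfl⟩ := (TensorProduct.piScalarRight R R (ResidueField R) ι).symm.surjective z
    choose c hc using fun j ↦ algebraMap_residueField_bijective (k := k) (R := R) |>.2 (a j)
    obtain rfl : (fun j ↦ algebraMap k (ResidueField R) (c j)) = a := funext hc
    have key : ∑ j, algebraMap k R (c j) * x j ∈ maximalIdeal R ^ 2 := by
      have h1 : (TensorProduct.piScalarRight R R (ResidueField R) ι).symm
          (fun j ↦ algebraMap k (ResidueField R) (c j)) =
          ∑ j, (1 : ResidueField R) ⊗ₜ[R] (Pi.single j (algebraMap k R (c j)) : ι → R) := by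
        rw [LinearEquiv.symm_apply_eq]
        ext i
        simp only [map_sum, piScalarRight_apply, Finset.sum_apply, piScalarRightHom_tmul,
          Algebra.smul_def, mul_one, Pi.single_apply]
        rw [Finset.sum_eq_single i (fun b _ hb ↦ by rw [if_neg hb.symm, map_zero]) (by simp),
          if_pos rfl, ← IsScalarTower.algebraMap_apply]
      rw [h1, map_sum] at hz
      have h2 : ∀ j, x j ∈ RingHom.ker (algebraMap R (ResidueField R)) := fun j ↦ by
        rw [hker]; exact hx.1 j
      have h3 : (kerCotangentToTensor k R (ResidueField R))
          (Ideal.toCotangent _ (∑ j, algebraMap k R (c j) • ⟨x j, h2 j⟩)) = 0 := by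
        rw [← hz, map_sum, map_sum]
        refine Finset.sum_congr rfl fun j _ ↦ ?_
        rw [map_smul, map_smul, kerCotangentToTensor_toCotangent]
        simp [l, Fintype.linearCombination_apply_single]
      have h4 := congr(s $h3)
      rw [map_zero, ← LinearMap.comp_apply, hs, LinearMap.id_apply,
        Ideal.toCotangent_eq_zero] at h4
      rw [← hker]
      rw [AddSubmonoidClass.coe_finsetSum] at h4
      exact h4
    have := hx.2 c key
    subst this
    simp only [Pi.zero_apply, map_zero]
    exact map_zero _
  obtain ⟨l', hl'⟩ := (IsLocalRing.split_injective_iff_lTensor_residueField_injective l).mpr hl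
  refine ⟨fun i ↦ (LinearMap.proj i ∘ₗ l').compDer (D k R), fun i j ↦ ?_⟩
  have : l' (D k R (x j)) = Pi.single j 1 := by
    have := LinearMap.congr_fun hl' (Pi.single j 1)
    simpa [l, Fintype.linearCombination_apply_single] using this
  simp [this, Pi.single_apply]

/-- Perturbing an algebra homomorphism by derivations into a square-zero ideal. -/
def twistHom {B ι : Type*} [Fintype ι] [CommRing B] [Algebra k B] (φ : R →ₐ[k] B)
    (d : ι → Derivation k R R) (a : ι → B) (ha : ∀ i j, a i * a j = 0) : R →ₐ[k] B :=
  AlgHom.ofLinearMap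
    (φ.toLinearMap + ∑ i, LinearMap.mulRight k (a i) ∘ₗ φ.toLinearMap ∘ₗ (d i).toLinearMap)
    (by simp)
    (fun r s ↦ by
      have h0 (r : R) : (φ.toLinearMap + ∑ i, LinearMap.mulRight k (a i) ∘ₗ φ.toLinearMap ∘ₗ
          (d i).toLinearMap) r = φ r + ∑ i, φ (d i r) * a i := by simp
      have h1 : (∑ i, φ (d i r) * a i) * (∑ i, φ (d i s) * a i) = 0 := by
        rw [Finset.sum_mul_sum]
        refine Finset.sum_eq_zero fun i _ ↦ Finset.sum_eq_zero fun j _ ↦ ?_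
        linear_combination φ (d i r) * φ (d j s) * ha i j
      have h2 : ∑ i, φ (d i (r * s)) * a i =
          φ r * ∑ i, φ (d i s) * a i + φ s * ∑ i, φ (d i r) * a i := by
        rw [Finset.mul_sum, Finset.mul_sum, ← Finset.sum_add_distrib]
        refine Finset.sum_congr rfl fun i _ ↦ ?_
        simp only [Derivation.leibniz, smul_eq_mul, map_mul, map_add]
        ring
      rw [h0, h0, h0, h2, map_mul]
      linear_combination -h1)

lemma twistHom_apply {B ι : Type*} [Fintype ι] [CommRing B] [Algebra k B] (φ : R →ₐ[k] B)
    (d : ι → Derivation k R R) (a : ι → B) (ha : ∀ i j, a i * a j = 0) (r : R) :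
    twistHom φ d a ha r = φ r + ∑ i, φ (d i r) * a i := by
  simp [twistHom]

lemma twistHom_apply_of_dual {B ι : Type*} [Fintype ι] [DecidableEq ι] [CommRing B]
    [Algebra k B] (φ : R →ₐ[k] B) (d : ι → Derivation k R R) (a : ι → B)
    (ha : ∀ i j, a i * a j = 0) (x : ι → R) (hd : ∀ i j, d i (x j) = if i = j then 1 else 0)
    (j : ι) : twistHom φ d a ha (x j) = φ (x j) + a j := by
  simp [twistHom_apply, hd, apply_ite φ]

/-- If `R ⧸ J` is formally smooth then `J ∩ 𝔪² = 𝔪J`. -/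
lemma inf_sq_le_mul_of_formallySmooth {J m : Ideal R} (hJ : J ≤ m)
    [Algebra.FormallySmooth k (R ⧸ J)] : J ⊓ m ^ 2 ≤ m * J := by
  let q := Ideal.Quotient.mkₐ k (J ^ 2)
  let I : Ideal (R ⧸ J ^ 2) := J.map q
  have hI : IsNilpotent I := ⟨2, by
    rw [← Ideal.map_pow]; exact Ideal.map_quotient_self _⟩
  -- A section `s` of `R ⧸ J² → R ⧸ J`. The defect `q z - s z̄` obeys a product rule, so it sends
  -- `𝔪²` into `𝔪J`, while on `J` it is just `q`.
  obtain ⟨s, hs⟩ := Algebra.FormallySmooth.exists_lift (R := k) I hI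
    (DoubleQuot.quotQuotEquivQuotOfLEₐ k (Ideal.pow_le_self two_ne_zero : J ^ 2 ≤ J)).symm.toAlgHom
  have hs' (r : R) : q r - s (Ideal.Quotient.mk J r) ∈ I := by
    rw [← Ideal.Quotient.eq]
    exact congr($hs (Ideal.Quotient.mk J r)).symm
  have hIm : I ≤ m.map q := Ideal.map_mono hJ
  have key : ∀ z ∈ m ^ 2, q z - s (Ideal.Quotient.mk J z) ∈ (m * J).map q := by
    intro z hz
    rw [pow_two] at hz
    refine Submodule.mul_induction_on hz (fun x hx y hy ↦ ?_) (fun x y hx hy ↦ ?_)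
    · have h1 : s (Ideal.Quotient.mk J y) ∈ m.map q := by
        have := sub_mem (Ideal.mem_map_of_mem q hy) (hIm (hs' y))
        simpa using this
      have : q (x * y) - s (Ideal.Quotient.mk J (x * y)) =
          q x * (q y - s (Ideal.Quotient.mk J y)) +
          s (Ideal.Quotient.mk J y) * (q x - s (Ideal.Quotient.mk J x)) := by
        simp only [map_mul]; ring
      rw [this, Ideal.map_mul]
      exact add_mem (Ideal.mul_mem_mul (Ideal.mem_map_of_mem q hx) (hs' y))
        (Ideal.mul_mem_mul h1 (hs' x))
    · have := add_mem hx hy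
      simp only [map_add]
      convert this using 1
      ring
  intro z hz
  have h := key z hz.2
  rw [Ideal.Quotient.eq_zero_iff_mem.mpr hz.1, map_zero, sub_zero] at h
  have h2 : z ∈ ((m * J).map q).comap q := h
  rw [Ideal.comap_map_of_surjective' q (Ideal.Quotient.mkₐ_surjective k _)] at h2
  refine (sup_le le_rfl ?_ : _ ≤ m * J) h2
  rw [show RingHom.ker q = J ^ 2 from Ideal.mk_ker, pow_two]
  exact Ideal.mul_mono_left hJ

/-- Twisting the projection to `R ⧸ J²` by the dual derivations with coefficients `-x i` kills every
`x j`. The twisted map descends to a section of `R ⧸ J² → R ⧸ J`, which is the splitting criterion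
for smoothness. -/
lemma IndepModSq.formallySmooth_quotient [IsRationalLocal k R] [Algebra.FormallySmooth k R]
    {ι : Type*} [Fintype ι] {x : ι → R} (hx : IndepModSq k x) :
    Algebra.FormallySmooth k (R ⧸ Ideal.span (Set.range x)) := by
  classical
  obtain ⟨d, hd⟩ := hx.exists_derivation
  set J := Ideal.span (Set.range x) with hJ
  have hker : RingHom.ker (Ideal.Quotient.mkₐ k J).toRingHom = J := Ideal.mk_ker
  let q := Ideal.Quotient.mkₐ k (RingHom.ker (Ideal.Quotient.mkₐ k J).toRingHom ^ 2)
  have hxJ (i) : x i ∈ J := Ideal.subset_span ⟨i, rfl⟩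
  have ha (i j) : - q (x i) * - q (x j) = 0 := by
    rw [neg_mul_neg, ← map_mul, ← AlgHom.coe_toRingHom]
    refine Ideal.Quotient.eq_zero_iff_mem.mpr ?_
    rw [hker, pow_two]
    exact Ideal.mul_mem_mul (hxJ i) (hxJ j)
  let h := twistHom q d (fun i ↦ - q (x i)) ha
  have hdef (r) : h r = q r + ∑ i, q (d i r) * - q (x i) := twistHom_apply q d _ ha r
  have hh : ∀ r ∈ J, h r = 0 := by
    intro r hr
    change r ∈ RingHom.ker h
    revert r
    refine Ideal.span_le.mpr ?_
    rintro _ ⟨j, rfl⟩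
    exact (twistHom_apply_of_dual q d _ ha x hd j).trans (add_neg_cancel _)
  refine Algebra.FormallySmooth.of_split (Ideal.Quotient.mkₐ k J) (Ideal.Quotient.liftₐ J h hh) ?_
  ext r
  obtain ⟨r, rfl⟩ := Ideal.Quotient.mk_surjective r
  change (Ideal.Quotient.mkₐ k J).kerSquareLift (h r) = Ideal.Quotient.mk J r
  rw [hdef, map_add, map_sum]
  have h1 (y : R) : (Ideal.Quotient.mkₐ k J).kerSquareLift (q y) = Ideal.Quotient.mk J y := rfl
  rw [h1, Finset.sum_eq_zero, add_zero]
  intro i _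
  rw [map_mul, map_neg, h1, h1, Ideal.Quotient.eq_zero_iff_mem.mpr (hxJ i), neg_zero, mul_zero]

/-- Lift over `k` first. The lift misses the prescribed values of the variables by elements `a i` of
the square-zero ideal, and twisting by the dual derivations with coefficients `a i` corrects them
all at once. -/
lemma IndepModSq.formallySmooth_mvPolynomial [IsRationalLocal k R] [Algebra.FormallySmooth k R]
    {ι : Type*} [Fintype ι] {x : ι → R} (hx : IndepModSq k x) [Algebra (MvPolynomial ι k) R]
    [IsScalarTower k (MvPolynomial ι k) R]
    (hX : ∀ i, algebraMap (MvPolynomial ι k) R (.X i) = x i) :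
    Algebra.FormallySmooth (MvPolynomial ι k) R := by
  classical
  obtain ⟨d, hd⟩ := hx.exists_derivation
  refine Algebra.FormallySmooth.of_comp_surjective fun B _ _ I hI g ↦ ?_
  let : Algebra k B := ((algebraMap (MvPolynomial ι k) B).comp MvPolynomial.C).toAlgebra
  have : IsScalarTower k (MvPolynomial ι k) B := .of_algebraMap_eq' rfl
  have : IsScalarTower k (MvPolynomial ι k) (B ⧸ I) := .of_algebraMap_eq' rfl
  obtain ⟨φ, hφ⟩ := Algebra.FormallySmooth.exists_lift (R := k) I ⟨2, hI⟩ (g.restrictScalars k)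
  have hφ' (r : R) : Ideal.Quotient.mk I (φ r) = g r := congr($hφ r)
  let a (i : ι) : B := algebraMap (MvPolynomial ι k) B (.X i) - φ (x i)
  have ha (i) : a i ∈ I := by
    rw [← Ideal.Quotient.eq_zero_iff_mem, map_sub, hφ', ← hX, g.commutes, sub_eq_zero]
    rfl
  have ha' (i j) : a i * a j = 0 := by
    have := Ideal.mul_mem_mul (ha i) (ha j)
    rwa [← pow_two, hI] at this
  let h := twistHom φ d a ha'
  have hdef (r) : h r = φ r + ∑ i, φ (d i r) * a i := twistHom_apply φ d _ ha' r
  let h' : R →ₐ[MvPolynomial ι k] B :=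
    { h with
      commutes' := by
        intro p
        have : h.comp (IsScalarTower.toAlgHom k (MvPolynomial ι k) R) =
            IsScalarTower.toAlgHom k (MvPolynomial ι k) B := by
          ext i
          simp only [AlgHom.comp_apply, IsScalarTower.coe_toAlgHom', hX]
          exact (twistHom_apply_of_dual φ d _ ha' x hd i).trans (by simp [a])
        exact congr($this p) }
  refine ⟨h', AlgHom.ext fun r ↦ ?_⟩
  change Ideal.Quotient.mk I (h r) = g r
  rw [hdef, map_add, hφ', map_sum, Finset.sum_eq_zero, add_zero]
  intro i _
  rw [map_mul, Ideal.Quotient.eq_zero_iff_mem.mpr (ha i), mul_zero]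

lemma indepModSq_unit [IsRationalLocal k R] {x : R} (hx : x ∈ maximalIdeal R)
    (hx' : x ∉ maximalIdeal R ^ 2) : IndepModSq k (fun _ : Unit ↦ x) := by
  refine ⟨fun _ ↦ hx, fun c hc ↦ funext fun _ ↦ ?_⟩
  by_contra hne
  have hu : IsUnit (algebraMap k R (c ())) := (IsUnit.mk0 _ hne).map _
  simp only [Finset.univ_unique, Finset.sum_singleton] at hc
  exact hx' ((Ideal.unit_mul_mem_iff_mem _ hu).mp hc)

/-- A homomorphism with a prescribed first-order deformation in a nilpotent direction `X`. -/
lemma exists_algHom_deformation [IsRationalLocal k R] [Algebra.FormallySmooth k R]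
    {x : R} (hx : x ∈ maximalIdeal R) (hx' : x ∉ maximalIdeal R ^ 2) {C : Type*} [CommRing C]
    [Algebra k C] (X : C) (hX : IsNilpotent X) (e : R →ₐ[k] C) (he : e x = 0) :
    ∃ φ : R →ₐ[k] C, (∀ r, ∃ c, φ r = e r + c * X) ∧ ∃ u, IsUnit u ∧ φ x = X * u := by
  obtain ⟨d, hd⟩ := (indepModSq_unit (k := k) hx hx').exists_derivation
  obtain ⟨N, hN⟩ := hX
  -- Modulo `X²` the deformation is the explicit twist of `e` by a derivation `d` with `d x = 1`; it
  -- lifts to `C` because `X²` is nilpotent. The unit `u` is `1` plus a multiple of `X`.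
  let I : Ideal C := Ideal.span {X ^ 2}
  have hI : IsNilpotent I := ⟨N, by
    rw [Ideal.span_singleton_pow, ← pow_mul, mul_comm, pow_mul, hN, zero_pow two_ne_zero]
    simp⟩
  let ε : R →ₐ[k] C ⧸ I := (Ideal.Quotient.mkₐ k I).comp e
  have hX2 : Ideal.Quotient.mk I X * Ideal.Quotient.mk I X = 0 := by
    rw [← map_mul, ← pow_two]
    exact Ideal.Quotient.eq_zero_iff_mem.mpr (Ideal.mem_span_singleton_self _)
  obtain ⟨φ, hφ⟩ := Algebra.FormallySmooth.exists_lift (R := k) I hI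
    (twistHom ε d (fun _ ↦ Ideal.Quotient.mk I X) (fun _ _ ↦ hX2))
  refine ⟨φ, fun r ↦ ?_, ?_⟩
  · have h1 : Ideal.Quotient.mk I (φ r) = Ideal.Quotient.mk I (e r + e (d default r) * X) := by
      refine congr($hφ r).trans ?_
      rw [twistHom_apply, Finset.univ_unique, Finset.sum_singleton, map_add, map_mul]
      rfl
    rw [Ideal.Quotient.eq, Ideal.mem_span_singleton] at h1
    obtain ⟨v, hv⟩ := h1
    exact ⟨e (d default r) + v * X, by linear_combination hv⟩
  · have h1 : Ideal.Quotient.mk I (φ x) = Ideal.Quotient.mk I X := by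
      refine congr($hφ x).trans ?_
      rw [twistHom_apply_of_dual ε d _ _ (fun _ ↦ x) hd default]
      simp [ε, he]
    rw [Ideal.Quotient.eq, Ideal.mem_span_singleton] at h1
    obtain ⟨v, hv⟩ := h1
    refine ⟨1 + X * v, IsNilpotent.isUnit_one_add ⟨N, by rw [mul_pow, hN, zero_mul]⟩,
      by linear_combination hv⟩

/-- Apply the deformation `φ` of `e`: up to a unit `φ x` is `X`, and `φ s` differs from `e s` by a
multiple of `X`, whose product with `X ^ N` vanishes. -/
lemma map_mul_pow_eq_zero [IsRationalLocal k R] [Algebra.FormallySmooth k R]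
    {x : R} (hx : x ∈ maximalIdeal R) (hx' : x ∉ maximalIdeal R ^ 2) {s : R} {N : ℕ}
    (h : s * x ^ N = 0) {C : Type*} [CommRing C] [Algebra k C] (X : C) (hX : X ^ (N + 1) = 0)
    (e : R →ₐ[k] C) (he : e x = 0) : e s * X ^ N = 0 := by
  obtain ⟨φ, h1, u, hu, hxu⟩ := exists_algHom_deformation (k := k) hx hx' X ⟨N + 1, hX⟩ e he
  obtain ⟨c, hc⟩ := h1 s
  have h1 : φ s * X ^ N = 0 := by
    have : φ s * X ^ N * u ^ N = 0 := by
      rw [mul_assoc, ← mul_pow, ← hxu, ← map_pow, ← map_mul, h, map_zero]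
    exact (hu.pow N).mul_left_eq_zero.mp this
  linear_combination h1 - X ^ N * hc - c * hX

lemma mem_span_of_mul_pow_eq_zero [IsRationalLocal k R] [Algebra.FormallySmooth k R]
    {x : R} (hx : x ∈ maximalIdeal R) (hx' : x ∉ maximalIdeal R ^ 2) {s : R} {N : ℕ}
    (h : s * x ^ N = 0) : s ∈ Ideal.span {x} := by
  let Rb := R ⧸ Ideal.span {x}
  -- The universal test ring `(R ⧸ x)[X] / (X ^ (N + 1))`: there `s * X ^ N = 0` says that the
  -- coefficient of `X ^ N`, the class of `s`, vanishes.
  let mk := Ideal.Quotient.mkₐ k (Ideal.span {(Polynomial.X : Polynomial Rb) ^ (N + 1)})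
  have hXN : mk Polynomial.X ^ (N + 1) = 0 := by
    rw [← map_pow]
    exact Ideal.Quotient.eq_zero_iff_mem.mpr (Ideal.mem_span_singleton_self _)
  have h1 := map_mul_pow_eq_zero (k := k) hx hx' h (mk Polynomial.X) hXN
    ((mk.comp (IsScalarTower.toAlgHom k Rb (Polynomial Rb))).comp (Ideal.Quotient.mkₐ k _)) (by
      have : Ideal.Quotient.mkₐ k (Ideal.span {x}) x = 0 :=
        Ideal.Quotient.eq_zero_iff_mem.mpr (Ideal.mem_span_singleton_self _)
      rw [AlgHom.comp_apply, this, map_zero])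
  have h2 : mk (Polynomial.C (Ideal.Quotient.mk _ s) * Polynomial.X ^ N) = 0 := by
    rw [map_mul, map_pow]
    exact h1
  replace h2 := Ideal.Quotient.eq_zero_iff_mem.mp h2
  rw [Ideal.mem_span_singleton, Polynomial.X_pow_dvd_iff] at h2
  have := h2 N (Nat.lt_succ_self N)
  rw [Polynomial.coeff_C_mul_X_pow, if_pos rfl] at this
  exact Ideal.Quotient.eq_zero_iff_mem.mp this

/-- An element killed by `x` is divisible by every power of `x`, one factor at a time by
`mem_span_of_mul_pow_eq_zero`, so it is zero by Krull's intersection theorem. -/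
lemma mem_nonZeroDivisors_of_notMem_sq [IsRationalLocal k R] [Algebra.FormallySmooth k R]
    {x : R} (hx : x ∈ maximalIdeal R) (hx' : x ∉ maximalIdeal R ^ 2) :
    x ∈ nonZeroDivisors R := by
  have := IsRationalLocal.isNoetherianRing k R
  rw [mem_nonZeroDivisors_iff_right]
  intro s hs
  have key : ∀ n : ℕ, ∃ s', s = s' * x ^ n := by
    intro n
    induction n with
    | zero => exact ⟨s, by simp⟩
    | succ n ih =>
      obtain ⟨s', rfl⟩ := ih
      have h1 : s' * x ^ (n + 1) = 0 := by rw [← hs]; ring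
      obtain ⟨t, rfl⟩ := Ideal.mem_span_singleton'.mp
        (mem_span_of_mul_pow_eq_zero (k := k) hx hx' h1)
      exact ⟨t, by ring⟩
  have h2 : s ∈ (⨅ n : ℕ, maximalIdeal R ^ n) := by
    rw [Ideal.mem_iInf]
    intro n
    obtain ⟨s', rfl⟩ := key n
    exact Ideal.mul_mem_left _ _ (Ideal.pow_mem_pow hx n)
  rwa [Ideal.iInf_pow_eq_bot_of_isLocalRing _ (maximalIdeal.isMaximal R).ne_top] at h2

instance IsRationalLocal.quotient [IsRationalLocal k R] (J : Ideal R) [Nontrivial (R ⧸ J)] :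
    IsRationalLocal k (R ⧸ J) where
  toIsLocalRing := .of_surjective' _ Ideal.Quotient.mk_surjective
  essFiniteType := .comp k R _
  exists_sub_mem r := by
    have : IsLocalRing (R ⧸ J) := .of_surjective' _ Ideal.Quotient.mk_surjective
    obtain ⟨r, rfl⟩ := Ideal.Quotient.mk_surjective r
    obtain ⟨c, hc⟩ := IsRationalLocal.exists_sub_mem (k := k) r
    refine ⟨c, ?_⟩
    rw [← IsLocalRing.map_maximalIdeal_of_surjective _ (Ideal.Quotient.mk_surjective (I := J))]
    exact Ideal.mem_map_of_mem (Ideal.Quotient.mk J) hc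

/-- Induction on the number of generators of `𝔪`. A generator in `𝔪²` is redundant by Nakayama.
Otherwise `R ⧸ (x 0)` is smooth with fewer generators, so `(x 0)` is prime, and it is generated by a
nonzerodivisor. -/
lemma isDomain_of_maximalIdeal_eq_span (n : ℕ) (R : Type*) [CommRing R] [Algebra k R]
    [IsRationalLocal k R] [Algebra.FormallySmooth k R] (x : Fin n → R)
    (hx : maximalIdeal R = Ideal.span (Set.range x)) : IsDomain R := by
  induction n generalizing R with
  | zero =>
    have : maximalIdeal R = ⊥ := by rw [hx]; simp
    exact (IsLocalRing.isField_iff_maximalIdeal_eq.mpr this).isDomain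
  | succ n ih =>
    have := IsRationalLocal.isNoetherianRing k R
    have hx0 : x 0 ∈ maximalIdeal R := by rw [hx]; exact Ideal.subset_span ⟨0, rfl⟩
    have hsup : maximalIdeal R = Ideal.span (Set.range (Fin.tail x)) ⊔ Ideal.span {x 0} := by
      rw [hx, ← Ideal.span_union, Set.union_comm, Set.singleton_union, ← Fin.range_cons,
        Fin.cons_self_tail]
    by_cases h2 : x 0 ∈ maximalIdeal R ^ 2
    · refine ih R (Fin.tail x) (le_antisymm ?_ (by rw [hsup]; exact le_sup_left))
      refine Submodule.le_of_le_smul_of_le_jacobson_bot (I := maximalIdeal R)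
        (IsNoetherian.noetherian _) (IsLocalRing.maximalIdeal_le_jacobson _) ?_
      conv_lhs => rw [hsup]
      refine sup_le_sup le_rfl ?_
      rw [Ideal.span_singleton_le_iff_mem, smul_eq_mul, ← pow_two]
      exact h2
    · have hsm := (indepModSq_unit (k := k) hx0 h2).formallySmooth_quotient
      rw [Set.range_const] at hsm
      have hne : Ideal.span {x 0} ≠ ⊤ := fun h ↦
        (maximalIdeal.isMaximal R).ne_top
          (top_le_iff.mp (h ▸ (Ideal.span_singleton_le_iff_mem _).mpr hx0))
      have : Nontrivial (R ⧸ Ideal.span {x 0}) := Ideal.Quotient.nontrivial_iff.mpr hne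
      have hdom := ih (R ⧸ Ideal.span {x 0}) (fun i ↦ Ideal.Quotient.mk _ (Fin.tail x i)) (by
        rw [← IsLocalRing.map_maximalIdeal_of_surjective _
          (Ideal.Quotient.mk_surjective (I := Ideal.span {x 0})), hsup, Ideal.map_sup,
          Ideal.map_quotient_self, sup_bot_eq, Ideal.map_span, ← Set.range_comp]
        rfl)
      have hprime : (Ideal.span {x 0}).IsPrime := (Ideal.Quotient.isDomain_iff_prime _).mp hdom
      have hnzd := mem_nonZeroDivisors_of_notMem_sq (k := k) hx0 h2
      -- A minimal prime `Q` inside `(x 0)` cannot contain the nonzerodivisor `x 0`. Writing `y ∈ Q`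
      -- as `z * x 0` puts `z` in `Q`, so `Q = 𝔪Q` and Nakayama gives `Q = 0`.
      obtain ⟨Q, hQ, hQle⟩ := Ideal.exists_minimalPrimes_le (bot_le : ⊥ ≤ Ideal.span {x 0})
      have hQp : Q.IsPrime := hQ.1.1
      have hxQ : x 0 ∉ Q := fun h ↦
        Set.disjoint_left.mp (Ideal.disjoint_nonZeroDivisors_of_mem_minimalPrimes hQ) h hnzd
      have hQ0 : Q = ⊥ := by
        refine Submodule.eq_bot_of_le_smul_of_le_jacobson_bot (maximalIdeal R) Q
          (IsNoetherian.noetherian _) ?_ (IsLocalRing.maximalIdeal_le_jacobson _)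
        intro y hy
        obtain ⟨z, rfl⟩ := Ideal.mem_span_singleton'.mp (hQle hy)
        rw [mul_comm, smul_eq_mul]
        exact Ideal.mul_mem_mul hx0 ((hQp.mem_or_mem hy).resolve_right hxQ)
      subst hQ0
      exact (IsDomain.of_bot_isPrime R)

lemma isDomain_of_formallySmooth (k R : Type*) [Field k] [CommRing R] [Algebra k R]
    [IsRationalLocal k R] [Algebra.FormallySmooth k R] : IsDomain R := by
  have := IsRationalLocal.isNoetherianRing k R
  obtain ⟨n, x, hx⟩ := Submodule.fg_iff_exists_fin_generating_family.mp
    (IsNoetherian.noetherian (maximalIdeal R))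
  exact isDomain_of_maximalIdeal_eq_span (k := k) n R x hx.symm

end LocalAlgebra

/-! ### Images of ideals modulo `𝔪²`, and local coordinates on a blowup. -/

section LocalAlgebra

open IsLocalRing

variable {k : Type*} {R : Type*} [Field k] [CommRing R] [Algebra k R]

lemma indepModSq_iff_linearIndependent [IsLocalRing R] {ι : Type*} [Fintype ι] {x : ι → R} :
    IndepModSq k x ↔ (∀ j, x j ∈ maximalIdeal R) ∧
      LinearIndependent k (fun j ↦ Ideal.Quotient.mkₐ k (maximalIdeal R ^ 2) (x j)) := by
  refine and_congr Iff.rfl ?_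
  rw [Fintype.linearIndependent_iff]
  refine forall_congr' fun c ↦ ?_
  rw [← Ideal.Quotient.eq_zero_iff_mem, ← Ideal.Quotient.mkₐ_eq_mk k, map_sum, funext_iff]
  simp only [← Algebra.smul_def, map_smul, Pi.zero_apply]

lemma IndepModSq.comp [IsLocalRing R] {ι κ : Type*} [Fintype ι] [Fintype κ] {x : ι → R}
    (hx : IndepModSq k x) (a : κ → ι) (ha : Function.Injective a) : IndepModSq k (x ∘ a) := by
  rw [indepModSq_iff_linearIndependent] at hx ⊢
  exact ⟨fun j ↦ hx.1 _, hx.2.comp a ha⟩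

variable (k) in
/-- The image of an ideal in `R ⧸ 𝔪²`, as a `k`-subspace. -/
def cot [IsLocalRing R] (J : Ideal R) : Submodule k (R ⧸ maximalIdeal R ^ 2) :=
  (J.restrictScalars k).map (Ideal.Quotient.mkₐ k (maximalIdeal R ^ 2)).toLinearMap

lemma mem_cot [IsLocalRing R] {J : Ideal R} {z : R ⧸ maximalIdeal R ^ 2} :
    z ∈ cot k J ↔ ∃ r ∈ J, Ideal.Quotient.mk _ r = z := Iff.rfl

lemma mk_mem_cot [IsLocalRing R] {J : Ideal R} {r : R} :
    Ideal.Quotient.mk _ r ∈ cot k J ↔ r ∈ J ⊔ maximalIdeal R ^ 2 := by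
  rw [mem_cot, Submodule.mem_sup]
  constructor
  · rintro ⟨s, hs, h⟩
    exact ⟨s, hs, r - s, by rw [← Ideal.Quotient.eq]; exact h.symm, by ring⟩
  · rintro ⟨s, hs, z, hz, rfl⟩
    exact ⟨s, hs, by rw [map_add, Ideal.Quotient.eq_zero_iff_mem.mpr hz, add_zero]⟩

lemma cot_mono [IsLocalRing R] {I J : Ideal R} (h : I ≤ J) : cot k I ≤ cot k J :=
  Submodule.map_mono h

lemma cot_iSup [IsLocalRing R] {ι : Type*} (J : ι → Ideal R) :
    cot k (⨆ i, J i) = ⨆ i, cot k (J i) := by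
  refine le_antisymm ?_ (iSup_le fun i ↦ cot_mono (le_iSup J i))
  rintro _ ⟨r, hr, rfl⟩
  change Ideal.Quotient.mk _ r ∈ _
  refine Submodule.iSup_induction J
    (motive := fun r ↦ Ideal.Quotient.mk _ r ∈ ⨆ i, cot k (J i)) hr (fun i x hx ↦ ?_) ?_ ?_
  · exact (le_iSup (fun i ↦ cot k (J i)) i) ⟨x, hx, rfl⟩
  · rw [map_zero]; exact zero_mem _
  · intro x y hx hy; rw [map_add]; exact add_mem hx hy

lemma cot_sup [IsLocalRing R] (I J : Ideal R) : cot k (I ⊔ J) = cot k I ⊔ cot k J := by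
  rw [sup_eq_iSup, cot_iSup, sup_eq_iSup]
  exact iSup_congr fun b ↦ by cases b <;> rfl

lemma cot_eq_bot_iff [IsLocalRing R] {J : Ideal R} : cot k J = ⊥ ↔ J ≤ maximalIdeal R ^ 2 := by
  rw [eq_bot_iff]
  constructor
  · intro h r hr
    exact Ideal.Quotient.eq_zero_iff_mem.mp (h (mem_cot.mpr ⟨r, hr, rfl⟩))
  · rintro h _ ⟨r, hr, rfl⟩
    exact Ideal.Quotient.eq_zero_iff_mem.mpr (h hr)

/-- A coefficient in `R` may be replaced by its constant term, since the error lies in `𝔪` and the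
generators do too. -/
lemma cot_span [IsRationalLocal k R] {s : Set R} (hs : s ⊆ maximalIdeal R) :
    cot k (Ideal.span s) = Submodule.span k (Ideal.Quotient.mkₐ k (maximalIdeal R ^ 2) '' s) := by
  refine le_antisymm ?_ (Submodule.span_le.mpr ?_)
  · rintro _ ⟨r, hr, rfl⟩
    change Ideal.Quotient.mkₐ k _ r ∈ _
    refine Submodule.span_induction (p := fun r _ ↦ Ideal.Quotient.mkₐ k _ r ∈
      Submodule.span k (Ideal.Quotient.mkₐ k (maximalIdeal R ^ 2) '' s)) ?_ ?_ ?_ ?_ hr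
    · exact fun x hx ↦ Submodule.subset_span ⟨x, hx, rfl⟩
    · rw [map_zero]; exact zero_mem _
    · intro x y _ _ hx hy; rw [map_add]; exact add_mem hx hy
    · intro a x hx' hx
      obtain ⟨c, hc⟩ := IsRationalLocal.exists_sub_mem (k := k) a
      have hxm : x ∈ maximalIdeal R := Ideal.span_le.mpr hs hx'
      have : Ideal.Quotient.mkₐ k (maximalIdeal R ^ 2) (a • x) =
          c • Ideal.Quotient.mkₐ k (maximalIdeal R ^ 2) x := by
        rw [← map_smul, Ideal.Quotient.mkₐ_eq_mk, Ideal.Quotient.eq, smul_eq_mul,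
          Algebra.smul_def, ← sub_mul, pow_two]
        exact Ideal.mul_mem_mul hc hxm
      rw [this]
      exact Submodule.smul_mem _ _ hx
  · rintro _ ⟨x, hx, rfl⟩
    exact ⟨x, Ideal.subset_span hx, rfl⟩

/-- Nakayama: an ideal with formally smooth quotient is generated by any subideal with the same
image in `𝔪 / 𝔪²`. -/
lemma eq_of_cot_le [IsRationalLocal k R] {I J : Ideal R} (hIJ : I ≤ J) (hJ : J ≤ maximalIdeal R)
    [Algebra.FormallySmooth k (R ⧸ J)] (h : cot k J ≤ cot k I) : I = J := by
  have := IsRationalLocal.isNoetherianRing k R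
  refine le_antisymm hIJ ?_
  refine Submodule.le_of_le_smul_of_le_jacobson_bot (I := maximalIdeal R)
    (IsNoetherian.noetherian _) (IsLocalRing.maximalIdeal_le_jacobson _) ?_
  intro r hr
  have h1 : r ∈ I ⊔ maximalIdeal R ^ 2 := mk_mem_cot.mp (h (mem_cot.mpr ⟨r, hr, rfl⟩))
  obtain ⟨s, hs, z, hz, rfl⟩ := Submodule.mem_sup.mp h1
  have hzJ : z ∈ J := by simpa using sub_mem hr (hIJ hs)
  exact add_mem (Submodule.mem_sup_left hs)
    (Submodule.mem_sup_right (inf_sq_le_mul_of_formallySmooth (k := k) hJ ⟨hzJ, hz⟩))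

/-- Pick a subfamily whose images form a basis of the span modulo `𝔪²`; by `eq_of_cot_le` it already
generates the ideal. Selecting from the given family keeps the generators equations of actual
divisors. -/
lemma exists_indepModSq_span_eq [IsRationalLocal k R] {ι : Type*} [Finite ι] (f : ι → R)
    (hf : ∀ i, f i ∈ maximalIdeal R)
    [Algebra.FormallySmooth k (R ⧸ Ideal.span (Set.range f))] :
    ∃ (n : ℕ) (a : Fin n → ι), IndepModSq k (f ∘ a) ∧
      Ideal.span (Set.range (f ∘ a)) = Ideal.span (Set.range f) := by
  obtain ⟨κ, a, ha, hspan, hli⟩ := exists_linearIndependent' k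
    (fun i ↦ Ideal.Quotient.mkₐ k (maximalIdeal R ^ 2) (f i))
  have : Finite κ := Finite.of_injective a ha
  obtain ⟨n, ⟨e⟩⟩ := Finite.exists_equiv_fin κ
  refine ⟨n, a ∘ e.symm, ?_, ?_⟩
  · rw [indepModSq_iff_linearIndependent]
    exact ⟨fun j ↦ hf _, hli.comp e.symm e.symm.injective⟩
  · have hr : Set.range (f ∘ a ∘ e.symm) = Set.range (f ∘ a) := by
      rw [← Function.comp_assoc, Set.range_comp, e.symm.surjective.range_eq, Set.image_univ]
    rw [hr]
    refine eq_of_cot_le (k := k) (Ideal.span_mono (Set.range_comp_subset_range _ _)) ?_ ?_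
    · rw [Ideal.span_le]; rintro _ ⟨i, rfl⟩; exact hf i
    · rw [cot_span (by rintro _ ⟨i, rfl⟩; exact hf i), cot_span (by rintro _ ⟨i, rfl⟩; exact hf _),
        ← Set.range_comp, ← Set.range_comp]
      exact hspan.ge

/-- Local coordinates on a blowup: `R` is a local ring of the base with parameters `x`, of which
the first kind cut out the centre, and `R'` is a local ring of the blowup over it. The exceptional
divisor is cut out by `x (inl i₀)`, `z j` are the quotients `x (inl j) / x (inl i₀)`, and `θ` are
tangent vectors dual to the coordinates. -/
structure BlowupCoordinates (k R R' : Type*) [Field k] [CommRing R] [Algebra k R] [CommRing R']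
    [Algebra k R'] [Algebra R R'] [IsLocalRing R] [IsLocalRing R'] (ι₁ ι₂ : Type*)
    [DecidableEq ι₁] [DecidableEq ι₂] where
  x : ι₁ ⊕ ι₂ → R
  x_mem : ∀ j, x j ∈ maximalIdeal R
  i₀ : ι₁
  z : ι₁ → R'
  map_x_inl : ∀ j, algebraMap R R' (x (.inl j)) = algebraMap R R' (x (.inl i₀)) * z j
  z_i₀ : z i₀ = 1
  map_mem : ∀ r ∈ maximalIdeal R, algebraMap R R' r ∈ maximalIdeal R'
  θ₁ : ι₁ → R' →ₐ[k] DualNumber k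
  θ₁_z : ∀ j l, j ≠ i₀ → l ≠ i₀ → (θ₁ j (z l)).snd = if j = l then 1 else 0
  θ₁_map : ∀ j, j ≠ i₀ → ∀ r, (θ₁ j (algebraMap R R' r)).snd = 0
  θ₁_i₀ : (θ₁ i₀ (algebraMap R R' (x (.inl i₀)))).snd = 1
  θ₂ : ι₂ → R' →ₐ[k] DualNumber k
  θ₂_i₀ : ∀ j, (θ₂ j (algebraMap R R' (x (.inl i₀)))).snd = 0
  θ₂_inr : ∀ j l, (θ₂ j (algebraMap R R' (x (.inr l)))).snd = if j = l then 1 else 0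

/-- With a nonzero constant term `c`, the element `r - c` would be a unit whose image has constant
term zero. -/
lemma fst_eq_zero_of_mem [IsRationalLocal k R] (θ : R →ₐ[k] DualNumber k) {r : R}
    (hr : r ∈ maximalIdeal R) : (θ r).fst = 0 := by
  by_contra h
  have h1 : r - algebraMap k R (θ r).fst ∉ maximalIdeal R := fun h2 ↦ by
    have h3 := sub_mem hr h2
    rw [sub_sub_cancel] at h3
    exact h3 ((IsUnit.mk0 _ h).map _)
  have h2 : IsUnit (r - algebraMap k R (θ r).fst) := by simpa using h1
  have h3 := (h2.map θ).map (TrivSqZeroExt.fstHom k k k)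
  rw [map_sub, map_sub, AlgHom.commutes, AlgHom.commutes] at h3
  simp at h3

lemma snd_eq_zero_of_mem_sq [IsRationalLocal k R] (θ : R →ₐ[k] DualNumber k) {r : R}
    (hr : r ∈ maximalIdeal R ^ 2) : (θ r).snd = 0 := by
  rw [pow_two] at hr
  refine Submodule.mul_induction_on hr (fun x hx y hy ↦ ?_) (fun x y hx hy ↦ ?_)
  · rw [map_mul, TrivSqZeroExt.snd_mul, fst_eq_zero_of_mem θ hx, fst_eq_zero_of_mem θ hy]
    simp
  · rw [map_add, TrivSqZeroExt.snd_add, hx, hy, add_zero]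

lemma fst_eq_of_sub_mem [IsRationalLocal k R] (θ : R →ₐ[k] DualNumber k) {r : R} {c : k}
    (hr : r - algebraMap k R c ∈ maximalIdeal R) : (θ r).fst = c := by
  have := fst_eq_zero_of_mem θ hr
  rw [map_sub, TrivSqZeroExt.fst_sub, AlgHom.commutes] at this
  exact sub_eq_zero.mp this

lemma sum_mul_mem_sq [IsRationalLocal k R] {σ τ : Type*} [Fintype σ] [Fintype τ] (γ : σ → τ → R)
    (G : σ → τ → k) (hG : ∀ i j, γ i j - algebraMap k R (G i j) ∈ maximalIdeal R) (y : τ → R)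
    (hy : ∀ j, y j ∈ maximalIdeal R) (e : σ → k) (he : ∀ j, ∑ i, e i * G i j = 0) :
    ∑ i, algebraMap k R (e i) * ∑ j, γ i j * y j ∈ maximalIdeal R ^ 2 := by
  simp_rw [Finset.mul_sum]
  rw [Finset.sum_comm]
  refine sum_mem fun j _ ↦ ?_
  simp_rw [← mul_assoc]
  rw [← Finset.sum_mul, pow_two]
  refine Ideal.mul_mem_mul ?_ (hy j)
  have : ∑ i, algebraMap k R (e i) * γ i j =
      ∑ i, algebraMap k R (e i) * (γ i j - algebraMap k R (G i j)) := by
    have h2 := congr(algebraMap k R $(he j))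
    simp only [map_sum, map_mul, map_zero] at h2
    simp only [mul_sub, Finset.sum_sub_distrib, h2, sub_zero]
  rw [this]
  exact sum_mem fun i _ ↦ Ideal.mul_mem_left _ _ (hG i j)

lemma span_sumElim {R : Type*} [CommRing R] {a b : Type*} (u : a → R) (v : b → R) :
    Ideal.span (Set.range (Sum.elim u v)) =
      Ideal.span (Set.range u) ⊔ Ideal.span (Set.range v) := by
  rw [Set.Sum.elim_range, Ideal.span_union]

namespace BlowupCoordinates

variable {R' : Type*} [CommRing R'] [Algebra k R'] [Algebra R R'] [IsScalarTower k R R']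
  [IsRationalLocal k R] [IsRationalLocal k R'] {ι₁ ι₂ : Type*} [Fintype ι₁] [Fintype ι₂]
  [DecidableEq ι₁] [DecidableEq ι₂]
  (X : BlowupCoordinates k R R' ι₁ ι₂)

/-- The equation of the exceptional divisor. -/
def t : R' := algebraMap R R' (X.x (.inl X.i₀))

/-- A relation modulo `𝔪'²` with coefficients `c₀`, `l`, `m` is differentiated along each tangent
vector. The vectors `θ₁ j` with `j ≠ i₀`, together with the vanishing of the strict transforms at
the point, reduce `l` to a relation among the original equations. Then `θ₂` does the same for `m`,
and `θ₁ i₀` finally isolates `c₀`. -/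
lemma indepModSq {a b : Type*} [Fintype a] [Fintype b] (α : a → ι₁ → R) (β : b → ι₂ → R)
    (hf : IndepModSq k (fun i ↦ ∑ j, α i j * X.x (.inl j)))
    (hg : IndepModSq k (fun i ↦ ∑ j, β i j * X.x (.inr j)))
    (hf' : ∀ i, ∑ j, algebraMap R R' (α i j) * X.z j ∈ maximalIdeal R') :
    IndepModSq k (Sum.elim (fun _ : Unit ↦ X.t)
      (Sum.elim (fun i ↦ ∑ j, algebraMap R R' (α i j) * X.z j)
        (fun i ↦ ∑ j, algebraMap R R' (β i j) * algebraMap R R' (X.x (.inr j))))) := by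
  classical
  choose A hA using fun i j ↦ IsRationalLocal.exists_sub_mem (k := k) (α i j)
  choose B hB using fun i j ↦ IsRationalLocal.exists_sub_mem (k := k) (β i j)
  have hA' (i j) : algebraMap R R' (α i j) - algebraMap k R' (A i j) ∈ maximalIdeal R' := by
    rw [IsScalarTower.algebraMap_apply k R R', ← map_sub]
    exact X.map_mem _ (hA i j)
  have hB' (i j) : algebraMap R R' (β i j) - algebraMap k R' (B i j) ∈ maximalIdeal R' := by
    rw [IsScalarTower.algebraMap_apply k R R', ← map_sub]
    exact X.map_mem _ (hB i j)
  refine ⟨?_, fun c hc ↦ ?_⟩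
  · rintro (_ | i | i)
    · exact X.map_mem _ (X.x_mem _)
    · exact hf' i
    · exact sum_mem fun j _ ↦ Ideal.mul_mem_left _ _ (X.map_mem _ (X.x_mem _))
  obtain ⟨c₀, hc₀⟩ : ∃ c₀, c₀ = c (.inl ()) := ⟨_, rfl⟩
  obtain ⟨l, hl⟩ : ∃ l : a → k, l = fun i ↦ c (.inr (.inl i)) := ⟨_, rfl⟩
  obtain ⟨m, hm⟩ : ∃ m : b → k, m = fun i ↦ c (.inr (.inr i)) := ⟨_, rfl⟩
  rw [Fintype.sum_sum_type, Fintype.sum_sum_type] at hc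
  simp only [Finset.univ_unique, Finset.sum_singleton, Sum.elim_inl, Sum.elim_inr] at hc
  have hc' (θ : R' →ₐ[k] DualNumber k) : c₀ * (θ X.t).snd +
      (∑ i, l i * ∑ j, (A i j * (θ (X.z j)).snd +
        (θ (algebraMap R R' (α i j))).snd * (θ (X.z j)).fst) +
       ∑ i, m i * ∑ j, B i j * (θ (algebraMap R R' (X.x (.inr j)))).snd) = 0 := by
    have := snd_eq_zero_of_mem_sq θ hc
    have hx0 (j) : (θ (algebraMap R R' (X.x (.inr j)))).fst = 0 :=
      fst_eq_zero_of_mem θ (X.map_mem _ (X.x_mem _))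
    have hsnd (e : k) (w : DualNumber k) :
        (algebraMap k (DualNumber k) e * w).snd = e * w.snd := by
      rw [← Algebra.smul_def]; rfl
    simp only [map_add, map_sum, map_mul, AlgHom.commutes, TrivSqZeroExt.snd_add, hsnd,
      TrivSqZeroExt.snd_sum, TrivSqZeroExt.snd_mul, hx0,
      fst_eq_of_sub_mem θ (hA' _ _), fst_eq_of_sub_mem θ (hB' _ _)] at this
    simpa [hc₀, hl, hm, mul_comm] using this
  have hl1 (j : ι₁) (hj : j ≠ X.i₀) : ∑ i, l i * A i j = 0 := by
    have := hc' (X.θ₁ j)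
    simp only [X.θ₁_map j hj, t, mul_zero, zero_mul, add_zero, Finset.sum_const_zero,
      zero_add] at this
    rw [← this]
    refine Finset.sum_congr rfl fun i _ ↦ ?_
    rw [Finset.sum_eq_single j, X.θ₁_z j j hj hj, if_pos rfl, mul_one]
    · intro b _ hb
      by_cases hb0 : b = X.i₀
      · rw [hb0, X.z_i₀, map_one, TrivSqZeroExt.snd_one, mul_zero]
      · rw [X.θ₁_z j b hj hb0, if_neg (Ne.symm hb), mul_zero]
    · simp
  -- No tangent vector sees column `i₀`, because `z i₀ = 1`. Instead, since the strict transforms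
  -- vanish at the point, this column is a combination of the others with coefficients the values of
  -- the `z j`.
  have hl2 : ∑ i, l i * A i X.i₀ = 0 := by
    have h1 (i) : A i X.i₀ = - ∑ j ∈ Finset.univ.erase X.i₀, A i j * (X.θ₁ X.i₀ (X.z j)).fst := by
      have := fst_eq_zero_of_mem (X.θ₁ X.i₀) (hf' i)
      rw [map_sum, TrivSqZeroExt.fst_sum] at this
      simp only [map_mul, TrivSqZeroExt.fst_mul, fst_eq_of_sub_mem _ (hA' _ _)] at this
      rw [← Finset.add_sum_erase _ _ (Finset.mem_univ X.i₀), X.z_i₀, map_one,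
        TrivSqZeroExt.fst_one, mul_one] at this
      exact eq_neg_of_add_eq_zero_left this
    simp_rw [h1, mul_neg, Finset.sum_neg_distrib, Finset.mul_sum]
    rw [Finset.sum_comm, neg_eq_zero]
    refine Finset.sum_eq_zero fun j hj ↦ ?_
    simp_rw [← mul_assoc]
    rw [← Finset.sum_mul, hl1 j (Finset.ne_of_mem_erase hj), zero_mul]
  have hl0 : l = 0 := hf.2 l (sum_mul_mem_sq α A hA _ (fun _ ↦ X.x_mem _) l (fun j ↦ by
    by_cases hj : j = X.i₀
    · rw [hj, hl2]
    · exact hl1 j hj))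
  have hm0 : m = 0 := hg.2 m (sum_mul_mem_sq β B hB _ (fun _ ↦ X.x_mem _) m (fun j ↦ by
    have := hc' (X.θ₂ j)
    simpa [hl0, t, X.θ₂_i₀, X.θ₂_inr] using this))
  have hc0 : c₀ = 0 := by
    have := hc' (X.θ₁ X.i₀)
    simpa [hl0, hm0, t, X.θ₁_i₀] using this
  ext (_ | i | i)
  · exact hc₀.symm.trans hc0
  · exact (congrFun hl i).symm.trans (congrFun hl0 i)
  · exact (congrFun hm i).symm.trans (congrFun hm0 i)

lemma t_ne_zero : X.t ≠ 0 := fun h ↦ by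
  have := X.θ₁_i₀
  rw [show algebraMap R R' _ = 0 from h, map_zero] at this
  simp at this

/-- The structure of the strict transforms `f'` of the divisors `f` at a point of the exceptional
divisor: `K` are the divisors that contain the centre. -/
theorem strictTransform_formallySmooth [Algebra.FormallySmooth k R'] {ι : Type*} [Finite ι]
    {f : ι → R} (hf : ∀ i, f i ∈ maximalIdeal R) {K : Set ι}
    (hfs : ∀ T : Set ι, T ⊆ K ∨ T ⊆ Kᶜ → Algebra.FormallySmooth k (R ⧸ Ideal.span (f '' T)))
    (hx₁ : ∀ i ∈ K, f i ∈ Ideal.span (Set.range fun j ↦ X.x (.inl j)))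
    (hx₂ : ∀ i ∉ K, f i ∈ Ideal.span (Set.range fun j ↦ X.x (.inr j)))
    {f' : ι → R'} (hf₁ : ∀ i ∈ K, algebraMap R R' (f i) = X.t * f' i)
    (hf₂ : ∀ i ∉ K, f' i = algebraMap R R' (f i))
    {T : Set ι} (hT : ∀ i ∈ T, f' i ∈ maximalIdeal R') :
    Algebra.FormallySmooth k (R' ⧸ Ideal.span (f' '' T)) ∧
    Algebra.FormallySmooth k (R' ⧸ (Ideal.span {X.t} ⊔ Ideal.span (f' '' T))) ∧
    X.t ∉ Ideal.span (f' '' T) ⊔ maximalIdeal R' ^ 2 := by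
  have : IsDomain R' := isDomain_of_formallySmooth k R'
  have h1 := hfs (T ∩ K) (.inl Set.inter_subset_right)
  have h2 := hfs (T ∩ Kᶜ) (.inr Set.inter_subset_right)
  rw [Set.image_eq_range] at h1 h2
  obtain ⟨n₁, a₁, hi₁, hs₁⟩ := exists_indepModSq_span_eq (k := k)
    (fun i : (T ∩ K : Set ι) ↦ f i) (fun i ↦ hf i)
  obtain ⟨n₂, a₂, hi₂, hs₂⟩ := exists_indepModSq_span_eq (k := k)
    (fun i : (T ∩ Kᶜ : Set ι) ↦ f i) (fun i ↦ hf i)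
  choose α hα using fun i ↦ Ideal.mem_span_range_iff_exists_fun.mp (hx₁ (a₁ i) (a₁ i).2.2)
  choose β hβ using fun i ↦ Ideal.mem_span_range_iff_exists_fun.mp (hx₂ (a₂ i) (a₂ i).2.2)
  -- `R'` is a domain, so the factor `t` can be cancelled: the strict transform of `∑ α j * x j` is
  -- `∑ α j * z j`.
  have hα' (i) : ∑ j, algebraMap R R' (α i j) * X.z j = f' (a₁ i) := by
    refine mul_left_cancel₀ X.t_ne_zero ?_
    rw [← hf₁ _ (a₁ i).2.2, ← hα i, map_sum, Finset.mul_sum]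
    refine Finset.sum_congr rfl fun j _ ↦ ?_
    rw [map_mul, X.map_x_inl j, t]
    ring
  have hβ' (i) : ∑ j, algebraMap R R' (β i j) * algebraMap R R' (X.x (.inr j)) = f' (a₂ i) := by
    rw [hf₂ _ (a₂ i).2.2, ← hβ i, map_sum]
    simp only [map_mul]
  have hi := X.indepModSq α β (by simp only [hα]; exact hi₁) (by simp only [hβ]; exact hi₂)
    (fun i ↦ by rw [hα']; exact hT _ (a₁ i).2.1)
  simp only [hα', hβ'] at hi
  set v : Fin n₁ ⊕ Fin n₂ → R' := Sum.elim (fun i ↦ f' (a₁ i)) (fun i ↦ f' (a₂ i)) with hv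
  -- The relations expressing every equation by the chosen ones survive division by `t`, since
  -- within `K` both sides carry exactly one factor `t`.
  have hspan : Ideal.span (f' '' T) = Ideal.span (Set.range v) := by
    refine le_antisymm (Ideal.span_le.mpr ?_) (Ideal.span_mono ?_)
    · rintro _ ⟨i, hi, rfl⟩
      rw [SetLike.mem_coe, hv, span_sumElim]
      by_cases hiK : i ∈ K
      · refine Submodule.mem_sup_left ?_
        have h3 : f i ∈ Ideal.span (Set.range fun i : (T ∩ K : Set ι) ↦ f i) :=
          Ideal.subset_span ⟨⟨i, hi, hiK⟩, rfl⟩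
        rw [← hs₁] at h3
        obtain ⟨γ, hγ⟩ := Ideal.mem_span_range_iff_exists_fun.mp h3
        refine Ideal.mem_span_range_iff_exists_fun.mpr ⟨fun l ↦ algebraMap R R' (γ l), ?_⟩
        refine mul_left_cancel₀ X.t_ne_zero ?_
        rw [← hf₁ _ hiK, ← hγ, map_sum, Finset.mul_sum]
        refine Finset.sum_congr rfl fun j _ ↦ ?_
        rw [map_mul, Function.comp_apply, hf₁ _ (a₁ j).2.2]
        ring
      · refine Submodule.mem_sup_right ?_
        have h3 : f i ∈ Ideal.span (Set.range fun i : (T ∩ Kᶜ : Set ι) ↦ f i) :=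
          Ideal.subset_span ⟨⟨i, hi, hiK⟩, rfl⟩
        rw [← hs₂] at h3
        obtain ⟨γ, hγ⟩ := Ideal.mem_span_range_iff_exists_fun.mp h3
        refine Ideal.mem_span_range_iff_exists_fun.mpr ⟨fun l ↦ algebraMap R R' (γ l), ?_⟩
        rw [hf₂ _ hiK, ← hγ, map_sum]
        refine Finset.sum_congr rfl fun j _ ↦ ?_
        rw [map_mul, Function.comp_apply, hf₂ _ (a₂ j).2.2]
    · rintro _ ⟨i | i, rfl⟩
      · exact ⟨_, (a₁ i).2.1, rfl⟩
      · exact ⟨_, (a₂ i).2.1, rfl⟩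
  refine ⟨?_, ?_, ?_⟩
  · rw [hspan]
    exact (hi.comp Sum.inr Sum.inr_injective).formallySmooth_quotient
  · have h3 := hi.formallySmooth_quotient
    rwa [span_sumElim, Set.range_const, ← hspan] at h3
  · intro h3
    have h4 := mk_mem_cot (k := k).mpr h3
    rw [hspan, cot_span (by
      rintro _ ⟨i, rfl⟩; exact hi.1 (.inr i)), ← Set.range_comp] at h4
    have h5 := (indepModSq_iff_linearIndependent.mp hi).2.notMem_span_image
      (s := Set.range Sum.inr) (x := Sum.inl ()) (by simp)
    rw [← Set.range_comp] at h5
    exact h5 h4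

end BlowupCoordinates

end LocalAlgebra

/-! ### Stalks of ideal sheaves. -/

section Stalks

variable {X : Scheme.{u}}

lemma exists_affineOpen_le (p : X) (U : X.Opens) (hp : p ∈ U) :
    ∃ V : X.affineOpens, p ∈ V.1 ∧ V.1 ≤ U := by
  obtain ⟨_, ⟨V, hV, rfl⟩, hpV, hVU⟩ :=
    X.isBasis_affineOpens.exists_subset_of_mem_open hp U.2
  exact ⟨⟨V, hV⟩, hpV, hVU⟩

lemma map_germ_ideal_of_le (D : X.IdealSheafData) {U V : X.affineOpens} (h : U ≤ V) {p : X}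
    (hp : p ∈ U.1) :
    (D.ideal V).map (X.presheaf.germ V.1 p (h hp)).hom =
      (D.ideal U).map (X.presheaf.germ U.1 p hp).hom := by
  rw [← D.map_ideal h, Ideal.map_map, ← CommRingCat.hom_comp]
  exact congr(Ideal.map (CommRingCat.Hom.hom $((X.presheaf.germ_res (homOfLE h) p hp).symm)) _)

lemma stalkIdeal_eq (D : X.IdealSheafData) {U : X.affineOpens} {p : X} (hp : p ∈ U.1) :
    stalkIdeal D p = (D.ideal U).map (X.presheaf.germ U.1 p hp).hom := by
  refine le_antisymm (iSup₂_le fun V hV ↦ ?_)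
    (le_iSup₂_of_le (f := fun (U : X.affineOpens) (hp : p ∈ U.1) ↦
      (D.ideal U).map (X.presheaf.germ U.1 p hp).hom) U hp le_rfl)
  obtain ⟨W, hpW, hW⟩ := exists_affineOpen_le p (U.1 ⊓ V.1) ⟨hp, hV⟩
  rw [map_germ_ideal_of_le D (U := W) (V := V) (hW.trans inf_le_right) hpW,
    map_germ_ideal_of_le D (U := W) (V := U) (hW.trans inf_le_left) hpW]

lemma exists_affineOpen_mem (p : X) : ∃ U : X.affineOpens, p ∈ U.1 := by
  obtain ⟨U, hU, -⟩ := exists_affineOpen_le p ⊤ trivial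
  exact ⟨U, hU⟩

lemma stalkIdeal_mono {D D' : X.IdealSheafData} (h : D ≤ D') (p : X) :
    stalkIdeal D p ≤ stalkIdeal D' p :=
  iSup₂_mono fun U _ ↦ Ideal.map_mono (h U)

lemma stalkIdeal_sSup (T : Set X.IdealSheafData) (p : X) :
    stalkIdeal (sSup T) p = ⨆ D ∈ T, stalkIdeal D p := by
  obtain ⟨U, hU⟩ := exists_affineOpen_mem p
  simp only [stalkIdeal_eq _ hU]
  rw [Scheme.IdealSheafData.ideal_sSup, sSup_image, iSup_apply, Ideal.map_iSup]
  refine iSup_congr fun D ↦ ?_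
  rw [iSup_apply, Ideal.map_iSup]

lemma mem_support_iff_stalkIdeal_le {D : X.IdealSheafData} {p : X} :
    p ∈ D.support ↔ stalkIdeal D p ≤ IsLocalRing.maximalIdeal (X.presheaf.stalk p) := by
  obtain ⟨U, hU⟩ := exists_affineOpen_mem p
  rw [Scheme.IdealSheafData.mem_support_iff_of_mem hU, stalkIdeal_eq D hU, Ideal.map_le_iff_le_comap,
    Scheme.mem_zeroLocus_iff]
  refine forall₂_congr fun s _ ↦ ?_
  rw [Scheme.mem_basicOpen X s p hU]
  rfl

lemma stalkIdeal_eq_top_iff {D : X.IdealSheafData} {p : X} :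
    stalkIdeal D p = ⊤ ↔ p ∉ D.support := by
  rw [mem_support_iff_stalkIdeal_le]
  refine ⟨fun h h' ↦ IsLocalRing.maximalIdeal.isMaximal _ |>.ne_top (top_le_iff.mp (h ▸ h')),
    fun h ↦ by_contra fun h' ↦ h (IsLocalRing.le_maximalIdeal h')⟩

lemma mem_support_sSup {T : Set X.IdealSheafData} {p : X} :
    p ∈ (sSup T).support ↔ ∀ D ∈ T, p ∈ D.support := by
  simp only [mem_support_iff_stalkIdeal_le, stalkIdeal_sSup, iSup_le_iff]

/-- Through this, statements on closed subsets near `p` become inclusions of ideals in the local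
ring. -/
lemma fromSpecStalk_mem_support_iff {D : X.IdealSheafData} {p : X}
    (q : Spec (X.presheaf.stalk p)) :
    X.fromSpecStalk p q ∈ D.support ↔ stalkIdeal D p ≤ q.asIdeal := by
  obtain ⟨U, hU⟩ := exists_affineOpen_mem p
  rw [← IsAffineOpen.fromSpecStalk_eq_fromSpecStalk U.2 hU,
    show IsAffineOpen.fromSpecStalk U.2 hU q = IsAffineOpen.fromSpec U.2
      (Spec.map (X.presheaf.germ U.1 p hU) q) from rfl]
  have hmem (z : Spec Γ(X, U.1)) : U.2.fromSpec z ∈ U.1 := by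
    have : U.2.fromSpec z ∈ Set.range U.2.fromSpec := ⟨z, rfl⟩
    rwa [U.2.range_fromSpec] at this
  rw [Scheme.IdealSheafData.mem_support_iff_of_mem (hmem _), stalkIdeal_eq D hU,
    Ideal.map_le_iff_le_comap, Scheme.mem_zeroLocus_iff]
  refine forall₂_congr fun s _ ↦ ?_
  have := SetLike.ext_iff.mp (IsAffineOpen.fromSpec_preimage_basicOpen U.2 s)
    (Spec.map (X.presheaf.germ U.1 p hU) q)
  exact (not_congr this).trans not_not

lemma fromSpecStalk_specializes_iff {p : X} {q q' : Spec (X.presheaf.stalk p)} :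
    X.fromSpecStalk p q ⤳ X.fromSpecStalk p q' ↔ q.asIdeal ≤ q'.asIdeal := by
  rw [(X.fromSpecStalk p).isEmbedding.isInducing.specializes_iff]
  exact (PrimeSpectrum.le_iff_specializes _ _).symm

lemma exists_fromSpecStalk_eq {x p : X} (h : x ⤳ p) : ∃ q, X.fromSpecStalk p q = x := by
  have : x ∈ Set.range (X.fromSpecStalk p) := by rwa [Scheme.range_fromSpecStalk]
  exact this

lemma stalkIdeal_of_specializes (D : X.IdealSheafData) {x p : X} (h : x ⤳ p) :
    stalkIdeal D x = (stalkIdeal D p).map (X.presheaf.stalkSpecializes h).hom := by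
  obtain ⟨U, hU⟩ := exists_affineOpen_mem p
  rw [stalkIdeal_eq D hU, stalkIdeal_eq D (h.mem_open U.1.2 hU), Ideal.map_map,
    ← CommRingCat.hom_comp, TopCat.Presheaf.germ_stalkSpecializes]

lemma isLocalization_germ {U : X.Opens} (hU : IsAffineOpen U) {p : X} (hp : p ∈ U) :
    letI := (X.presheaf.germ U p hp).hom.toAlgebra
    IsLocalization.AtPrime (X.presheaf.stalk p) (hU.primeIdealOf ⟨p, hp⟩).asIdeal :=
  hU.isLocalization_stalk ⟨p, hp⟩

lemma mem_primeIdealOf_iff {U : X.Opens} (hU : IsAffineOpen U) {p : X} (hp : p ∈ U) {a : Γ(X, U)} :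
    a ∈ (hU.primeIdealOf ⟨p, hp⟩).asIdeal ↔ ¬ IsUnit (X.presheaf.germ U p hp a) := by
  letI := (X.presheaf.germ U p hp).hom.toAlgebra
  have := isLocalization_germ hU hp
  exact not_iff_not.mp (((IsLocalization.AtPrime.isUnit_to_map_iff (X.presheaf.stalk p)
    (hU.primeIdealOf ⟨p, hp⟩).asIdeal a)).symm.trans (not_not).symm)

/-- The local ring at a generization is a localization. -/
lemma exists_isLocalization_stalkSpecializes {x p : X} (h : x ⤳ p) :
    ∃ M : Submonoid (X.presheaf.stalk p), letI := (X.presheaf.stalkSpecializes h).hom.toAlgebra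
      IsLocalization M (X.presheaf.stalk x) := by
  obtain ⟨U, hU⟩ := exists_affineOpen_mem p
  have hx := h.mem_open U.1.2 hU
  letI a1 := (X.presheaf.germ U.1 p hU).hom.toAlgebra
  letI a2 := (X.presheaf.germ U.1 x hx).hom.toAlgebra
  letI a3 := (X.presheaf.stalkSpecializes h).hom.toAlgebra
  have l1 := isLocalization_germ U.2 hU
  have l2 := isLocalization_germ U.2 hx
  have : IsScalarTower Γ(X, U.1) (X.presheaf.stalk p) (X.presheaf.stalk x) := .of_algebraMap_eq' (by
    change _ = RingHom.comp (X.presheaf.stalkSpecializes h).hom (X.presheaf.germ U.1 p hU).hom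
    rw [← CommRingCat.hom_comp, TopCat.Presheaf.germ_stalkSpecializes]
    rfl)
  refine ⟨_, IsLocalization.isLocalization_of_submonoid_le (X.presheaf.stalk p)
    (X.presheaf.stalk x) (U.2.primeIdealOf ⟨p, hU⟩).asIdeal.primeCompl
    (U.2.primeIdealOf ⟨x, hx⟩).asIdeal.primeCompl ?_⟩
  intro a ha hax
  refine ha ?_
  refine (mem_primeIdealOf_iff U.2 hU).mpr fun h1 ↦ (mem_primeIdealOf_iff U.2 hx).mp hax ?_
  rw [← X.presheaf.germ_stalkSpecializes hU h]
  exact h1.map (X.presheaf.stalkSpecializes h).hom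

end Stalks

/-! ### Smoothness of a quotient algebra, tested at maximal ideals. -/

section SmoothQuotient

variable {k A : Type*} [Field k] [CommRing A] [Algebra k A]

/-- Localization commutes with quotients: both rings are localizations of `A ⧸ J` at `Q`. -/
lemma formallySmooth_localization_quotient_iff (J : Ideal A) (P : Ideal A) [P.IsPrime]
    (Q : Ideal (A ⧸ J)) [Q.IsPrime] (hQ : Q.comap (Ideal.Quotient.mk J) = P)
    (L : Type*) [CommRing L] [Algebra A L] [Algebra k L] [IsScalarTower k A L]
    [IsLocalization.AtPrime L P] :
    Algebra.FormallySmooth k (Localization.AtPrime Q) ↔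
      Algebra.FormallySmooth k (L ⧸ J.map (algebraMap A L)) := by
  let g : A ⧸ J →+* L ⧸ J.map (algebraMap A L) :=
    Ideal.quotientMap _ (algebraMap A L) Ideal.le_comap_map
  letI : Algebra (A ⧸ J) (L ⧸ J.map (algebraMap A L)) := g.toAlgebra
  have hg (a : A) : algebraMap (A ⧸ J) (L ⧸ J.map (algebraMap A L)) (Ideal.Quotient.mk J a) =
      Ideal.Quotient.mk _ (algebraMap A L a) := Ideal.quotientMap_mk
  have h1 : P.primeCompl.map (Ideal.Quotient.mk J) = Q.primeCompl := by
    ext y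
    obtain ⟨a, rfl⟩ := Ideal.Quotient.mk_surjective y
    constructor
    · rintro ⟨b, hb, hab⟩
      rw [← hab]
      intro h
      exact hb (by rw [← hQ]; exact h)
    · intro h
      exact ⟨a, fun h' ↦ h (by rw [← hQ] at h'; exact h'), rfl⟩
  have h2 : IsLocalization (P.primeCompl.map (Ideal.Quotient.mk J))
      (L ⧸ J.map (algebraMap A L)) :=
    IsLocalization.of_surjective P.primeCompl L (Ideal.Quotient.mk J) Ideal.Quotient.mk_surjective
      (Ideal.Quotient.mk _) Ideal.Quotient.mk_surjective (by ext a; exact (hg a).symm)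
      (by simp)
  rw [h1] at h2
  have : IsScalarTower k (A ⧸ J) (L ⧸ J.map (algebraMap A L)) := .of_algebraMap_eq fun c ↦ by
    change Ideal.Quotient.mk _ (algebraMap k L c) =
      algebraMap (A ⧸ J) (L ⧸ J.map (algebraMap A L)) (Ideal.Quotient.mk J (algebraMap k A c))
    rw [hg, ← IsScalarTower.algebraMap_apply]
  exact Algebra.FormallySmooth.iff_of_equiv
    ((IsLocalization.algEquiv Q.primeCompl (Localization.AtPrime Q)
      (L ⧸ J.map (algebraMap A L))).restrictScalars k)

/-- The smooth locus is open and every prime specializes to a maximal ideal, so maximal ideals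
suffice. -/
lemma smooth_quotient_iff [Algebra.FiniteType k A] (J : Ideal A) :
    Algebra.Smooth k (A ⧸ J) ↔ ∀ (Q : Ideal (A ⧸ J)) [Q.IsMaximal],
      Algebra.FormallySmooth k (Localization.AtPrime Q) := by
  have : Algebra.FinitePresentation k (A ⧸ J) :=
    Algebra.FinitePresentation.of_finiteType.mp inferInstance
  constructor
  · intro h Q hQ
    infer_instance
  · intro h
    have h1 : Algebra.smoothLocus k (A ⧸ J) = Set.univ := by
      refine Set.eq_univ_of_forall fun x ↦ ?_
      obtain ⟨M, hM, hxM⟩ := Ideal.exists_le_maximal x.asIdeal x.2.ne_top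
      have h2 : (⟨M, hM.isPrime⟩ : PrimeSpectrum (A ⧸ J)) ∈ Algebra.smoothLocus k (A ⧸ J) := h M
      refine ((PrimeSpectrum.le_iff_specializes x ⟨M, hM.isPrime⟩).mp hxM).mem_open
        Algebra.isOpen_smoothLocus h2
    exact ⟨Algebra.smoothLocus_eq_univ_iff.mp h1, inferInstance⟩

end SmoothQuotient

/-! ### Schemes over a field: closed points, local rings and smooth subschemes. -/

section OverField

lemma le_preimage_top {X Y : Scheme.{u}} (f : X ⟶ Y) (U : X.Opens) : U ≤ f ⁻¹ᵁ ⊤ :=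
  fun _ _ ↦ trivial

lemma mem_preimage_top {X Y : Scheme.{u}} (f : X ⟶ Y) (p : X) : p ∈ f ⁻¹ᵁ ⊤ := trivial

variable {k : Type u} [Field k] {X : Scheme.{u}} [X.Over (Spec (.of k))]

instance sectionAlgebra (U : X.Opens) : Algebra k Γ(X, U) :=
  ((Scheme.ΓSpecIso (.of k)).inv ≫ (X ↘ Spec (.of k)).appLE ⊤ U (le_preimage_top _ _)).hom.toAlgebra

instance stalkAlgebra (p : X) : Algebra k (X.presheaf.stalk p) :=
  ((Scheme.ΓSpecIso (.of k)).inv ≫ (X ↘ Spec (.of k)).appLE ⊤ ⊤ (le_preimage_top _ _) ≫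
    X.presheaf.germ ⊤ p (Opens.mem_top p)).hom.toAlgebra

lemma algebraMap_section_eq (U : X.Opens) : algebraMap k Γ(X, U) =
    ((Scheme.ΓSpecIso (.of k)).inv ≫ (X ↘ Spec (.of k)).appLE ⊤ U (le_preimage_top _ _)).hom := rfl

lemma germ_algebraMap (U : X.Opens) (p : X) (hp : p ∈ U) (c : k) :
    X.presheaf.germ U p hp (algebraMap k Γ(X, U) c) = algebraMap k (X.presheaf.stalk p) c := by
  have : ((Scheme.ΓSpecIso (.of k)).inv ≫ (X ↘ Spec (.of k)).appLE ⊤ U (le_preimage_top _ _)) ≫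
      X.presheaf.germ U p hp =
      (Scheme.ΓSpecIso (.of k)).inv ≫ (X ↘ Spec (.of k)).appLE ⊤ ⊤ (le_preimage_top _ _) ≫
        X.presheaf.germ ⊤ p (Opens.mem_top p) := by
    rw [Category.assoc, ← X.presheaf.germ_res (homOfLE (le_top : U ≤ ⊤)) p hp,
      Scheme.Hom.appLE_map_assoc]
  exact congr($(this).hom c)

lemma isScalarTower_stalk (U : X.Opens) (p : X) (hp : p ∈ U) :
    letI := (X.presheaf.germ U p hp).hom.toAlgebra
    IsScalarTower k Γ(X, U) (X.presheaf.stalk p) :=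
  letI := (X.presheaf.germ U p hp).hom.toAlgebra
  .of_algebraMap_eq fun c ↦ (germ_algebraMap U p hp c).symm

section Morphism

variable {Y : Scheme.{u}} [Y.Over (Spec (.of k))] (π : Y ⟶ X) [π.IsOver (Spec (.of k))]

lemma appLE_algebraMap (U : X.Opens) (V : Y.Opens) (h : V ≤ π ⁻¹ᵁ U) (c : k) :
    π.appLE U V h (algebraMap k Γ(X, U) c) = algebraMap k Γ(Y, V) c := by
  have : ((Scheme.ΓSpecIso (.of k)).inv ≫ (X ↘ Spec (.of k)).appLE ⊤ U (le_preimage_top _ _)) ≫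
      π.appLE U V h =
      (Scheme.ΓSpecIso (.of k)).inv ≫ (Y ↘ Spec (.of k)).appLE ⊤ V (le_preimage_top _ _) := by
    rw [Category.assoc, Scheme.Hom.appLE_comp_appLE]
    simp only [CategoryTheory.comp_over]
  exact congr($(this).hom c)

lemma stalkMap_algebraMap (q : Y) (c : k) :
    π.stalkMap q (algebraMap k (X.presheaf.stalk (π q)) c) =
      algebraMap k (Y.presheaf.stalk q) c := by
  rw [← germ_algebraMap ⊤ (π q) (Opens.mem_top _), ← germ_algebraMap (π ⁻¹ᵁ ⊤) q (mem_preimage_top π q),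
    Scheme.Hom.germ_stalkMap_apply, ← appLE_algebraMap π ⊤ _ le_rfl, Scheme.Hom.app_eq_appLE]

end Morphism

lemma finiteType_section [LocallyOfFiniteType (X ↘ Spec (.of k))] {U : X.Opens}
    (hU : IsAffineOpen U) : Algebra.FiniteType k Γ(X, U) := by
  have h1 := (HasRingHomProperty.appLE (P := @LocallyOfFiniteType) (X ↘ Spec (.of k)) ‹_›
    ⟨⊤, isAffineOpen_top _⟩ ⟨U, hU⟩ (le_preimage_top _ _))
  have h2 : (algebraMap k Γ(X, U)).FiniteType := by
    rw [algebraMap_section_eq, CommRingCat.hom_comp]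
    exact RingHom.FiniteType.comp h1 (RingHom.FiniteType.of_surjective _
      (ConcreteCategory.bijective_of_isIso (Scheme.ΓSpecIso (.of k)).inv).2)
  exact h2

/-- By the Nullstellensatz the residue field of a closed point is finite over the algebraically
closed field `k`, hence equal to it. -/
lemma isRationalLocal_stalk [IsAlgClosed k] [LocallyOfFiniteType (X ↘ Spec (.of k))] {p : X}
    (hp : IsClosed {p}) : IsRationalLocal k (X.presheaf.stalk p) := by
  obtain ⟨U, hU⟩ := exists_affineOpen_mem p
  letI := (X.presheaf.germ U.1 p hU).hom.toAlgebra
  have l1 := isLocalization_germ U.2 hU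
  have := isScalarTower_stalk (k := k) U.1 p hU
  have := finiteType_section (k := k) U.2
  have hM : (IsAffineOpen.primeIdealOf U.2 ⟨p, hU⟩).asIdeal.IsMaximal :=
    IsAffineOpen.primeIdealOf_isMaximal_of_isClosed U.2 ⟨p, hU⟩ hp
  set M := (IsAffineOpen.primeIdealOf U.2 ⟨p, hU⟩).asIdeal with hMdef
  have hk (a : Γ(X, U.1)) : ∃ c : k, a - algebraMap k _ c ∈ M := by
    letI := Ideal.Quotient.field M
    have : Module.Finite k (Γ(X, U.1) ⧸ M) := finite_of_finite_type_of_isJacobsonRing _ _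
    obtain ⟨c, hc⟩ := (IsAlgClosed.algebraMap_bijective_of_isIntegral
      (k := k) (K := Γ(X, U.1) ⧸ M)).2 (Ideal.Quotient.mk M a)
    exact ⟨c, by rw [← Ideal.Quotient.eq]; exact hc.symm⟩
  have hmem (a : Γ(X, U.1)) (ha : a ∈ M) : algebraMap _ (X.presheaf.stalk p) a ∈
      IsLocalRing.maximalIdeal (X.presheaf.stalk p) := (mem_primeIdealOf_iff U.2 hU).mp ha
  refine { essFiniteType := ?_, exists_sub_mem := ?_ }
  · have : Algebra.EssFiniteType Γ(X, U.1) (X.presheaf.stalk p) := .of_isLocalization _ M.primeCompl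
    exact .comp _ Γ(X, U.1) _
  · intro r
    obtain ⟨⟨a, s⟩, h⟩ := IsLocalization.surj M.primeCompl r
    obtain ⟨c, hc⟩ := hk a
    obtain ⟨d, hd⟩ := hk s
    have hd0 : d ≠ 0 := fun h0 ↦ s.2 (by simpa [h0] using hd)
    -- For `r = a / s`, the constant is the quotient of the values of `a` and `s`; the value of `s`
    -- is nonzero.
    refine ⟨c / d, ?_⟩
    have hu : IsUnit (algebraMap Γ(X, U.1) (X.presheaf.stalk p) s) :=
      IsLocalization.map_units _ s
    rw [← Ideal.unit_mul_mem_iff_mem _ hu]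
    have h1 : algebraMap Γ(X, U.1) (X.presheaf.stalk p) s *
        (r - algebraMap k _ (c / d)) =
        algebraMap _ _ (a - algebraMap k _ c) -
          algebraMap _ _ ((s : Γ(X, U.1)) - algebraMap k _ d) * algebraMap k _ (c / d) := by
      rw [map_sub, map_sub, ← IsScalarTower.algebraMap_apply, ← IsScalarTower.algebraMap_apply,
        mul_sub, mul_comm _ r, h, sub_mul, ← map_mul, mul_div_cancel₀ _ hd0]
      ring
    rw [h1]
    exact sub_mem (hmem _ hc) (Ideal.mul_mem_right _ _ (hmem _ hd))

lemma jacobsonSpace_of_over [LocallyOfFiniteType (X ↘ Spec (.of k))] : JacobsonSpace X :=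
  LocallyOfFiniteType.jacobsonSpace (X ↘ Spec (.of k))

/-- In a Jacobson space a locally closed point is closed, so closedness in `U` is enough. -/
lemma isClosed_fromSpec_singleton [LocallyOfFiniteType (X ↘ Spec (.of k))] {U : X.Opens}
    (hU : IsAffineOpen U) (x : Spec Γ(X, U)) (hx : x.asIdeal.IsMaximal) :
    IsClosed {hU.fromSpec x} := by
  have := jacobsonSpace_of_over (k := k) (X := X)
  refine isClosed_singleton_of_isLocallyClosed_singleton ?_
  have h1 : IsClosed {x} := (PrimeSpectrum.isClosed_singleton_iff_isMaximal x).mpr hx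
  rw [← Set.image_singleton]
  exact h1.isLocallyClosed.image hU.fromSpec.isOpenEmbedding.isInducing
    hU.fromSpec.isOpenEmbedding.isOpen_range.isLocallyClosed

lemma smooth_subscheme_iff_section (Z : X.IdealSheafData) :
    Smooth (Z.subschemeι ≫ (X ↘ Spec (.of k))) ↔
      ∀ U : X.affineOpens, Algebra.Smooth k (Γ(X, U.1) ⧸ Z.ideal U) := by
  have hU : ⨆ U : X.affineOpens, Z.subschemeι ⁻¹ᵁ U.1 = ⊤ := by
    rw [← Scheme.Hom.preimage_iSup, iSup_affineOpens_eq_top]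
    rfl
  rw [HasRingHomProperty.iff_of_iSup_eq_top (P := @Smooth)
    (fun U : X.affineOpens ↦ ⟨Z.subschemeι ⁻¹ᵁ U.1, U.2.preimage Z.subschemeι⟩) hU]
  refine forall_congr' fun U ↦ ?_
  have H := RingHom.Smooth.respectsIso
  rw [← RingHom.smooth_algebraMap]
  have h1 : (Z.subschemeι ≫ (X ↘ Spec (.of k))).appLE ⊤ (Z.subschemeι ⁻¹ᵁ U.1) (le_preimage_top _ _) =
      ((X ↘ Spec (.of k)).appLE ⊤ U.1 (le_preimage_top _ _) ≫
        CommRingCat.ofHom (Ideal.Quotient.mk (Z.ideal U))) ≫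
        (Z.subschemeObjIso U).inv := by
    rw [← Scheme.Hom.appLE_comp_appLE (f := Z.subschemeι) (g := X ↘ Spec (.of k)) (U := ⊤)
      (V := U.1) (e₁ := le_preimage_top _ _) (e₂ := le_rfl), ← Scheme.Hom.app_eq_appLE,
      Scheme.IdealSheafData.subschemeι_app, Category.assoc]
  rw [h1, CommRingCat.hom_comp, H.cancel_right_isIso]
  have h2 : algebraMap k (Γ(X, U.1) ⧸ Z.ideal U) = ((Scheme.ΓSpecIso (.of k)).inv ≫
      ((X ↘ Spec (.of k)).appLE ⊤ U.1 (le_preimage_top _ _) ≫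
        CommRingCat.ofHom (Ideal.Quotient.mk (Z.ideal U)))).hom := rfl
  rw [h2, CommRingCat.hom_comp]
  exact (H.cancel_left_isIso (Scheme.ΓSpecIso (.of k)).inv _).symm

/-- A closed subscheme is smooth if and only if its local rings at closed points are. -/
lemma smooth_subscheme_iff [LocallyOfFiniteType (X ↘ Spec (.of k))] (Z : X.IdealSheafData) :
    Smooth (Z.subschemeι ≫ (X ↘ Spec (.of k))) ↔ ∀ p ∈ Z.support, IsClosed {p} →
      Algebra.FormallySmooth k (X.presheaf.stalk p ⧸ stalkIdeal Z p) := by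
  rw [smooth_subscheme_iff_section]
  constructor
  · intro h p hp hpc
    obtain ⟨U, hU⟩ := exists_affineOpen_mem p
    letI := (X.presheaf.germ U.1 p hU).hom.toAlgebra
    have l1 := isLocalization_germ U.2 hU
    have := isScalarTower_stalk (k := k) U.1 p hU
    have := finiteType_section (k := k) U.2
    have hM : (IsAffineOpen.primeIdealOf U.2 ⟨p, hU⟩).asIdeal.IsMaximal :=
      IsAffineOpen.primeIdealOf_isMaximal_of_isClosed U.2 ⟨p, hU⟩ hpc
    have hle : Z.ideal U ≤ (IsAffineOpen.primeIdealOf U.2 ⟨p, hU⟩).asIdeal := fun a ha ↦ by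
      rw [mem_support_iff_stalkIdeal_le, stalkIdeal_eq Z hU] at hp
      exact (mem_primeIdealOf_iff U.2 hU).mpr (hp (Ideal.mem_map_of_mem _ ha))
    have hQ : ((IsAffineOpen.primeIdealOf U.2 ⟨p, hU⟩).asIdeal.map
        (Ideal.Quotient.mk (Z.ideal U))).comap (Ideal.Quotient.mk (Z.ideal U)) =
        (IsAffineOpen.primeIdealOf U.2 ⟨p, hU⟩).asIdeal := by
      rw [Ideal.comap_map_of_surjective _ Ideal.Quotient.mk_surjective, ← RingHom.ker_eq_comap_bot,
        Ideal.mk_ker, sup_eq_left]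
      exact hle
    have hmax : ((IsAffineOpen.primeIdealOf U.2 ⟨p, hU⟩).asIdeal.map
        (Ideal.Quotient.mk (Z.ideal U))).IsMaximal := by
      refine (Ideal.map_eq_top_or_isMaximal_of_surjective _ Ideal.Quotient.mk_surjective
        hM).resolve_left fun htop ↦ hM.ne_top ?_
      rw [← hQ, htop, Ideal.comap_top]
    rw [stalkIdeal_eq Z hU]
    exact (formallySmooth_localization_quotient_iff (Z.ideal U) _ _ hQ
      (X.presheaf.stalk p)).mp ((smooth_quotient_iff _).mp (h U) _)
  · intro h U
    have := finiteType_section (k := k) U.2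
    rw [smooth_quotient_iff]
    intro Q hQm
    have hM : (Q.comap (Ideal.Quotient.mk (Z.ideal U))).IsMaximal :=
      Ideal.comap_isMaximal_of_surjective _ Ideal.Quotient.mk_surjective
    let x : Spec Γ(X, U.1) := ⟨Q.comap (Ideal.Quotient.mk (Z.ideal U)), hM.isPrime⟩
    let p := IsAffineOpen.fromSpec U.2 x
    have hU : p ∈ U.1 := by
      have : p ∈ Set.range (IsAffineOpen.fromSpec U.2) := ⟨x, rfl⟩
      rwa [IsAffineOpen.range_fromSpec U.2] at this
    have hUa : IsAffineOpen U.1 := U.2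
    have hx : hUa.primeIdealOf ⟨p, hU⟩ = x :=
      hUa.fromSpec.isOpenEmbedding.injective
        (IsAffineOpen.fromSpec_primeIdealOf U.2 ⟨p, hU⟩)
    letI := (X.presheaf.germ U.1 p hU).hom.toAlgebra
    have l1 := isLocalization_germ U.2 hU
    have := isScalarTower_stalk (k := k) U.1 p hU
    have hp : p ∈ Z.support := by
      rw [mem_support_iff_stalkIdeal_le, stalkIdeal_eq Z hU, Ideal.map_le_iff_le_comap]
      intro a ha
      refine (mem_primeIdealOf_iff U.2 hU).mp ?_
      rw [hx]
      change Ideal.Quotient.mk _ a ∈ Q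
      rw [Ideal.Quotient.eq_zero_iff_mem.mpr ha]
      exact zero_mem _
    have h3 := h p hp (isClosed_fromSpec_singleton (k := k) U.2 x hM)
    rw [stalkIdeal_eq Z hU] at h3
    exact (formallySmooth_localization_quotient_iff (Z.ideal U) _ Q (congr(($hx).asIdeal)).symm
      (X.presheaf.stalk p)).mpr h3

end OverField

/-! ### The rank of the conormal module as an invariant of generization. -/

section ConormalRank

open IsLocalRing

/-- The ideal `J` is generated by `r` elements which form a basis of `J / J²` over `R / J`. -/
def HasConormalRank {R : Type*} [CommRing R] (J : Ideal R) (r : ℕ) : Prop :=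
  ∃ x : Fin r → R, Ideal.span (Set.range x) = J ∧
    ∀ a : Fin r → R, ∑ i, a i * x i ∈ J ^ 2 → ∀ i, a i ∈ J

variable {R : Type*} [CommRing R] {J : Ideal R}

lemma exists_matrix_of_span_eq {m n : ℕ} {x : Fin m → R} {y : Fin n → R}
    (h : Ideal.span (Set.range x) = Ideal.span (Set.range y)) :
    ∃ M : Matrix (Fin m) (Fin n) R, ∀ i, ∑ j, M i j * y j = x i := by
  have h1 (i) : x i ∈ Ideal.span (Set.range y) := h ▸ Ideal.subset_span ⟨i, rfl⟩
  choose M hM using fun i ↦ Ideal.mem_span_range_iff_exists_fun.mp (h1 i)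
  exact ⟨M, hM⟩

lemma map_mul_eq_one {m n : ℕ} {x : Fin m → R} {y : Fin n → R}
    (hx : ∀ a : Fin m → R, ∑ i, a i * x i ∈ J ^ 2 → ∀ i, a i ∈ J)
    {M : Matrix (Fin m) (Fin n) R} {N : Matrix (Fin n) (Fin m) R}
    (hM : ∀ i, ∑ j, M i j * y j = x i) (hN : ∀ i, ∑ j, N i j * x j = y i) :
    M.map (Ideal.Quotient.mk J) * N.map (Ideal.Quotient.mk J) = 1 := by
  rw [← Matrix.map_mul, ← Matrix.map_one (Ideal.Quotient.mk J) (map_zero _) (map_one _)]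
  ext i l
  rw [Matrix.map_apply, Matrix.map_apply, Ideal.Quotient.eq]
  refine hx (fun l ↦ (M * N) i l - (1 : Matrix (Fin m) (Fin m) R) i l) ?_ l
  have : ∑ l, ((M * N) i l - (1 : Matrix (Fin m) (Fin m) R) i l) * x l = 0 := by
    simp only [sub_mul, Finset.sum_sub_distrib, Matrix.one_apply, ite_mul, one_mul, zero_mul,
      Finset.sum_ite_eq, Finset.mem_univ, if_true, Matrix.mul_apply, Finset.sum_mul]
    rw [Finset.sum_comm, sub_eq_zero, ← hM i]
    refine Finset.sum_congr rfl fun j _ ↦ ?_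
    rw [← hN j, Finset.mul_sum]
    exact Finset.sum_congr rfl fun l _ ↦ mul_assoc _ _ _
  rw [this]
  exact zero_mem _

/-- The transition matrices between two sets of generators become mutually inverse over the nonzero
ring `R ⧸ J`. -/
lemma HasConormalRank.unique (hJ : J ≠ ⊤) {r s : ℕ} (hr : HasConormalRank J r)
    (hs : HasConormalRank J s) : r = s := by
  obtain ⟨x, hx, hx'⟩ := hr
  obtain ⟨y, hy, hy'⟩ := hs
  obtain ⟨M, hM⟩ := exists_matrix_of_span_eq (hx.trans hy.symm)
  obtain ⟨N, hN⟩ := exists_matrix_of_span_eq (hy.trans hx.symm)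
  have : Nontrivial (R ⧸ J) := Ideal.Quotient.nontrivial_iff.mpr hJ
  simpa using Matrix.square_of_invertible _ _ (map_mul_eq_one hx' hM hN)
    (map_mul_eq_one hy' hN hM)

/-- Clearing denominators turns a relation over the localization into one over `R`. This carries the
rank from a closed point to its generizations. -/
lemma HasConormalRank.localization {r : ℕ} (hr : HasConormalRank J r) (M : Submonoid R)
    (S : Type*) [CommRing S] [Algebra R S] [IsLocalization M S] :
    HasConormalRank (J.map (algebraMap R S)) r := by
  obtain ⟨x, hx, hx'⟩ := hr
  refine ⟨algebraMap R S ∘ x, ?_, fun a ha i ↦ ?_⟩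
  · rw [Set.range_comp, ← Ideal.map_span, hx]
  obtain ⟨s, hs⟩ := IsLocalization.exist_integer_multiples_of_finite M a
  choose b hb using hs
  have h1 : algebraMap R S (∑ i, b i * x i) ∈ (J ^ 2).map (algebraMap R S) := by
    rw [Ideal.map_pow]
    convert! Ideal.mul_mem_left _ (algebraMap R S s) ha using 1
    rw [map_sum, Finset.mul_sum]
    refine Finset.sum_congr rfl fun j _ ↦ ?_
    rw [map_mul, hb, Algebra.smul_def, Function.comp_apply, mul_assoc]
  rw [IsLocalization.algebraMap_mem_map_algebraMap_iff M] at h1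
  obtain ⟨t, ht, h1⟩ := h1
  have h2 := hx' (fun i ↦ t * b i) (by simpa only [mul_assoc, ← Finset.mul_sum] using h1) i
  have hu : IsUnit (algebraMap R S (t * s)) := IsLocalization.map_units S (⟨t, ht⟩ * s : M)
  rw [← Ideal.unit_mul_mem_iff_mem _ hu]
  convert! Ideal.mem_map_of_mem (algebraMap R S) h2 using 1
  rw [map_mul, map_mul, hb, Algebra.smul_def, mul_assoc]

variable {k : Type*} [Field k] [Algebra k R]

/-- A derivation maps `J²` into `J`, and the `i`-th dual derivation of `∑ a j * x j` is `a i` modulo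
`J`. -/
lemma IndepModSq.hasConormalRank [IsRationalLocal k R] [Algebra.FormallySmooth k R] {r : ℕ}
    {x : Fin r → R} (hx : IndepModSq k x) : HasConormalRank (Ideal.span (Set.range x)) r := by
  obtain ⟨d, hd⟩ := hx.exists_derivation
  refine ⟨x, rfl, fun a ha i ↦ ?_⟩
  set J := Ideal.span (Set.range x)
  have hxJ (j) : x j ∈ J := Ideal.subset_span ⟨j, rfl⟩
  have h1 (z : R) (hz : z ∈ J ^ 2) : d i z ∈ J := by
    rw [pow_two] at hz
    refine Submodule.mul_induction_on hz (fun m hm n hn ↦ ?_) fun m n hm hn ↦ ?_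
    · rw [Derivation.leibniz]
      exact add_mem (Ideal.mul_mem_right _ _ hm) (Ideal.mul_mem_right _ _ hn)
    · rw [map_add]
      exact add_mem hm hn
  have h2 := h1 _ ha
  simp only [map_sum, Derivation.leibniz, hd, smul_eq_mul, mul_ite, mul_one, mul_zero,
    Finset.sum_add_distrib, Finset.sum_ite_eq, Finset.mem_univ, if_true] at h2
  exact (J.add_mem_iff_left (sum_mem fun j _ ↦ Ideal.mul_mem_right _ _ (hxJ j))).mp h2

lemma exists_indepModSq_span_eq' [IsRationalLocal k R] (hJ : J ≤ maximalIdeal R)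
    [Algebra.FormallySmooth k (R ⧸ J)] :
    ∃ (n : ℕ) (x : Fin n → R), IndepModSq k x ∧ Ideal.span (Set.range x) = J := by
  have := IsRationalLocal.isNoetherianRing k R
  obtain ⟨n, x, hx⟩ := Submodule.fg_iff_exists_fin_generating_family.mp
    (IsNoetherian.noetherian J)
  subst hx
  obtain ⟨m, a, h1, h2⟩ := exists_indepModSq_span_eq (k := k) x
    (fun i ↦ hJ (Ideal.subset_span ⟨i, rfl⟩))
  exact ⟨m, _, h1, h2⟩

lemma finiteDimensional_cot [IsRationalLocal k R] (hJ : J ≤ maximalIdeal R) :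
    FiniteDimensional k (cot k J) := by
  have := IsRationalLocal.isNoetherianRing k R
  obtain ⟨s, rfl⟩ := IsNoetherian.noetherian J
  rw [← Ideal.span, cot_span fun x hx ↦ hJ (Ideal.subset_span hx)]
  exact FiniteDimensional.span_of_finite k (s.finite_toSet.image _)

/-- The dimension of the image of an ideal in `𝔪 / 𝔪²` is its conormal rank. -/
lemma hasConormalRank_finrank_cot [IsRationalLocal k R] [Algebra.FormallySmooth k R]
    (hJ : J ≤ maximalIdeal R) [Algebra.FormallySmooth k (R ⧸ J)] :
    HasConormalRank J (Module.finrank k (cot k J)) := by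
  obtain ⟨n, x, hx, rfl⟩ := exists_indepModSq_span_eq' (k := k) hJ
  rw [cot_span (by rintro _ ⟨i, rfl⟩; exact hx.1 i), ← Set.range_comp]
  have := finrank_span_eq_card (indepModSq_iff_linearIndependent.mp hx).2
  rw [Fintype.card_fin] at this
  convert! hx.hasConormalRank

lemma disjoint_iff_finrank_sup {V : Type*} [AddCommGroup V] [Module k V] (A B : Submodule k V)
    [FiniteDimensional k A] [FiniteDimensional k B] :
    Disjoint A B ↔ Module.finrank k (A ⊔ B : Submodule k V) =
      Module.finrank k A + Module.finrank k B := by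
  rw [← Submodule.finrank_sup_add_finrank_inf_eq, disjoint_iff, left_eq_add]
  constructor
  · intro h; rw [h, finrank_bot]
  · intro h
    exact Submodule.finrank_eq_zero.mp h

end ConormalRank

/-! ### Comparison with the cotangent space over the residue field. -/

section Cotangent

open IsLocalRing

variable {k R : Type*} [Field k] [CommRing R] [Algebra k R]

/-- The image of an ideal in the cotangent space. -/
def cotangentImage [IsLocalRing R] (J : Ideal R) :
    Submodule (ResidueField R) (CotangentSpace R) :=
  Submodule.span (ResidueField R) ((maximalIdeal R).toCotangent '' {x | (x : R) ∈ J})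

lemma mem_cotangentImage [IsLocalRing R] {J : Ideal R} {y : CotangentSpace R} :
    y ∈ cotangentImage J ↔ ∃ x : maximalIdeal R, (x : R) ∈ J ∧ (maximalIdeal R).toCotangent x = y := by
  constructor
  · intro h
    refine Submodule.span_induction (p := fun y _ ↦ ∃ x : maximalIdeal R, (x : R) ∈ J ∧
      (maximalIdeal R).toCotangent x = y) ?_ ?_ ?_ ?_ h
    · rintro _ ⟨x, hx, rfl⟩; exact ⟨x, hx, rfl⟩
    · exact ⟨0, zero_mem _, map_zero _⟩
    · rintro _ _ _ _ ⟨x, hx, rfl⟩ ⟨z, hz, rfl⟩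
      exact ⟨x + z, add_mem hx hz, map_add _ _ _⟩
    · rintro a _ _ ⟨x, hx, rfl⟩
      obtain ⟨r, rfl⟩ := residue_surjective a
      refine ⟨r • x, J.mul_mem_left r hx, ?_⟩
      rw [map_smul]
      rfl
  · rintro ⟨x, hx, rfl⟩
    exact Submodule.subset_span ⟨x, hx, rfl⟩

lemma cotangentImage_biSup [IsLocalRing R] {ι : Type*} (T : Set ι) (J : ι → Ideal R)
    (hJ : ∀ i ∈ T, J i ≤ maximalIdeal R) :
    cotangentImage (⨆ i ∈ T, J i) = ⨆ i ∈ T, cotangentImage (J i) := by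
  refine le_antisymm ?_ (iSup₂_le fun i hi ↦ Submodule.span_mono (Set.image_mono fun x hx ↦
    (le_iSup₂_of_le (f := fun i (_ : i ∈ T) ↦ J i) i hi le_rfl) hx))
  intro y hy
  obtain ⟨⟨x, hxm⟩, hx, rfl⟩ := mem_cotangentImage.mp hy
  rw [iSup_subtype'] at hx ⊢
  obtain ⟨_, h⟩ := Submodule.iSup_induction (fun i : T ↦ J i) (motive := fun x ↦
    ∃ hxm : x ∈ maximalIdeal R,
      (maximalIdeal R).toCotangent ⟨x, hxm⟩ ∈ ⨆ i : T, cotangentImage (J i)) hx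
    (fun i x hx ↦ ⟨hJ i i.2 hx,
      (le_iSup (fun i : T ↦ cotangentImage (J i)) i) (mem_cotangentImage.mpr ⟨_, hx, rfl⟩)⟩)
    ⟨zero_mem _, by
      rw [show (⟨0, zero_mem _⟩ : maximalIdeal R) = 0 from rfl, map_zero]; exact zero_mem _⟩
    (by
      rintro x y ⟨hxm, hx⟩ ⟨hym, hy⟩
      refine ⟨add_mem hxm hym, ?_⟩
      rw [show (⟨x + y, add_mem hxm hym⟩ : maximalIdeal R) = ⟨x, hxm⟩ + ⟨y, hym⟩ from rfl, map_add]
      exact add_mem hx hy)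
  exact h

lemma disjoint_cotangentImage_iff [IsLocalRing R] {I J : Ideal R} (hI : I ≤ maximalIdeal R)
    (hJ : J ≤ maximalIdeal R) :
    Disjoint (cotangentImage I) (cotangentImage J) ↔ Disjoint (cot k I) (cot k J) := by
  rw [Submodule.disjoint_def, Submodule.disjoint_def]
  constructor
  · rintro h z hzI hzJ
    obtain ⟨a, ha, rfl⟩ := mem_cot.mp hzI
    obtain ⟨b, hb, hab⟩ := mem_cot.mp hzJ
    have h1 : (maximalIdeal R).toCotangent ⟨b, hJ hb⟩ = (maximalIdeal R).toCotangent ⟨a, hI ha⟩ :=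
      Ideal.toCotangent_eq _ |>.mpr (Ideal.Quotient.eq.mp hab)
    have h2 := h _ (mem_cotangentImage.mpr ⟨⟨a, hI ha⟩, ha, rfl⟩)
      (mem_cotangentImage.mpr ⟨⟨b, hJ hb⟩, hb, h1⟩)
    exact Ideal.Quotient.eq_zero_iff_mem.mpr ((Ideal.toCotangent_eq_zero _ _).mp h2)
  · rintro h z hzI hzJ
    obtain ⟨a, ha, rfl⟩ := mem_cotangentImage.mp hzI
    obtain ⟨b, hb, hab⟩ := mem_cotangentImage.mp hzJ
    rw [Ideal.toCotangent_eq] at hab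
    rw [Ideal.toCotangent_eq_zero]
    exact Ideal.Quotient.eq_zero_iff_mem.mp (h _ (mem_cot.mpr ⟨a, ha, rfl⟩)
      (mem_cot.mpr ⟨b, hb, Ideal.Quotient.eq.mpr hab⟩))

end Cotangent

/-! ### Splayedness as disjointness of cotangent images. -/

section Splayed

variable {k : Type u} [Field k] {X : Scheme.{u}} [X.Over (Spec (.of k))]

lemma iInf_tangentSubspace {T : Set X.IdealSheafData} {p : X} (hp : p ∈ (sSup T).support) :
    ⨅ D ∈ T, tangentSubspace D p = (cotangentImage (stalkIdeal (sSup T) p)).dualAnnihilator := by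
  rw [stalkIdeal_sSup, cotangentImage_biSup _ _ fun D hD ↦
    mem_support_iff_stalkIdeal_le.mp (mem_support_sSup.mp hp D hD),
    Submodule.dualAnnihilator_iSup_eq]
  refine iInf_congr fun D ↦ ?_
  rw [Submodule.dualAnnihilator_iSup_eq]
  rfl

/-- The tangent spaces are annihilators of the cotangent images. In finite dimension the sum of two
annihilators is the annihilator of the intersection, which is everything exactly when the
intersection is zero. -/
lemma isSplayedAt_iff_disjoint [IsAlgClosed k] [LocallyOfFiniteType (X ↘ Spec (.of k))]
    {S : Set X.IdealSheafData} {p : X} (hpc : IsClosed {p}) (hp : p ∈ (sSup S).support) :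
    IsSplayedAt S p ↔ ∃ S₁ S₂ : Set X.IdealSheafData, S₁.Nonempty ∧ S₂.Nonempty ∧ S = S₁ ∪ S₂ ∧
      Disjoint (cot k (stalkIdeal (sSup S₁) p)) (cot k (stalkIdeal (sSup S₂) p)) := by
  have := isRationalLocal_stalk (k := k) hpc
  have := IsRationalLocal.isNoetherianRing k (X.presheaf.stalk p)
  refine exists₂_congr fun S₁ S₂ ↦ and_congr_right fun _ ↦ and_congr_right fun _ ↦
    and_congr_right fun h ↦ ?_
  have h1 : p ∈ (sSup S₁).support := mem_support_sSup.mpr fun D hD ↦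
    mem_support_sSup.mp hp D (h ▸ .inl hD)
  have h2 : p ∈ (sSup S₂).support := mem_support_sSup.mpr fun D hD ↦
    mem_support_sSup.mp hp D (h ▸ .inr hD)
  rw [iInf_tangentSubspace h1, iInf_tangentSubspace h2, ← Subspace.dualAnnihilator_inf_eq,
    ← Submodule.dualAnnihilator_bot, Subspace.dualAnnihilator_inj, ← disjoint_iff,
    disjoint_cotangentImage_iff (k := k) (mem_support_iff_stalkIdeal_le.mp h1)
      (mem_support_iff_stalkIdeal_le.mp h2)]

end Splayed

/-! ### Irreducible components through a point where the local ideal is prime. -/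

section Components

variable {X : Scheme.{u}} {Z : X.IdealSheafData} {p : X}

lemma IsComponent.isClosed {C : Set X} (hC : IsComponent Z C) : IsClosed C := by
  have h : IsIrreducible (closure C) ∧ closure C ⊆ Z.support :=
    ⟨hC.prop.1.closure, closure_minimal hC.prop.2 Z.support.isClosed⟩
  exact closure_subset_iff_isClosed.mp (hC.2 h subset_closure)

/-- The point of `X` that corresponds to the prime ideal of `Z` at `p`. -/
def localGenericPoint (Z : X.IdealSheafData) (p : X) (hZ : (stalkIdeal Z p).IsPrime) : X :=
  X.fromSpecStalk p ⟨stalkIdeal Z p, hZ⟩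

variable (hZ : (stalkIdeal Z p).IsPrime)

lemma localGenericPoint_specializes : localGenericPoint Z p hZ ⤳ p := by
  have : localGenericPoint Z p hZ ∈ Set.range (X.fromSpecStalk p) := ⟨_, rfl⟩
  rwa [Scheme.range_fromSpecStalk] at this

lemma mem_closure_localGenericPoint : p ∈ closure {localGenericPoint Z p hZ} :=
  (localGenericPoint_specializes hZ).mem_closure

lemma localGenericPoint_mem_support_iff {D : X.IdealSheafData} :
    localGenericPoint Z p hZ ∈ D.support ↔ stalkIdeal D p ≤ stalkIdeal Z p :=
  fromSpecStalk_mem_support_iff _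

lemma closure_localGenericPoint_subset_iff {D : X.IdealSheafData} :
    closure {localGenericPoint Z p hZ} ⊆ D.support ↔ stalkIdeal D p ≤ stalkIdeal Z p := by
  rw [D.support.isClosed.closure_subset_iff, Set.singleton_subset_iff]
  exact localGenericPoint_mem_support_iff hZ

/-- The generic point of `C` comes from a prime of the local ring at `p` containing the ideal of
`Z`, so it is a specialization of the point given by that ideal. Hence only one component of `Z`
passes through `p`. -/
lemma subset_closure_localGenericPoint {C : Set X} (hC : IsIrreducible C) (hpC : p ∈ C)
    (hCZ : C ⊆ Z.support) : C ⊆ closure {localGenericPoint Z p hZ} := by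
  obtain ⟨q, hq⟩ := exists_fromSpecStalk_eq (p := p) (x := hC.genericPoint)
    (specializes_iff_mem_closure.mpr (by
      rw [hC.genericPoint_closure_eq]; exact subset_closure hpC))
  have h1 : hC.genericPoint ∈ Z.support := by
    have h2 : hC.genericPoint ∈ closure C := by
      rw [← hC.genericPoint_closure_eq]; exact subset_closure rfl
    exact closure_minimal hCZ Z.support.isClosed h2
  rw [← hq, fromSpecStalk_mem_support_iff] at h1
  have h3 : localGenericPoint Z p hZ ⤳ hC.genericPoint := by
    rw [← hq]
    exact fromSpecStalk_specializes_iff.mpr h1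
  refine subset_closure.trans ?_
  rw [← hC.genericPoint_closure_eq]
  exact specializes_iff_closure_subset.mp h3

lemma isComponent_closure_localGenericPoint :
    IsComponent Z (closure {localGenericPoint Z p hZ}) := by
  refine ⟨⟨isIrreducible_singleton.closure,
    (closure_localGenericPoint_subset_iff hZ).mpr le_rfl⟩, fun C hC hle ↦ ?_⟩
  exact subset_closure_localGenericPoint hZ hC.1 (hle (mem_closure_localGenericPoint hZ)) hC.2

lemma IsComponent.eq_closure_localGenericPoint {C : Set X} (hC : IsComponent Z C) (hpC : p ∈ C) :
    C = closure {localGenericPoint Z p hZ} :=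
  hC.eq_of_le (isComponent_closure_localGenericPoint hZ).prop
    (subset_closure_localGenericPoint hZ hC.prop.1 hpC hC.prop.2)

lemma IsComponent.subset_support_iff (hZ : (stalkIdeal Z p).IsPrime) {C : Set X}
    (hC : IsComponent Z C) (hpC : p ∈ C) {D : X.IdealSheafData} : C ⊆ D.support ↔ stalkIdeal D p ≤ stalkIdeal Z p := by
  rw [hC.eq_closure_localGenericPoint hZ hpC]
  exact closure_localGenericPoint_subset_iff hZ

lemma support_reducedIdeal (C : Set X) : ((reducedIdeal C).support : Set X) = closure C := by
  rw [reducedIdeal, Scheme.IdealSheafData.coe_support_vanishingIdeal, Closeds.coe_closure]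

lemma le_reducedIdeal {D : X.IdealSheafData} {C : Set X} (h : C ⊆ D.support) :
    D ≤ reducedIdeal C := by
  rw [reducedIdeal, ← Scheme.IdealSheafData.le_support_iff_le_vanishingIdeal]
  exact closure_minimal h D.support.isClosed

/-- A prime local ideal is already reduced with a single component, so passing to `C` with its
reduced structure changes nothing at `p`. -/
lemma IsComponent.stalkIdeal_reducedIdeal (hZ : (stalkIdeal Z p).IsPrime) {C : Set X}
    (hC : IsComponent Z C) (hpC : p ∈ C) :
    stalkIdeal (reducedIdeal C) p = stalkIdeal Z p := by
  refine le_antisymm ((hC.subset_support_iff hZ hpC).mp ?_)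
    (stalkIdeal_mono (le_reducedIdeal hC.prop.2) p)
  exact subset_closure.trans (support_reducedIdeal C).ge

lemma finite_setOf_isComponent [NoetherianSpace X] (Z : X.IdealSheafData) :
    {C | IsComponent Z C}.Finite := by
  obtain ⟨T, hT, h1, h2, h3⟩ :=
    NoetherianSpace.exists_finite_set_isClosed_irreducible Z.support.isClosed
  refine hT.subset fun C (hC : IsComponent Z C) ↦ ?_
  obtain ⟨t, htT, ht⟩ := isIrreducible_iff_sUnion_isClosed.mp hC.prop.1 hT.toFinset
    (fun z hz ↦ h1 z (hT.mem_toFinset.mp hz)) (by simpa [← h3] using hC.prop.2)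
  rw [hT.mem_toFinset] at htT
  rw [hC.eq_of_le ⟨h2 t htT, h3 ▸ Set.subset_sUnion_of_mem htT⟩ ht]
  exact htT

lemma finite_nonSplayedComponents [NoetherianSpace X] {S : Set X.IdealSheafData}
    (hS : S.Finite) : (nonSplayedComponents S).Finite := by
  refine (hS.finite_subsets.biUnion fun I _ ↦ finite_setOf_isComponent (sSup I)).subset ?_
  rintro C ⟨I, hI, -, hC, -⟩
  exact Set.mem_biUnion hI hC

end Components

/-! ### Effective Cartier divisors and their local equations. -/

section Cartier

variable {X : Scheme.{u}} {D : X.IdealSheafData}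

lemma IsEffectiveCartier.exists_stalkIdeal_eq (hD : IsEffectiveCartier D) (p : X) :
    ∃ t ∈ nonZeroDivisors (X.presheaf.stalk p), stalkIdeal D p = Ideal.span {t} := by
  obtain ⟨U, hU, g, hg, h⟩ := hD p
  letI := (X.presheaf.germ U.1 p hU).hom.toAlgebra
  have l1 := isLocalization_germ U.2 hU
  refine ⟨X.presheaf.germ U.1 p hU g, IsLocalization.map_nonZeroDivisors_le
    (IsAffineOpen.primeIdealOf U.2 ⟨p, hU⟩).asIdeal.primeCompl _ ⟨g, hg, rfl⟩, ?_⟩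
  rw [stalkIdeal_eq D hU, h, Ideal.map_span, Set.image_singleton]

/-- Spreading out: each of the finitely many generators becomes a multiple of `a` after
multiplication by some element invertible at `p`, and the product of these elements defines the
neighbourhood. -/
lemma exists_affineOpen_ideal_eq_span {p : X} {U : X.affineOpens} (hU : p ∈ U.1)
    (hfg : (D.ideal U).FG) {t : X.presheaf.stalk p} (ht : stalkIdeal D p = Ideal.span {t}) :
    ∃ (V : X.affineOpens) (_ : V ≤ U) (hV : p ∈ V.1) (g : Γ(X, V.1)),
      D.ideal V = Ideal.span {g} ∧ Ideal.span {t} = Ideal.span {X.presheaf.germ V.1 p hV g} := by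
  classical
  have hUa : IsAffineOpen U.1 := U.2
  letI := (X.presheaf.germ U.1 p hU).hom.toAlgebra
  have l1 := isLocalization_germ hUa hU
  set M := (hUa.primeIdealOf ⟨p, hU⟩).asIdeal.primeCompl
  have hmap : stalkIdeal D p = (D.ideal U).map (algebraMap Γ(X, U.1) (X.presheaf.stalk p)) :=
    stalkIdeal_eq D hU
  obtain ⟨a, ha, hat⟩ : ∃ a ∈ D.ideal U, Ideal.span {t} =
      Ideal.span {algebraMap Γ(X, U.1) (X.presheaf.stalk p) a} := by
    have h1 : t ∈ (D.ideal U).map (algebraMap Γ(X, U.1) (X.presheaf.stalk p)) := by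
      rw [← hmap, ht]; exact Ideal.mem_span_singleton_self t
    obtain ⟨⟨a, s⟩, h2⟩ := (IsLocalization.mem_map_algebraMap_iff M _).mp h1
    refine ⟨a, a.2, ?_⟩
    rw [← h2, Ideal.span_singleton_mul_right_unit (IsLocalization.map_units _ s)]
  have hle (b : Γ(X, U.1)) (hb : b ∈ D.ideal U) : ∃ s ∈ M, s * b ∈ Ideal.span {a} := by
    rw [← IsLocalization.algebraMap_mem_map_algebraMap_iff M (X.presheaf.stalk p), Ideal.map_span,
      Set.image_singleton, ← hat, ← ht, hmap]
    exact Ideal.mem_map_of_mem _ hb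
  obtain ⟨s, hsM, hs⟩ : ∃ s ∈ M, ∀ b ∈ D.ideal U, s * b ∈ Ideal.span {a} := by
    obtain ⟨F, hF⟩ := hfg
    choose! c hcM hc using hle
    refine ⟨∏ b ∈ F, c b, prod_mem fun b hb ↦ hcM b (hF ▸ Ideal.subset_span hb), fun b hb ↦ ?_⟩
    rw [← hF] at hb
    refine Submodule.span_induction (p := fun b _ ↦ (∏ b ∈ F, c b) * b ∈ Ideal.span {a})
      (fun b hb ↦ ?_) (by rw [mul_zero]; exact zero_mem _)
      (fun x y _ _ hx hy ↦ by rw [mul_add]; exact add_mem hx hy)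
      (fun r x _ hx ↦ by rw [smul_eq_mul, mul_left_comm]; exact Ideal.mul_mem_left _ _ hx) hb
    rw [← Finset.mul_prod_erase F c hb, mul_comm (c b), mul_assoc]
    exact Ideal.mul_mem_left _ _ (hc b (hF ▸ Ideal.subset_span hb))
  have hps : p ∈ X.basicOpen s := by
    rw [Scheme.mem_basicOpen X s p hU]
    exact IsLocalization.map_units (X.presheaf.stalk p) (⟨s, hsM⟩ : M)
  refine ⟨X.affineBasicOpen s, X.basicOpen_le s, hps,
    X.presheaf.map (homOfLE (X.basicOpen_le s)).op a, ?_, ?_⟩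
  · rw [← D.map_ideal (U := X.affineBasicOpen s) (V := U) (X.basicOpen_le s)]
    refine le_antisymm (Ideal.map_le_iff_le_comap.mpr fun b hb ↦ ?_)
      ((Ideal.span_singleton_le_iff_mem _).mpr (Ideal.mem_map_of_mem _ ha))
    obtain ⟨c, hc⟩ := Ideal.mem_span_singleton'.mp (hs b hb)
    have hu : IsUnit (X.presheaf.map (homOfLE (X.basicOpen_le s)).op s) :=
      RingedSpace.isUnit_res_basicOpen _ s
    rw [Ideal.mem_comap]
    refine (Ideal.unit_mul_mem_iff_mem _ hu).mp ?_
    refine Ideal.mem_span_singleton'.mpr ⟨X.presheaf.map (homOfLE (X.basicOpen_le s)).op c, ?_⟩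
    have := congr(X.presheaf.map (homOfLE (X.basicOpen_le s)).op $hc)
    rw [map_mul, map_mul] at this
    exact this
  · rw [hat]
    exact congrArg (fun z ↦ Ideal.span {z})
      (X.presheaf.germ_res_apply (homOfLE (X.basicOpen_le s)) p hps a).symm

end Cartier

/-! ### Cartier divisors from equations at closed points. -/

section OverField

variable {k : Type u} [Field k] {X : Scheme.{u}} [X.Over (Spec (.of k))]

lemma isNoetherianRing_section [LocallyOfFiniteType (X ↘ Spec (.of k))] {U : X.Opens}
    (hU : IsAffineOpen U) : IsNoetherianRing Γ(X, U) :=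
  have := finiteType_section (k := k) hU
  Algebra.FiniteType.isNoetherianRing k _

lemma exists_isClosed_specializes [LocallyOfFiniteType (X ↘ Spec (.of k))] (x : X) :
    ∃ p, x ⤳ p ∧ IsClosed {p} := by
  have := jacobsonSpace_of_over (k := k) (X := X)
  obtain ⟨p, hp, hpc⟩ := nonempty_inter_closedPoints (Z := closure {x})
    ⟨x, subset_closure rfl⟩ isClosed_closure.isLocallyClosed
  exact ⟨p, specializes_iff_mem_closure.mpr hp, hpc⟩

/-- Every point specializes to a closed one, and an equation at the closed point spreads to a
neighbourhood that contains both. -/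
lemma isEffectiveCartier_of_stalkIdeal [LocallyOfFiniteType (X ↘ Spec (.of k))] [IsIntegral X]
    {D : X.IdealSheafData} (h : ∀ p, IsClosed {p} → ∃ t ≠ 0, stalkIdeal D p = Ideal.span {t}) :
    IsEffectiveCartier D := by
  intro x
  obtain ⟨p, hxp, hp⟩ := exists_isClosed_specializes (k := k) x
  obtain ⟨t, ht0, ht⟩ := h p hp
  obtain ⟨U, hU⟩ := exists_affineOpen_mem p
  have := isNoetherianRing_section (k := k) U.2
  obtain ⟨V, -, hV, g, hg, hgt⟩ := exists_affineOpen_ideal_eq_span hU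
    (IsNoetherian.noetherian (D.ideal U)) ht
  refine ⟨V, hxp.mem_open V.1.2 hV, g, ?_, hg⟩
  have : Nonempty V.1 := ⟨p, hV⟩
  refine mem_nonZeroDivisors_of_ne_zero fun h0 ↦ ht0 ?_
  rw [h0, map_zero, Ideal.span_singleton_eq_span_singleton, associated_zero_iff_eq_zero] at hgt
  exact hgt

end OverField

/-! ### Arrangements at closed points and the structure along a minimal non-splayed component. -/

section Arrangement

variable {k : Type u} [Field k] {X : Scheme.{u}} [X.Over (Spec (.of k))]

lemma stalkIdeal_bot (p : X) : stalkIdeal (⊥ : X.IdealSheafData) p = ⊥ := by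
  obtain ⟨U, hU⟩ := exists_affineOpen_mem p
  rw [stalkIdeal_eq _ hU]
  exact Ideal.map_bot

lemma isPrime_of_formallySmooth {R : Type*} [CommRing R] [Algebra k R] [IsRationalLocal k R]
    {J : Ideal R} (hJ : J ≤ IsLocalRing.maximalIdeal R) [Algebra.FormallySmooth k (R ⧸ J)] :
    J.IsPrime := by
  have : Nontrivial (R ⧸ J) := Ideal.Quotient.nontrivial_iff.mpr
    (ne_top_of_le_ne_top (IsLocalRing.maximalIdeal.isMaximal R).ne_top hJ)
  have := isDomain_of_formallySmooth k (R ⧸ J)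
  exact (Ideal.Quotient.isDomain_iff_prime J).mp this

/-- The local properties of an arrangement at the closed points. -/
structure IsLocalArrangement (k : Type u) [Field k] {X : Scheme.{u}} [X.Over (Spec (.of k))]
    (S : Set X.IdealSheafData) : Prop where
  locallyOfFiniteType : LocallyOfFiniteType (X ↘ Spec (.of k))
  formallySmooth : ∀ T ⊆ S, ∀ p ∈ (sSup T).support, IsClosed {p} →
    Algebra.FormallySmooth k (X.presheaf.stalk p ⧸ stalkIdeal (sSup T) p)
  ne_bot : ∀ D ∈ S, ∀ p, stalkIdeal D p ≠ ⊥

lemma IsArrangement.isLocalArrangement {S : Set X.IdealSheafData}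
    (hS : IsArrangement (X ↘ Spec (.of k)) S) : IsLocalArrangement k S where
  locallyOfFiniteType := hS.isVariety.locallyOfFiniteType
  formallySmooth T hT p hp hpc := by
    have := hS.isVariety.locallyOfFiniteType
    exact (smooth_subscheme_iff _).mp (hS.smooth T hT) p hp hpc
  ne_bot D hD p h := by
    obtain ⟨t, ht, hD⟩ := (hS.isEffectiveCartier D hD).exists_stalkIdeal_eq p
    rw [h, eq_comm, Ideal.span_singleton_eq_bot] at hD
    exact nonZeroDivisors.ne_zero ht hD

namespace IsLocalArrangement

variable {S : Set X.IdealSheafData} (hS : IsLocalArrangement k S)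

include hS

variable [IsAlgClosed k] {p : X} (hpc : IsClosed {p})

include hpc

lemma isRationalLocal : IsRationalLocal k (X.presheaf.stalk p) :=
  have := hS.locallyOfFiniteType
  isRationalLocal_stalk hpc

omit [IsAlgClosed k] in
lemma formallySmooth_stalk : Algebra.FormallySmooth k (X.presheaf.stalk p) := by
  have := hS.formallySmooth ∅ (Set.empty_subset _) p (mem_support_sSup.mpr (by simp)) hpc
  rw [sSup_empty, stalkIdeal_bot] at this
  exact .of_equiv (AlgEquiv.quotientBot k (X.presheaf.stalk p))

lemma isPrime {T : Set X.IdealSheafData} (hT : T ⊆ S) (hp : p ∈ (sSup T).support) :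
    (stalkIdeal (sSup T) p).IsPrime := by
  have := hS.isRationalLocal hpc
  have := hS.formallySmooth T hT p hp hpc
  exact isPrime_of_formallySmooth (k := k) (mem_support_iff_stalkIdeal_le.mp hp)

/-- By Nakayama in the form `eq_of_cot_le`, a zero image would make the ideal of `D` zero. -/
lemma cot_ne_bot {D : X.IdealSheafData} (hD : D ∈ S) (hp : p ∈ D.support) :
    cot k (stalkIdeal D p) ≠ ⊥ := by
  have := hS.isRationalLocal hpc
  have h1 := hS.formallySmooth {D} (Set.singleton_subset_iff.mpr hD) p
    (by rwa [sSup_singleton]) hpc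
  rw [sSup_singleton] at h1
  intro h
  exact hS.ne_bot D hD p (eq_of_cot_le (k := k) bot_le (mem_support_iff_stalkIdeal_le.mp hp)
    (h.trans_le bot_le)).symm

/-- The conormal rank at `x` does not depend on `p`, so two closed specializations of `x` have
cotangent images of equal dimension. -/
lemma finrank_cot {x : X} (hx : x ⤳ p) {T : Set X.IdealSheafData} (hT : T ⊆ S)
    (hp : p ∈ (sSup T).support) : HasConormalRank (stalkIdeal (sSup T) x)
      (Module.finrank k (cot k (stalkIdeal (sSup T) p))) := by
  have := hS.isRationalLocal hpc
  have := hS.formallySmooth_stalk hpc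
  have := hS.formallySmooth T hT p hp hpc
  have h1 := hasConormalRank_finrank_cot (k := k) (mem_support_iff_stalkIdeal_le.mp hp)
  obtain ⟨M, hM⟩ := exists_isLocalization_stalkSpecializes hx
  letI := (X.presheaf.stalkSpecializes hx).hom.toAlgebra
  rw [stalkIdeal_of_specializes _ hx]
  exact h1.localization M (X.presheaf.stalk x)

lemma isSplayedAt_iff {T : Set X.IdealSheafData} (hp : p ∈ (sSup T).support) :
    IsSplayedAt T p ↔ ∃ S₁ S₂ : Set X.IdealSheafData, S₁.Nonempty ∧ S₂.Nonempty ∧ T = S₁ ∪ S₂ ∧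
      Disjoint (cot k (stalkIdeal (sSup S₁) p)) (cot k (stalkIdeal (sSup S₂) p)) :=
  have := hS.locallyOfFiniteType
  isSplayedAt_iff_disjoint hpc hp

omit hpc

/-- Disjointness of two cotangent images means that the dimension of their sum is the sum of the
dimensions. All three dimensions agree at `p` and `q`, so one decomposition works at both. -/
lemma isSplayedAt_of_specializes {q x : X} (hpc : IsClosed {p}) (hqc : IsClosed {q})
    (hxp : x ⤳ p) (hxq : x ⤳ q) {T : Set X.IdealSheafData} (hT : T ⊆ S)
    (hx : x ∈ (sSup T).support) (h : IsSplayedAt T p) : IsSplayedAt T q := by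
  have hsupp (T' : Set X.IdealSheafData) (hT' : T' ⊆ T) (y : X) (hy : x ⤳ y) :
      y ∈ (sSup T').support := by
    have h1 : x ∈ (sSup T').support := mem_support_sSup.mpr fun D hD ↦
      mem_support_sSup.mp hx D (hT' hD)
    exact hy.mem_closed (sSup T').support.isClosed h1
  have hrank (T' : Set X.IdealSheafData) (hT' : T' ⊆ T) :
      Module.finrank k (cot k (stalkIdeal (sSup T') p)) =
      Module.finrank k (cot k (stalkIdeal (sSup T') q)) :=
    (hS.finrank_cot hpc hxp (hT'.trans hT) (hsupp T' hT' p hxp)).unique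
      (by rw [Ne, stalkIdeal_eq_top_iff, not_not]; exact hsupp T' hT' x specializes_rfl)
      (hS.finrank_cot hqc hxq (hT'.trans hT) (hsupp T' hT' q hxq))
  rw [hS.isSplayedAt_iff hpc (hsupp T le_rfl p hxp)] at h
  rw [hS.isSplayedAt_iff hqc (hsupp T le_rfl q hxq)]
  obtain ⟨S₁, S₂, h1, h2, rfl, h⟩ := h
  refine ⟨S₁, S₂, h1, h2, rfl, ?_⟩
  have hfin {y : X} (hyc : IsClosed {y}) (hy : x ⤳ y) (T' : Set X.IdealSheafData)
      (hT' : T' ⊆ S₁ ∪ S₂) : FiniteDimensional k (cot k (stalkIdeal (sSup T') y)) :=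
    have := hS.isRationalLocal hyc
    finiteDimensional_cot (mem_support_iff_stalkIdeal_le.mp (hsupp T' hT' y hy))
  have f1 := hfin hpc hxp S₁ Set.subset_union_left
  have f2 := hfin hpc hxp S₂ Set.subset_union_right
  have f3 := hfin hqc hxq S₁ Set.subset_union_left
  have f4 := hfin hqc hxq S₂ Set.subset_union_right
  have hsup (y : X) : cot k (stalkIdeal (sSup (S₁ ∪ S₂)) y) =
      cot k (stalkIdeal (sSup S₁) y) ⊔ cot k (stalkIdeal (sSup S₂) y) := by
    rw [← cot_sup, stalkIdeal_sSup, stalkIdeal_sSup, stalkIdeal_sSup, iSup_union]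
  have h3 := hrank (S₁ ∪ S₂) le_rfl
  rw [disjoint_iff_finrank_sup, ← hsup, hrank S₁ Set.subset_union_left,
    hrank S₂ Set.subset_union_right, h3] at h
  rwa [disjoint_iff_finrank_sup, ← hsup]

/-- A set of divisors is splayed at one closed point of a component if and only if it is splayed
at all of them. -/
lemma not_isSplayedAt_of_not_isSplayedAlong {T : Set X.IdealSheafData} (hT : T ⊆ S) {C : Set X}
    (hC : IsIrreducible C) (hCT : C ⊆ (sSup T).support) (h : ¬ IsSplayedAlong T C) (hp : p ∈ C)
    (hpc : IsClosed {p}) : ¬ IsSplayedAt T p := by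
  intro h1
  refine h fun q hq hqc ↦ ?_
  have hsp (y) (hy : y ∈ C) : hC.genericPoint ⤳ y := specializes_iff_mem_closure.mpr (by
    rw [hC.genericPoint_closure_eq]; exact subset_closure hy)
  have h2 : hC.genericPoint ∈ closure C := by
    rw [← hC.genericPoint_closure_eq]; exact subset_closure rfl
  exact hS.isSplayedAt_of_specializes hpc hqc (hsp p hp) (hsp q hq) hT
    (closure_minimal hCT (sSup T).support.isClosed h2) h1

end IsLocalArrangement

lemma cot_stalkIdeal_sSup_union (S₁ S₂ : Set X.IdealSheafData) (p : X) :
    cot k (stalkIdeal (sSup (S₁ ∪ S₂)) p) =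
      cot k (stalkIdeal (sSup S₁) p) ⊔ cot k (stalkIdeal (sSup S₂) p) := by
  rw [← cot_sup, stalkIdeal_sSup, stalkIdeal_sSup, stalkIdeal_sSup, iSup_union]

lemma stalkIdeal_sSup_mono {S₁ S₂ : Set X.IdealSheafData} (h : S₁ ⊆ S₂) (p : X) :
    stalkIdeal (sSup S₁) p ≤ stalkIdeal (sSup S₂) p :=
  stalkIdeal_mono (sSup_le_sSup h) p

/-- At a closed point of a minimal non-splayed component `C`, the divisors containing `C` cut out
`C`, and they are transversal to the other divisors through the point. -/
theorem IsLocalArrangement.minimal_nonSplayed [IsAlgClosed k] {S : Set X.IdealSheafData}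
    (hS : IsLocalArrangement k S) (hfin : S.Finite) {C : Set X}
    (hC : Minimal (fun B ↦ B ∈ nonSplayedComponents S) C) {p : X} (hpC : p ∈ C)
    (hpc : IsClosed {p}) :
    stalkIdeal (reducedIdeal C) p = stalkIdeal (sSup {D ∈ S | C ⊆ D.support}) p ∧
    Disjoint (cot k (stalkIdeal (sSup {D ∈ S | C ⊆ D.support}) p))
      (cot k (stalkIdeal (sSup {D ∈ S | p ∈ D.support ∧ ¬ C ⊆ D.support}) p)) := by
  obtain ⟨I, hIS, hI, hIC, hIns⟩ := hC.prop
  have hIp := hS.not_isSplayedAt_of_not_isSplayedAlong hIS hIC.prop.1 hIC.prop.2 hIns hpC hpc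
  have hpI : p ∈ (sSup I).support := hIC.prop.2 hpC
  have hIprime := hS.isPrime hpc hIS hpI
  set K := {D ∈ S | C ⊆ D.support} with hK
  have hIK : I ⊆ K := fun D hD ↦ ⟨hIS hD, fun x hx ↦ mem_support_sSup.mp (hIC.prop.2 hx) D hD⟩
  have hred := hIC.stalkIdeal_reducedIdeal hIprime hpC
  have hKI : stalkIdeal (sSup K) p = stalkIdeal (sSup I) p := by
    refine le_antisymm ?_ (stalkIdeal_sSup_mono hIK p)
    rw [stalkIdeal_sSup]
    exact iSup₂_le fun D hD ↦ (hIC.subset_support_iff hIprime hpC).mp hD.2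
  refine ⟨hred.trans hKI.symm, ?_⟩
  rw [hKI]
  set Sp := {D ∈ S | p ∈ D.support} with hSp
  have hKSp : K ⊆ Sp := fun D hD ↦ ⟨hD.1, hD.2 hpC⟩
  -- Take `M` minimal among the sets between `K` and `Sp` that are transversal to their complement
  -- in `Sp`; the claim will be `M = K`.
  have hMfin : {M | K ⊆ M ∧ M ⊆ Sp ∧ Disjoint (cot k (stalkIdeal (sSup M) p))
      (cot k (stalkIdeal (sSup (Sp \ M)) p))}.Finite :=
    (hfin.subset (Set.sep_subset S _ : Sp ⊆ S)).finite_subsets.subset fun M hM ↦ hM.2.1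
  obtain ⟨M, hM⟩ := hMfin.exists_minimal ⟨Sp, hKSp, le_rfl, by
    rw [Set.sdiff_self, sSup_empty, stalkIdeal_bot, (cot_eq_bot_iff (k := k)).mpr bot_le]
    exact disjoint_bot_right⟩
  obtain ⟨hKM, hMSp, hdisj⟩ := hM.prop
  have hMS : M ⊆ S := hMSp.trans (Set.sep_subset S _)
  have hpM : p ∈ (sSup M).support := mem_support_sSup.mpr fun D hD ↦ (hMSp hD).2
  have hle (T : Set X.IdealSheafData) (D) (hD : D ∈ T) : cot k (stalkIdeal D p) ≤
      cot k (stalkIdeal (sSup T) p) := cot_mono (stalkIdeal_mono (le_sSup hD) p)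
  -- A splitting of `M` with `I` on one side contradicts minimality: that side contains `K` and is
  -- again transversal to its complement in `Sp`. A divisor common to both sides is impossible, its
  -- cotangent image being nonzero.
  have key (M₁ M₂ : Set X.IdealSheafData) (hM2 : M₂.Nonempty) (hM12 : M = M₁ ∪ M₂)
      (hd : Disjoint (cot k (stalkIdeal (sSup M₁) p)) (cot k (stalkIdeal (sSup M₂) p)))
      (hI1 : I ⊆ M₁) : False := by
    have hnot (D) (hD1 : cot k (stalkIdeal D p) ≤ cot k (stalkIdeal (sSup M₁) p))
        (hD2 : D ∈ M₂) : False :=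
      hS.cot_ne_bot hpc (hMS (hM12 ▸ .inr hD2)) (hMSp (hM12 ▸ .inr hD2)).2
        (le_bot_iff.mp (hd hD1 (hle _ D hD2)))
    have hKM1 : K ⊆ M₁ := fun D hD ↦ by
      rcases (hM12 ▸ hKM hD : D ∈ M₁ ∪ M₂) with h | h
      · exact h
      · refine (hnot D ?_ h).elim
        exact (hle K D hD).trans (hKI ▸ cot_mono (stalkIdeal_sSup_mono hI1 p))
    have hdiff : Sp \ M₁ ⊆ M₂ ∪ Sp \ M := fun D hD ↦ by
      by_cases h : D ∈ M
      · rcases (hM12 ▸ h : D ∈ M₁ ∪ M₂) with h | h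
        · exact (hD.2 h).elim
        · exact .inl h
      · exact .inr ⟨hD.1, h⟩
    have hM1 : M₁ ⊆ M := hM12 ▸ Set.subset_union_left
    have h1 := hM.2 (y := M₁) ⟨hKM1, hM1.trans hMSp, by
      refine Disjoint.mono_right (cot_mono (stalkIdeal_sSup_mono hdiff p)) ?_
      rw [cot_stalkIdeal_sSup_union]
      refine hd.disjoint_sup_right_of_disjoint_sup_left ?_
      rwa [← cot_stalkIdeal_sSup_union, ← hM12]⟩ hM1
    obtain ⟨D, hD⟩ := hM2
    exact hnot D (hle _ D (h1 (hM12 ▸ .inr hD))) hD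
  -- If `I` met neither hypothesis of `key`, a splitting of `M` would restrict to one of `I`, which
  -- is non-splayed at `p`.
  have hMns : ¬ IsSplayedAt M p := by
    intro h
    obtain ⟨M₁, M₂, hM1, hM2, hM12, hd⟩ := (hS.isSplayedAt_iff hpc hpM).mp h
    by_cases h1 : I ⊆ M₁
    · exact key M₁ M₂ hM2 hM12 hd h1
    by_cases h2 : I ⊆ M₂
    · exact key M₂ M₁ hM1 (hM12.trans (Set.union_comm _ _)) hd.symm h2
    refine hIp ((hS.isSplayedAt_iff hpc hpI).mpr ⟨I ∩ M₁, I ∩ M₂, ?_, ?_, ?_, ?_⟩)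
    · obtain ⟨D, hD, hD'⟩ := Set.not_subset.mp h2
      exact ⟨D, hD, (hM12 ▸ hKM (hIK hD) : D ∈ M₁ ∪ M₂).resolve_right hD'⟩
    · obtain ⟨D, hD, hD'⟩ := Set.not_subset.mp h1
      exact ⟨D, hD, (hM12 ▸ hKM (hIK hD) : D ∈ M₁ ∪ M₂).resolve_left hD'⟩
    · rw [← Set.inter_union_distrib_left, ← hM12, Set.inter_eq_left.mpr (hIK.trans hKM)]
    · exact hd.mono (cot_mono (stalkIdeal_sSup_mono Set.inter_subset_right p))
        (cot_mono (stalkIdeal_sSup_mono Set.inter_subset_right p))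
  have hMprime := hS.isPrime hpc hMS hpM
  have hCM := isComponent_closure_localGenericPoint hMprime
  have hpCM := mem_closure_localGenericPoint hMprime
  have hsub : closure {localGenericPoint (sSup M) p hMprime} ⊆ C := by
    rw [hIC.eq_closure_localGenericPoint hIprime hpC]
    refine subset_closure_localGenericPoint hIprime hCM.prop.1 hpCM ?_
    rw [closure_localGenericPoint_subset_iff]
    exact stalkIdeal_sSup_mono (hIK.trans hKM) p
  -- The component of `⋂ M` through `p` is non-splayed and lies in `C`. Minimality makes it all of
  -- `C`, so every member of `M` contains `C`.
  have hCsub := hC.2 (y := closure {localGenericPoint (sSup M) p hMprime})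
    ⟨M, hMS, hI.mono (hIK.trans hKM), hCM, fun h ↦ hMns (h p hpCM hpc)⟩ hsub
  have hMK : M ⊆ K := fun D hD ↦ ⟨hMS hD, fun x hx ↦
    mem_support_sSup.mp (hCM.prop.2 (hCsub hx)) D hD⟩
  rw [← hKI]
  have hMeq : M = K := hMK.antisymm hKM
  subst hMeq
  refine hdisj.mono_right (cot_mono (stalkIdeal_sSup_mono ?_ p))
  rintro D ⟨hD, hpD, hCD⟩
  exact ⟨⟨hD, hpD⟩, fun h ↦ hCD h.2⟩

end Arrangement

/-! ### Inverse images of ideal sheaves on affine opens and stalks. -/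

section Comap

variable {X Y : Scheme.{u}}

lemma ideal_comap_of_isOpenImmersion' (D : X.IdealSheafData) (j : Y ⟶ X) [IsOpenImmersion j]
    {U : X.affineOpens} {W : Y.affineOpens} (h : W.1 ≤ j ⁻¹ᵁ U.1) :
    (D.comap j).ideal W = (D.ideal U).map (j.appLE U.1 W.1 h).hom := by
  have hVU : j ''ᵁ W.1 ≤ U.1 := (Scheme.Hom.image_mono j h).trans (by
    rw [Scheme.Hom.image_preimage_eq_opensRange_inf]; exact inf_le_right)
  rw [Scheme.IdealSheafData.ideal_comap_of_isOpenImmersion,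
    ← D.map_ideal (U := ⟨j ''ᵁ W.1, W.2.image_of_isOpenImmersion j⟩) (V := U) hVU]
  have h1 : (D.ideal U).map (j.appLE U.1 W.1 h).hom =
      ((D.ideal U).map (X.presheaf.map (homOfLE hVU).op).hom).map (j.appIso W.1).hom.hom := by
    rw [Ideal.map_map, ← CommRingCat.hom_comp, Scheme.Hom.appIso_hom', Scheme.Hom.map_appLE]
  rw [h1]
  exact Ideal.comap_symm (I := (D.ideal U).map (X.presheaf.map (homOfLE hVU).op).hom)
    (j.appIso W.1).commRingCatIsoToRingEquiv

/-- Between affine schemes, inverse image is left adjoint to direct image, which on global sections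
is contraction of ideals; so inverse image is extension of ideals. -/
lemma ideal_comap_top [IsAffine X] [IsAffine Y] (D : X.IdealSheafData) (g : Y ⟶ X) :
    (D.comap g).ideal ⟨⊤, isAffineOpen_top Y⟩ =
      (D.ideal ⟨⊤, isAffineOpen_top X⟩).map g.appTop.hom := by
  refine eq_of_forall_ge_iff fun c ↦ ?_
  obtain ⟨I, rfl⟩ := Scheme.IdealSheafData.equivOfIsAffine.surjective c
  have h1 : (I.map g).ideal ⟨⊤, isAffineOpen_top X⟩ =
    (I.ideal ⟨⊤, isAffineOpen_top Y⟩).comap g.appTop.hom :=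
    Scheme.IdealSheafData.ideal_map_of_isAffineHom I g ⟨⊤, isAffineOpen_top X⟩
  rw [Ideal.map_le_iff_le_comap]
  change _ ≤ I.ideal ⟨⊤, isAffineOpen_top Y⟩ ↔ _ ≤ Ideal.comap _ (I.ideal ⟨⊤, isAffineOpen_top Y⟩)
  rw [← h1]
  constructor
  · intro h
    exact Scheme.IdealSheafData.le_map_iff_comap_le.mpr
      (Scheme.IdealSheafData.le_of_isAffine h) _
  · intro h
    exact Scheme.IdealSheafData.le_map_iff_comap_le.mp (Scheme.IdealSheafData.le_of_isAffine h) _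

/-- Reduce to the affine schemes `W` and `U` by restriction along the open immersions, where the
affine case and the case of open immersions apply. -/
lemma ideal_comap (D : X.IdealSheafData) (g : Y ⟶ X) {U : X.affineOpens} {W : Y.affineOpens}
    (h : W.1 ≤ g ⁻¹ᵁ U.1) :
    (D.comap g).ideal W = (D.ideal U).map (g.appLE U.1 W.1 h).hom := by
  have : IsAffine U.1 := U.2
  have : IsAffine W.1 := W.2
  have hW : (⊤ : W.1.toScheme.Opens) ≤ W.1.ι ⁻¹ᵁ W.1 := by simp
  have hU : (⊤ : U.1.toScheme.Opens) ≤ U.1.ι ⁻¹ᵁ U.1 := by simp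
  have hUW : (⊤ : W.1.toScheme.Opens) ≤ (g.resLE U.1 W.1 h) ⁻¹ᵁ ⊤ := le_preimage_top _ _
  have hgU : (⊤ : W.1.toScheme.Opens) ≤ (W.1.ι ≫ g) ⁻¹ᵁ U.1 := fun x _ ↦ h x.2
  have h1 : ((D.comap g).comap W.1.ι).ideal ⟨⊤, isAffineOpen_top _⟩ =
      ((D.comap g).ideal W).map (W.1.ι.appLE W.1 ⊤ hW).hom :=
    ideal_comap_of_isOpenImmersion' (D.comap g) W.1.ι hW
  have h2 : ((D.comap g).comap W.1.ι).ideal ⟨⊤, isAffineOpen_top _⟩ =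
      ((D.ideal U).map (g.appLE U.1 W.1 h).hom).map (W.1.ι.appLE W.1 ⊤ hW).hom := by
    rw [← Scheme.IdealSheafData.comap_comp, Ideal.map_map, ← CommRingCat.hom_comp,
      Scheme.Hom.appLE_comp_appLE]
    have h3 : g.resLE U.1 W.1 h ≫ U.1.ι = W.1.ι ≫ g := Scheme.Hom.resLE_comp_ι g h
    have h4 : (D.comap (g.resLE U.1 W.1 h ≫ U.1.ι)).ideal ⟨⊤, isAffineOpen_top _⟩ =
        (D.ideal U).map ((g.resLE U.1 W.1 h ≫ U.1.ι).appLE U.1 ⊤ (h3 ▸ hgU)).hom := by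
      rw [Scheme.IdealSheafData.comap_comp, ideal_comap_top,
        ideal_comap_of_isOpenImmersion' D U.1.ι hU, Ideal.map_map, ← CommRingCat.hom_comp]
      have h7 := Scheme.Hom.appLE_comp_appLE (f := g.resLE U.1 W.1 h) (g := U.1.ι) U.1 ⊤ ⊤ hU hUW
      rw [← h7, Scheme.Hom.appTop, Scheme.Hom.app_eq_appLE]
      rfl
    simp only [h3] at h4
    exact h4
  have hbij : Function.Bijective (W.1.ι.appLE W.1 ⊤ hW).hom := by
    have : IsIso (W.1.ι.appLE W.1 ⊤ hW) := by
      have h5 : W.1.ι.appLE W.1 ⊤ hW = W.1.topIso.inv := by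
        simp only [Scheme.Hom.appLE, Scheme.Opens.ι_app, Scheme.Opens.topIso_inv]
        exact (Functor.map_comp _ _ _).symm
      rw [h5]
      infer_instance
    exact ConcreteCategory.bijective_of_isIso (W.1.ι.appLE W.1 ⊤ hW)
  have h6 := h1.symm.trans h2
  rw [← Ideal.comap_map_of_bijective _ hbij (I := (D.comap g).ideal W), h6,
    Ideal.comap_map_of_bijective _ hbij]

lemma stalkIdeal_comap (D : X.IdealSheafData) (g : Y ⟶ X) (q : Y) :
    stalkIdeal (D.comap g) q = (stalkIdeal D (g q)).map (g.stalkMap q).hom := by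
  obtain ⟨U, hU⟩ := exists_affineOpen_mem (g q)
  obtain ⟨W, hW, hWU⟩ := exists_affineOpen_le q (g ⁻¹ᵁ U.1) hU
  rw [stalkIdeal_eq _ hW, ideal_comap D g hWU, stalkIdeal_eq D hU, Ideal.map_map, Ideal.map_map,
    ← CommRingCat.hom_comp, ← CommRingCat.hom_comp, Scheme.Hom.germ_stalkMap, Scheme.Hom.appLE,
    Category.assoc, Y.presheaf.germ_res]

end Comap

/-! ### Strict transforms as saturations by the equation of the exceptional divisor. -/

section StrictTransform

lemma mem_map_saturation_iff {A L : Type*} [CommRing A] [CommRing L] [Algebra A L]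
    (M : Submonoid A) [IsLocalization M L] {I K : Ideal A} {g : A}
    (h : ∀ b, b ∈ I ↔ ∃ n : ℕ, g ^ n * b ∈ K) (b : L) :
    b ∈ I.map (algebraMap A L) ↔ ∃ n : ℕ, algebraMap A L g ^ n * b ∈ K.map (algebraMap A L) := by
  obtain ⟨⟨a, s⟩, hab⟩ := IsLocalization.surj M b
  have hs := IsLocalization.map_units L s
  have h1 : b ∈ I.map (algebraMap A L) ↔ algebraMap A L a ∈ I.map (algebraMap A L) := by
    rw [← hab, mul_comm]
    exact (Ideal.unit_mul_mem_iff_mem _ hs).symm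
  have h2 (n : ℕ) : algebraMap A L g ^ n * b ∈ K.map (algebraMap A L) ↔
      algebraMap A L (g ^ n * a) ∈ K.map (algebraMap A L) := by
    rw [map_mul, map_pow, ← hab, mul_comm b, mul_left_comm]
    exact (Ideal.unit_mul_mem_iff_mem _ hs).symm
  simp only [h1, h2, IsLocalization.algebraMap_mem_map_algebraMap_iff M]
  constructor
  · rintro ⟨m, hm, hma⟩
    obtain ⟨n, hn⟩ := (h _).mp hma
    exact ⟨n, m, hm, by rwa [mul_left_comm]⟩
  · rintro ⟨n, m, hm, hn⟩
    exact ⟨m, hm, (h _).mpr ⟨n, by rwa [mul_left_comm]⟩⟩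

lemma exists_pow_mul_mem_iff {L : Type*} [CommRing L] {s t : L}
    (h : Ideal.span {s} = Ideal.span {t}) (K : Ideal L) (b : L) :
    (∃ n : ℕ, s ^ n * b ∈ K) ↔ ∃ n : ℕ, t ^ n * b ∈ K := by
  have key {s t : L} (h : Ideal.span {s} = Ideal.span {t}) (hs : ∃ n : ℕ, s ^ n * b ∈ K) :
      ∃ n : ℕ, t ^ n * b ∈ K := by
    obtain ⟨n, hn⟩ := hs
    obtain ⟨c, hc⟩ := Ideal.mem_span_singleton'.mp (h ▸ Ideal.mem_span_singleton_self t :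
      t ∈ Ideal.span {s})
    refine ⟨n, ?_⟩
    rw [← hc, mul_pow, mul_assoc]
    exact K.mul_mem_left _ hn
  exact ⟨key h, key h.symm⟩

variable {X X' : Scheme.{u}} {π : X' ⟶ X} {Z : X.IdealSheafData}

/-- On `W` the complement of the exceptional divisor is the basic open set of `t`. The
scheme-theoretic closure is thus the contraction of an ideal from the localization away from `t`. -/
lemma mem_ideal_strictTransform_iff [IsLocallyNoetherian X'] (D : X.IdealSheafData)
    {U : X.affineOpens} {W : X'.affineOpens} (h : W.1 ≤ π ⁻¹ᵁ U.1) {t : Γ(X', W.1)}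
    (ht : (exceptionalDivisor π Z).ideal W = Ideal.span {t}) (b : Γ(X', W.1)) :
    b ∈ (strictTransform π Z D).ideal W ↔
      ∃ n : ℕ, t ^ n * b ∈ (D.ideal U).map (π.appLE U.1 W.1 h).hom := by
  set j := (exceptionalCompl π Z).ι with hj
  have hWa : IsAffineOpen W.1 := W.2
  have himg : j ''ᵁ (j ⁻¹ᵁ W.1) = X'.basicOpen t := by
    ext x
    rw [Scheme.Hom.image_preimage_eq_opensRange_inf, Scheme.Opens.opensRange_ι]
    constructor
    · rintro ⟨h1, h2⟩
      by_contra hx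
      refine h1 ((Scheme.IdealSheafData.mem_support_iff_of_mem h2).mpr ?_)
      rw [ht, Scheme.zeroLocus_span, Scheme.zeroLocus_singleton]
      exact hx
    · intro h1
      have h2 : x ∈ W.1 := X'.basicOpen_le t h1
      refine ⟨fun h3 ↦ ?_, h2⟩
      rw [SetLike.mem_coe, Scheme.IdealSheafData.mem_support_iff_of_mem h2, ht,
        Scheme.zeroLocus_span, Scheme.zeroLocus_singleton] at h3
      exact h3 h1
  have haff : IsAffineOpen (j ⁻¹ᵁ W.1) := by
    rw [← j.isAffineOpen_iff_of_isOpenImmersion, himg]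
    exact hWa.basicOpen t
  letI := (j.app W.1).hom.toAlgebra
  have hloc : IsLocalization.Away t Γ((exceptionalCompl π Z).toScheme, j ⁻¹ᵁ W.1) :=
    hWa.isLocalization_of_eq_basicOpen t (homOfLE (himg.trans_le (X'.basicOpen_le t))) himg
  rw [strictTransform, Scheme.IdealSheafData.ideal_map _ _ _ haff, Ideal.mem_comap,
    ideal_comap D (j ≫ π) (U := U) (W := ⟨j ⁻¹ᵁ W.1, haff⟩) (fun x hx ↦ h hx)]
  have happ : (j ≫ π).appLE U.1 (j ⁻¹ᵁ W.1) (fun x hx ↦ h hx) =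
      π.appLE U.1 W.1 h ≫ j.app W.1 := by
    rw [Scheme.Hom.app_eq_appLE, Scheme.Hom.appLE_comp_appLE]
  rw [happ, CommRingCat.hom_comp, ← Ideal.map_map]
  refine (IsLocalization.algebraMap_mem_map_algebraMap_iff (Submonoid.powers t)
    Γ((exceptionalCompl π Z).toScheme, j ⁻¹ᵁ W.1) _ b).trans ?_
  constructor
  · rintro ⟨_, ⟨n, rfl⟩, hn⟩; exact ⟨n, hn⟩
  · rintro ⟨n, hn⟩; exact ⟨_, ⟨n, rfl⟩, hn⟩

lemma mem_stalkIdeal_strictTransform_iff [IsLocallyNoetherian X'] (D : X.IdealSheafData) {q : X'}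
    (hE : IsEffectiveCartier (exceptionalDivisor π Z)) {t : X'.presheaf.stalk q}
    (ht : stalkIdeal (exceptionalDivisor π Z) q = Ideal.span {t}) (b : X'.presheaf.stalk q) :
    b ∈ stalkIdeal (strictTransform π Z D) q ↔
      ∃ n : ℕ, t ^ n * b ∈ (stalkIdeal D (π q)).map (π.stalkMap q).hom := by
  obtain ⟨V, hV, g, -, hg⟩ := hE q
  obtain ⟨U, hU⟩ := exists_affineOpen_mem (π q)
  obtain ⟨W, hW, hWVU⟩ := exists_affineOpen_le q (V.1 ⊓ π ⁻¹ᵁ U.1) ⟨hV, hU⟩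
  have hWV : W.1 ≤ V.1 := hWVU.trans inf_le_left
  have hWU : W.1 ≤ π ⁻¹ᵁ U.1 := hWVU.trans inf_le_right
  have hgW : (exceptionalDivisor π Z).ideal W =
      Ideal.span {X'.presheaf.map (homOfLE hWV).op g} := by
    rw [← Scheme.IdealSheafData.map_ideal _ (U := W) (V := V) hWV, hg, Ideal.map_span, Set.image_singleton]
    rfl
  set g' := X'.presheaf.map (homOfLE hWV).op g
  letI := (X'.presheaf.germ W.1 q hW).hom.toAlgebra
  have l1 := isLocalization_germ W.2 hW
  have h1 : Ideal.span {t} = Ideal.span {algebraMap Γ(X', W.1) (X'.presheaf.stalk q) g'} := by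
    rw [← ht, stalkIdeal_eq _ hW, hgW, Ideal.map_span, Set.image_singleton]
    rfl
  have h2 : (stalkIdeal D (π q)).map (π.stalkMap q).hom =
      ((D.ideal U).map (π.appLE U.1 W.1 hWU).hom).map
        (algebraMap Γ(X', W.1) (X'.presheaf.stalk q)) := by
    rw [← stalkIdeal_comap, stalkIdeal_eq _ hW, ideal_comap D π hWU]
    rfl
  rw [exists_pow_mul_mem_iff h1, h2, stalkIdeal_eq _ hW]
  exact mem_map_saturation_iff (IsAffineOpen.primeIdealOf W.2 ⟨q, hW⟩).asIdeal.primeCompl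
    (mem_ideal_strictTransform_iff D hWU hgW) b

/-- Away from the exceptional divisor the strict transform is the inverse image. -/
lemma stalkIdeal_strictTransform_of_notMem [IsLocallyNoetherian X'] (D : X.IdealSheafData) {q : X'}
    (hE : IsEffectiveCartier (exceptionalDivisor π Z))
    (hq : q ∉ (exceptionalDivisor π Z).support) :
    stalkIdeal (strictTransform π Z D) q = (stalkIdeal D (π q)).map (π.stalkMap q).hom := by
  ext b
  rw [mem_stalkIdeal_strictTransform_iff D hE (t := 1)
    (by rw [Ideal.span_singleton_one]; exact stalkIdeal_eq_top_iff.mpr hq)]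
  simp

end StrictTransform

/-! ### Nonzerodivisors on affine opens and in stalks. -/

section NonZeroDivisors

variable {Y : Scheme.{u}}

lemma germ_mem_nonZeroDivisors {V : Y.Opens} (hV : IsAffineOpen V) {a : Γ(Y, V)}
    (ha : a ∈ nonZeroDivisors Γ(Y, V)) (x : Y) (hx : x ∈ V) :
    Y.presheaf.germ V x hx a ∈ nonZeroDivisors (Y.presheaf.stalk x) := by
  letI := (Y.presheaf.germ V x hx).hom.toAlgebra
  have l1 := isLocalization_germ hV hx
  exact IsLocalization.map_nonZeroDivisors_le (hV.primeIdealOf ⟨x, hx⟩).asIdeal.primeCompl _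
    ⟨a, ha, rfl⟩

lemma mem_nonZeroDivisors_of_germ {V : Y.Opens} {a : Γ(Y, V)}
    (h : ∀ x (hx : x ∈ V), Y.presheaf.germ V x hx a ∈ nonZeroDivisors (Y.presheaf.stalk x)) :
    a ∈ nonZeroDivisors Γ(Y, V) := by
  rw [mem_nonZeroDivisors_iff_right]
  intro b hb
  refine TopCat.Presheaf.section_ext Y.sheaf V b 0 fun x hx ↦ ?_
  refine ((mem_nonZeroDivisors_iff_right.mp (h x hx)) _ ?_).trans (map_zero _).symm
  have := congr(Y.presheaf.germ V x hx $hb)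
  rwa [map_mul, map_zero] at this

lemma map_mem_nonZeroDivisors {V W : Y.Opens} (hV : IsAffineOpen V) (h : W ≤ V) {a : Γ(Y, V)}
    (ha : a ∈ nonZeroDivisors Γ(Y, V)) :
    Y.presheaf.map (homOfLE h).op a ∈ nonZeroDivisors Γ(Y, W) :=
  mem_nonZeroDivisors_of_germ fun x hx ↦ by
    rw [Y.presheaf.germ_res_apply]
    exact germ_mem_nonZeroDivisors hV ha x (h hx)

end NonZeroDivisors

/-- The `A`-algebra `B` is the affine chart of the blowup of the ideal `I` on which `a ∈ I`
generates the exceptional divisor. -/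
structure IsAffineBlowup {A B : Type u} [CommRing A] [CommRing B] [Algebra A B] (I : Ideal A)
    (a : A) : Prop where
  map_eq : I.map (algebraMap A B) = Ideal.span {algebraMap A B a}
  mem_nonZeroDivisors : algebraMap A B a ∈ nonZeroDivisors B
  exists_lift : ∀ {G : Type u} [CommRing G] (g : A →+* G), g a ∈ nonZeroDivisors G →
    I.map g = Ideal.span {g a} → ∃ h : B →+* G, h.comp (algebraMap A B) = g
  lift_unique : ∀ {G : Type u} [CommRing G] (h h' : B →+* G),
    h (algebraMap A B a) ∈ nonZeroDivisors G →
      h.comp (algebraMap A B) = h'.comp (algebraMap A B) → h = h'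

lemma isAffineOpen_coe {X : Scheme.{u}} (U : X.affineOpens) : IsAffineOpen U.1 := U.2

/-! ### Opens on which one generator of the centre defines the exceptional divisor. -/

section Charts

variable {X X' : Scheme.{u}}

lemma SpecMap_fromSpec_appLE {U : X.Opens} (hU : IsAffineOpen U) {G : CommRingCat.{u}}
    (φ : Γ(X, U) ⟶ G) (h : ⊤ ≤ (Spec.map φ ≫ hU.fromSpec) ⁻¹ᵁ U) :
    (Spec.map φ ≫ hU.fromSpec).appLE U ⊤ h = φ ≫ (Scheme.ΓSpecIso G).inv := by
  have h1 : (⊤ : (Spec Γ(X, U)).Opens) ≤ hU.fromSpec ⁻¹ᵁ U := fun x _ ↦ by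
    have : hU.fromSpec x ∈ Set.range hU.fromSpec := ⟨_, rfl⟩
    rw [hU.range_fromSpec] at this
    exact this
  have e1 : hU.fromSpec.appLE U ⊤ h1 = (Scheme.ΓSpecIso Γ(X, U)).inv := by
    rw [Scheme.Hom.appLE, hU.fromSpec_app_self, Category.assoc, ← Functor.map_comp]
    convert! Category.comp_id _
  have e2 : (Spec.map φ).appLE ⊤ ⊤ le_rfl = (Spec.map φ).appTop :=
    Scheme.Hom.appLE_eq_app _
  rw [← Scheme.Hom.appLE_comp_appLE (Spec.map φ) hU.fromSpec U ⊤ ⊤ h1 le_rfl, e1, e2,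
    Scheme.ΓSpecIso_inv_naturality]

lemma le_preimage_SpecMap_fromSpec {U : X.Opens} (hU : IsAffineOpen U) {G : CommRingCat.{u}}
    (φ : Γ(X, U) ⟶ G) : ⊤ ≤ (Spec.map φ ≫ hU.fromSpec) ⁻¹ᵁ U := by
  intro x _
  have : hU.fromSpec (Spec.map φ x) ∈ Set.range hU.fromSpec := ⟨_, rfl⟩
  rw [hU.range_fromSpec] at this
  exact this

lemma isEffectiveCartier_comap (Z : X.IdealSheafData) {U : X.affineOpens} {G : CommRingCat.{u}}
    (φ : Γ(X, U.1) ⟶ G) {t : G} (ht : t ∈ nonZeroDivisors G)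
    (h : (Z.ideal U).map φ.hom = Ideal.span {t}) :
    IsEffectiveCartier (Z.comap (Spec.map φ ≫ (isAffineOpen_coe U).fromSpec)) := by
  intro x
  refine ⟨⟨⊤, isAffineOpen_top _⟩, trivial, (Scheme.ΓSpecIso G).inv t, ?_, ?_⟩
  · let e := (Scheme.ΓSpecIso G).symm.commRingCatIsoToRingEquiv
    exact (MulEquivClass.map_nonZeroDivisors e).le ⟨t, ht, rfl⟩
  · have h1 := SpecMap_fromSpec_appLE U.2 φ (le_preimage_SpecMap_fromSpec U.2 φ)
    refine (ideal_comap Z _ (U := U) (W := ⟨⊤, isAffineOpen_top _⟩)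
      (le_preimage_SpecMap_fromSpec U.2 φ)).trans ((congr(Ideal.map ($h1).hom (Z.ideal U))).trans ?_)
    rw [CommRingCat.hom_comp, ← Ideal.map_map, h, Ideal.map_span, Set.image_singleton]

/-- On the affine open `W` of `X'` the inverse image of `Z` is the Cartier divisor defined by the
element `a` of the ideal of `Z` on `U`. -/
structure IsChartOpen (π : X' ⟶ X) (Z : X.IdealSheafData) (U : X.affineOpens) (a : Γ(X, U.1))
    (W : X'.affineOpens) : Prop where
  le : W.1 ≤ π ⁻¹ᵁ U.1
  map_eq : (Z.ideal U).map (π.appLE U.1 W.1 le).hom = Ideal.span {π.appLE U.1 W.1 le a}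
  mem_nonZeroDivisors : π.appLE U.1 W.1 le a ∈ nonZeroDivisors Γ(X', W.1)

variable {π : X' ⟶ X} {Z : X.IdealSheafData} {U : X.affineOpens} {a : Γ(X, U.1)}

lemma map_appLE_apply {U : X.Opens} {W W' : X'.Opens} (h : W' ≤ W) (hW : W ≤ π ⁻¹ᵁ U)
    (a : Γ(X, U)) : X'.presheaf.map (homOfLE h).op (π.appLE U W hW a) =
      π.appLE U W' (h.trans hW) a := by
  have := Scheme.Hom.appLE_map π hW (homOfLE h).op
  exact congr($(this).hom a)

lemma IsChartOpen.mono {W W' : X'.affineOpens} (hW : IsChartOpen π Z U a W) (h : W'.1 ≤ W.1) :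
    IsChartOpen π Z U a W' where
  le := h.trans hW.le
  map_eq := by
    rw [← map_appLE_apply h hW.le, ← ideal_comap Z π (h.trans hW.le),
      ← Scheme.IdealSheafData.map_ideal (Z.comap π) (U := W') (V := W) h, ideal_comap Z π hW.le,
      hW.map_eq, Ideal.map_span, Set.image_singleton]
    rfl
  mem_nonZeroDivisors := by
    rw [← map_appLE_apply h hW.le]
    exact map_mem_nonZeroDivisors W.2 h hW.mem_nonZeroDivisors

/-- The quotient `b` of `a'` by `a` becomes a unit on its basic open set, so there `a'` generates
the same ideal as `a`. -/
lemma IsChartOpen.exists_basicOpen {W : X'.affineOpens} (hW : IsChartOpen π Z U a W)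
    {a' : Γ(X, U.1)} {b : Γ(X', W.1)}
    (hb : π.appLE U.1 W.1 hW.le a' = π.appLE U.1 W.1 hW.le a * b) :
    IsChartOpen π Z U a' (X'.affineBasicOpen b) := by
  have h1 := hW.mono (W' := X'.affineBasicOpen b) (X'.basicOpen_le b)
  have hu : IsUnit (X'.presheaf.map (homOfLE (X'.basicOpen_le b)).op b) :=
    RingedSpace.isUnit_res_basicOpen _ b
  have h2 : π.appLE U.1 (X'.basicOpen b) h1.le a' = π.appLE U.1 (X'.basicOpen b) h1.le a *
        X'.presheaf.map (homOfLE (X'.basicOpen_le b)).op b := by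
    have := congr(X'.presheaf.map (homOfLE (X'.basicOpen_le b)).op $hb)
    rw [map_mul, map_appLE_apply, map_appLE_apply] at this
    exact this
  refine ⟨h1.le, ?_, ?_⟩
  · refine h1.map_eq.trans (Eq.trans ?_ (congrArg (fun z ↦ Ideal.span {z}) h2).symm)
    exact (Ideal.span_singleton_mul_right_unit hu _).symm
  · refine Set.mem_of_eq_of_mem h2 ?_
    exact mul_mem_nonZeroDivisors.mpr ⟨h1.mem_nonZeroDivisors, hu.mem_nonZeroDivisors⟩

/-- If all quotients `x i / t` were in `𝔪`, then `t = c * t` with `c ∈ 𝔪`, and cancelling `t` would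
give `c = 1`. -/
lemma exists_span_singleton_eq {R : Type*} [CommRing R] [IsLocalRing R] {ι : Type*} {x : ι → R}
    {t : R} (ht : t ∈ nonZeroDivisors R) (h : Ideal.span (Set.range x) = Ideal.span {t}) :
    ∃ i u, IsUnit u ∧ x i = u * t := by
  by_contra! hc
  have h1 (i) : ∃ b, b * t = x i := Ideal.mem_span_singleton'.mp (h ▸ Ideal.subset_span ⟨i, rfl⟩)
  choose b hb using h1
  have h2 : Ideal.span (Set.range x) ≤ IsLocalRing.maximalIdeal R * Ideal.span {t} := by
    rw [Ideal.span_le]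
    rintro _ ⟨i, rfl⟩
    rw [← hb]
    refine Ideal.mul_mem_mul ?_ (Ideal.mem_span_singleton_self t)
    exact fun hu ↦ hc i (b i) hu (hb i).symm
  have h3 := h2 (h ▸ Ideal.mem_span_singleton_self t)
  obtain ⟨c, hc, hct⟩ := Ideal.mem_mul_span_singleton.mp h3
  have h4 : (1 - c) * t = 0 := by rw [sub_mul, one_mul, hct, sub_self]
  have h5 := (mem_nonZeroDivisors_iff_right.mp ht) _ h4
  rw [sub_eq_zero] at h5
  exact (Ideal.ne_top_iff_one _).mp (IsLocalRing.maximalIdeal.isMaximal R).ne_top (h5 ▸ hc)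

lemma exists_isChartOpen (hE : IsEffectiveCartier (exceptionalDivisor π Z)) {ι : Type*}
    {x : ι → Γ(X, U.1)} (hx : Z.ideal U = Ideal.span (Set.range x)) {q : X'} (hq : π q ∈ U.1) :
    ∃ i, ∃ W : X'.affineOpens, q ∈ W.1 ∧ IsChartOpen π Z U (x i) W := by
  obtain ⟨V, hV, g, hg, hgE⟩ := hE q
  obtain ⟨W, hqW, hW⟩ := exists_affineOpen_le q (V.1 ⊓ π ⁻¹ᵁ U.1) ⟨hV, hq⟩
  have hWV : W.1 ≤ V.1 := hW.trans inf_le_left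
  have hWU : W.1 ≤ π ⁻¹ᵁ U.1 := hW.trans inf_le_right
  set g' := X'.presheaf.map (homOfLE hWV).op g with hg'
  have hgW : (exceptionalDivisor π Z).ideal W = Ideal.span {g'} := by
    rw [← Scheme.IdealSheafData.map_ideal _ (U := W) (V := V) hWV, hgE, Ideal.map_span,
      Set.image_singleton]
    rfl
  have hg'0 : g' ∈ nonZeroDivisors Γ(X', W.1) := map_mem_nonZeroDivisors V.2 hWV hg
  have hEW : (exceptionalDivisor π Z).ideal W =
      Ideal.span (Set.range fun i ↦ π.appLE U.1 W.1 hWU (x i)) := by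
    rw [exceptionalDivisor, ideal_comap Z π hWU, hx, Ideal.map_span, ← Set.range_comp]
    rfl
  have hstalk : Ideal.span (Set.range fun i ↦ X'.presheaf.germ W.1 q hqW
      (π.appLE U.1 W.1 hWU (x i))) = Ideal.span {X'.presheaf.germ W.1 q hqW g'} := by
    have h1 := congr(Ideal.map (X'.presheaf.germ W.1 q hqW).hom $(hEW.symm.trans hgW))
    rw [Ideal.map_span, Ideal.map_span, Set.image_singleton, ← Set.range_comp] at h1
    exact h1
  obtain ⟨i, u, hu, hui⟩ := exists_span_singleton_eq (germ_mem_nonZeroDivisors W.2 hg'0 q hqW) hstalk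
  obtain ⟨b, hb⟩ : ∃ b, b * g' = π.appLE U.1 W.1 hWU (x i) := Ideal.mem_span_singleton'.mp
    (hgW ▸ hEW ▸ Ideal.subset_span ⟨i, rfl⟩)
  have hgb : X'.presheaf.germ W.1 q hqW b = u := by
    have h1 := congr(X'.presheaf.germ W.1 q hqW $hb)
    rw [map_mul, hui] at h1
    have h2 : (X'.presheaf.germ W.1 q hqW b - u) * X'.presheaf.germ W.1 q hqW g' = 0 := by
      rw [sub_mul, h1, sub_self]
    exact sub_eq_zero.mp
      (mem_nonZeroDivisors_iff_right.mp (germ_mem_nonZeroDivisors W.2 hg'0 q hqW) _ h2)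
  have hqb : q ∈ X'.basicOpen b := by
    rw [Scheme.mem_basicOpen X' b q hqW, hgb]
    exact hu
  refine ⟨i, X'.affineBasicOpen b, hqb, (X'.basicOpen_le b).trans hWU, ?_, ?_⟩
  · have hub : IsUnit (X'.presheaf.map (homOfLE (X'.basicOpen_le b)).op b) :=
      RingedSpace.isUnit_res_basicOpen _ b
    rw [← ideal_comap Z π (W := X'.affineBasicOpen b) ((X'.basicOpen_le b).trans hWU),
      ← Scheme.IdealSheafData.map_ideal _ (U := X'.affineBasicOpen b) (V := W) (X'.basicOpen_le b),
      hgW, Ideal.map_span, Set.image_singleton]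
    have h3 := map_appLE_apply (X'.basicOpen_le b) hWU (x i)
    rw [← hb, map_mul] at h3
    refine Eq.trans ?_ (congrArg (fun z ↦ Ideal.span {z}) h3)
    exact (Ideal.span_singleton_mul_left_unit hub _).symm
  · have h3 := map_appLE_apply (X'.basicOpen_le b) hWU (x i)
    have hub : IsUnit (X'.presheaf.map (homOfLE (X'.basicOpen_le b)).op b) :=
      RingedSpace.isUnit_res_basicOpen _ b
    rw [← hb, map_mul] at h3
    have h4 := mul_mem_nonZeroDivisors.mpr ⟨hub.mem_nonZeroDivisors,
      map_mem_nonZeroDivisors W.2 (X'.basicOpen_le b) hg'0⟩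
    rw [h3] at h4
    exact h4

end Charts

/-! ### Affine charts of a blowup obtained from its universal property. -/

section Charts

variable {X X' : Scheme.{u}} {π : X' ⟶ X} {Z : X.IdealSheafData} {U : X.affineOpens}

lemma appLE_congr_hom {g g' : X' ⟶ X} (h : g = g') {U : X.Opens} {W : X'.Opens} (e : W ≤ g ⁻¹ᵁ U)
    (e' : W ≤ g' ⁻¹ᵁ U) : g.appLE U W e = g'.appLE U W e' := by
  subst h
  rfl

lemma IsAffineBlowup.hom_ext {A B : Type u} [CommRing A] [CommRing B] [Algebra A B] {I : Ideal A}
    {a : A} (hB : IsAffineBlowup (B := B) I a) {Y : Scheme.{u}} {h₁ h₂ : Y ⟶ Spec (.of B)}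
    (h : h₁ ≫ Spec.map (CommRingCat.ofHom (algebraMap A B)) =
      h₂ ≫ Spec.map (CommRingCat.ofHom (algebraMap A B)))
    (ha : ((Scheme.ΓSpecIso (.of B)).inv ≫ h₁.appTop) (algebraMap A B a) ∈
      nonZeroDivisors Γ(Y, ⊤)) : h₁ = h₂ := by
  have h0 (g : Y ⟶ Spec (.of B)) :
      CommRingCat.ofHom (algebraMap A B) ≫ (Scheme.ΓSpecIso (.of B)).inv ≫ g.appTop =
        (Scheme.ΓSpecIso (.of A)).inv ≫
          (g ≫ Spec.map (CommRingCat.ofHom (algebraMap A B))).appTop := by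
    rw [Scheme.Hom.comp_appTop, Scheme.ΓSpecIso_inv_naturality_assoc]
  have h1 := hB.lift_unique ((Scheme.ΓSpecIso (.of B)).inv ≫ h₁.appTop).hom
    ((Scheme.ΓSpecIso (.of B)).inv ≫ h₂.appTop).hom ha
    (congr(($((h0 h₁).trans ((congr(_ ≫ Scheme.Hom.appTop $h)).trans (h0 h₂).symm))).hom))
  refine ext_of_isAffine ?_
  have h2 : (Scheme.ΓSpecIso (.of B)).inv ≫ h₁.appTop =
      (Scheme.ΓSpecIso (.of B)).inv ≫ h₂.appTop := CommRingCat.hom_ext h1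
  exact (cancel_epi _).mp h2

lemma SpecΓ_map_nonZeroDivisors {B : Type u} [CommRing B] {b : B} (hb : b ∈ nonZeroDivisors B)
    (T : (Spec (.of B)).Opens) :
    ((Scheme.ΓSpecIso (.of B)).inv ≫ T.ι.appTop) b ∈ nonZeroDivisors Γ(T, ⊤) := by
  rw [Scheme.Opens.ι_appTop]
  refine map_mem_nonZeroDivisors (isAffineOpen_top (Spec (.of B))) _ ?_
  let e := (Scheme.ΓSpecIso (.of B)).symm.commRingCatIsoToRingEquiv
  exact (MulEquivClass.map_nonZeroDivisors e).le ⟨b, hb, rfl⟩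

variable {B : Type u} [CommRing B] [Algebra Γ(X, U.1) B] {a : Γ(X, U.1)}

/-- The affine universal property gives `ψ`; uniqueness in the universal property of the blowup
identifies the composite with the inclusion of `W`. -/
lemma IsChartOpen.exists_lift (hπ : IsBlowup π Z) (hB : IsAffineBlowup (B := B) (Z.ideal U) a)
    {φ : Spec (.of B) ⟶ X'}
    (hφ : φ ≫ π = Spec.map (CommRingCat.ofHom (algebraMap Γ(X, U.1) B)) ≫
      (isAffineOpen_coe U).fromSpec) {W : X'.affineOpens} (hW : IsChartOpen π Z U a W) :
    ∃ ψ : CommRingCat.of B ⟶ Γ(X', W.1), CommRingCat.ofHom (algebraMap _ B) ≫ ψ =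
      π.appLE U.1 W.1 hW.le ∧ Spec.map ψ ≫ φ = (isAffineOpen_coe W).fromSpec := by
  obtain ⟨ψ, hψ⟩ := hB.exists_lift (π.appLE U.1 W.1 hW.le).hom hW.mem_nonZeroDivisors hW.map_eq
  have h1 : CommRingCat.ofHom (algebraMap _ B) ≫ CommRingCat.ofHom ψ = π.appLE U.1 W.1 hW.le :=
    CommRingCat.hom_ext hψ
  refine ⟨CommRingCat.ofHom ψ, h1, ?_⟩
  have h2 := isEffectiveCartier_comap Z (U := U) (π.appLE U.1 W.1 hW.le) hW.mem_nonZeroDivisors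
    hW.map_eq
  refine (hπ.existsUnique_lift _ _ h2).unique ?_ ?_
  · rw [Category.assoc, hφ, ← Spec.map_comp_assoc, h1]
  · exact (IsAffineOpen.SpecMap_appLE_fromSpec π U.2 W.2 hW.le).symm

/-- Over `W` the map `φ` is invertible: its inverse is the lift `W → Spec B`, and both composites
are identities by the two uniqueness statements. -/
lemma IsChartOpen.isOpenImmersion (hπ : IsBlowup π Z)
    (hB : IsAffineBlowup (B := B) (Z.ideal U) a) {φ : Spec (.of B) ⟶ X'}
    (hφ : φ ≫ π = Spec.map (CommRingCat.ofHom (algebraMap Γ(X, U.1) B)) ≫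
      (isAffineOpen_coe U).fromSpec) {W : X'.affineOpens} (hW : IsChartOpen π Z U a W) :
    IsOpenImmersion ((φ ⁻¹ᵁ W.1).ι ≫ φ) := by
  obtain ⟨ψ, hψ, hψφ⟩ := hW.exists_lift hπ hB hφ
  have hW' : Set.range ((isAffineOpen_coe W).fromSpec) = W.1 := (isAffineOpen_coe W).range_fromSpec
  let g := IsOpenImmersion.lift ((isAffineOpen_coe W).fromSpec) ((φ ⁻¹ᵁ W.1).ι ≫ φ) (by
    rw [hW']
    rintro _ ⟨x, rfl⟩
    exact x.2)
  have hg : g ≫ (isAffineOpen_coe W).fromSpec = (φ ⁻¹ᵁ W.1).ι ≫ φ := IsOpenImmersion.lift_fac _ _ _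
  let s := IsOpenImmersion.lift (φ ⁻¹ᵁ W.1).ι (Spec.map ψ) (by
    rw [Scheme.Opens.range_ι]
    rintro _ ⟨x, rfl⟩
    change (Spec.map ψ ≫ φ) x ∈ (W.1 : Set X')
    rw [← hW', hψφ]
    exact ⟨x, rfl⟩)
  have hs : s ≫ (φ ⁻¹ᵁ W.1).ι = Spec.map ψ := IsOpenImmersion.lift_fac _ _ _
  have h1 : (φ ⁻¹ᵁ W.1).ι = g ≫ Spec.map ψ := by
    refine hB.hom_ext ?_ (SpecΓ_map_nonZeroDivisors hB.mem_nonZeroDivisors _)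
    rw [← cancel_mono ((isAffineOpen_coe U).fromSpec), Category.assoc, Category.assoc, Category.assoc,
      ← hφ, reassoc_of% hψφ, reassoc_of% hg]
  have h2 : g ≫ s = 𝟙 _ := by
    rw [← cancel_mono (φ ⁻¹ᵁ W.1).ι, Category.assoc, hs, ← h1, Category.id_comp]
  have h3 : s ≫ g = 𝟙 _ := by
    rw [← cancel_mono ((isAffineOpen_coe W).fromSpec), Category.assoc, hg, reassoc_of% hs, hψφ,
      Category.id_comp]
  have : IsIso g := ⟨s, h2, h3⟩
  rw [← hg]
  infer_instance

/-- Some generator `x j` works near `φ y`. Since `x i` generates the same ideal on `Spec B`, the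
quotient `b = x i / x j` pulls back to a unit at `y`; shrink to its basic open set. -/
lemma exists_isChartOpen_of_isAffineBlowup
    (hE : IsEffectiveCartier (exceptionalDivisor π Z)) {ι : Type*}
    {x : ι → Γ(X, U.1)} (hx : Z.ideal U = Ideal.span (Set.range x)) {i : ι}
    (hB : IsAffineBlowup (B := B) (Z.ideal U) (x i)) {φ : Spec (.of B) ⟶ X'}
    (hφ : φ ≫ π = Spec.map (CommRingCat.ofHom (algebraMap Γ(X, U.1) B)) ≫
      (isAffineOpen_coe U).fromSpec) (y : Spec (.of B)) :
    ∃ W : X'.affineOpens, φ y ∈ W.1 ∧ IsChartOpen π Z U (x i) W := by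
  have hU : π (φ y) ∈ U.1 := by
    have h1 : (isAffineOpen_coe U).fromSpec (Spec.map (CommRingCat.ofHom (algebraMap Γ(X, U.1) B)) y) ∈
        Set.range ((isAffineOpen_coe U).fromSpec) := ⟨_, rfl⟩
    rw [(isAffineOpen_coe U).range_fromSpec] at h1
    have h2 : (φ ≫ π) y ∈ U.1 := by rw [hφ]; exact h1
    exact h2
  obtain ⟨j, W, hyW, hW⟩ := exists_isChartOpen hE hx hU
  obtain ⟨b, hb⟩ : ∃ b, b * π.appLE U.1 W.1 hW.le (x j) = π.appLE U.1 W.1 hW.le (x i) := by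
    refine Ideal.mem_span_singleton'.mp (hW.map_eq ▸ ?_)
    exact Ideal.mem_map_of_mem _ (hx ▸ Ideal.subset_span ⟨i, rfl⟩)
  refine ⟨X'.affineBasicOpen b, ?_, hW.exists_basicOpen (hb.symm.trans (mul_comm _ _))⟩
  change φ y ∈ X'.basicOpen b
  rw [Scheme.mem_basicOpen X' b _ hyW, ← isUnit_map_iff (φ.stalkMap y).hom]
  obtain ⟨c, hc⟩ : ∃ c, c * algebraMap _ B (x i) = algebraMap _ B (x j) :=
    Ideal.mem_span_singleton'.mp (hB.map_eq ▸ Ideal.mem_map_of_mem _ (hx ▸ Ideal.subset_span ⟨j, rfl⟩))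
  let κ : CommRingCat.of B ⟶ (Spec (.of B)).presheaf.stalk y :=
    (Scheme.ΓSpecIso (.of B)).inv ≫ (Spec (.of B)).presheaf.germ ⊤ y trivial
  have hκ (z : Γ(X, U.1)) : (φ.stalkMap y) (X'.presheaf.germ W.1 _ hyW
      (π.appLE U.1 W.1 hW.le z)) = κ (algebraMap _ B z) := by
    have h1 := Scheme.Hom.germ_stalkMap_apply φ W.1 y hyW (π.appLE U.1 W.1 hW.le z)
    refine h1.trans ?_
    have h2 : (π.appLE U.1 W.1 hW.le ≫ φ.app W.1) = (CommRingCat.ofHom (algebraMap Γ(X, U.1) B) ≫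
        (Scheme.ΓSpecIso (.of B)).inv) ≫ (Spec (.of B)).presheaf.map (homOfLE le_top).op := by
      rw [← SpecMap_fromSpec_appLE (isAffineOpen_coe U) (CommRingCat.ofHom (algebraMap Γ(X, U.1) B))
        (le_preimage_SpecMap_fromSpec _ _), Scheme.Hom.appLE_map, ← Scheme.Hom.appLE_eq_app,
        Scheme.Hom.appLE_comp_appLE]
      exact appLE_congr_hom hφ _ _
    have h3 := congr((Spec (.of B)).presheaf.germ _ y hyW (($h2).hom z))
    refine h3.trans ?_
    exact (Spec (.of B)).presheaf.germ_res_apply _ _ _ _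
  have h1 : κ (algebraMap _ B (x i)) ∈ nonZeroDivisors ((Spec (.of B)).presheaf.stalk y) := by
    refine germ_mem_nonZeroDivisors (isAffineOpen_top _) ?_ _ _
    let e := (Scheme.ΓSpecIso (.of B)).symm.commRingCatIsoToRingEquiv
    exact (MulEquivClass.map_nonZeroDivisors e).le ⟨_, hB.mem_nonZeroDivisors, rfl⟩
  have h2 := congr((φ.stalkMap y) (X'.presheaf.germ W.1 _ hyW $hb))
  rw [map_mul, map_mul, hκ, hκ, ← hc, map_mul, ← mul_assoc] at h2
  have h3 : ((φ.stalkMap y) (X'.presheaf.germ W.1 _ hyW b) * κ c - 1) *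
      κ (algebraMap _ B (x i)) = 0 := by
    rw [sub_mul, h2, one_mul, sub_self]
  exact IsUnit.of_mul_eq_one _ (sub_eq_zero.mp (mem_nonZeroDivisors_iff_right.mp h1 _ h3))

lemma IsBlowup.exists_chart (hπ : IsBlowup π Z) {ι : Type*}
    {x : ι → Γ(X, U.1)} (hx : Z.ideal U = Ideal.span (Set.range x)) {i : ι}
    (hB : IsAffineBlowup (B := B) (Z.ideal U) (x i)) :
    ∃ φ : Spec (.of B) ⟶ X', IsOpenImmersion φ ∧
      φ ≫ π = Spec.map (CommRingCat.ofHom (algebraMap Γ(X, U.1) B)) ≫ (isAffineOpen_coe U).fromSpec ∧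
      ∀ W : X'.affineOpens, IsChartOpen π Z U (x i) W → (W.1 : Set X') ⊆ Set.range φ := by
  obtain ⟨φ, hφ, -⟩ := hπ.existsUnique_lift _ _ (isEffectiveCartier_comap Z (U := U)
    (CommRingCat.ofHom (algebraMap Γ(X, U.1) B)) hB.mem_nonZeroDivisors hB.map_eq)
  have hφo : IsOpenImmersion φ := by
    refine IsZariskiLocalAtTarget.of_forall_source_exists_preimage (P := @IsOpenImmersion) φ
      fun y ↦ ?_
    obtain ⟨W, hyW, hW⟩ := exists_isChartOpen_of_isAffineBlowup hπ.isEffectiveCartier hx hB hφ y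
    exact ⟨W.1, hyW, hW.isOpenImmersion hπ hB hφ⟩
  refine ⟨φ, hφo, hφ, fun W hW q hq ↦ ?_⟩
  obtain ⟨ψ, -, hψ⟩ := hW.exists_lift hπ hB hφ
  have h1 : q ∈ Set.range (isAffineOpen_coe W).fromSpec := by
    rwa [(isAffineOpen_coe W).range_fromSpec]
  obtain ⟨y, rfl⟩ := h1
  rw [← hψ]
  exact ⟨Spec.map ψ y, rfl⟩

end Charts

/-! ### The affine blowup algebra. -/

section AffineBlowupAlgebra

variable {A : Type u} [CommRing A] {ι : Type*}

/-- The subalgebra of the localization `A_a` generated by the quotients `x i / a`. -/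
def affineBlowupAlgebra (x : ι → A) (a : A) : Subalgebra A (Localization.Away a) :=
  Algebra.adjoin A (Set.range fun i ↦
    IsLocalization.mk' (Localization.Away a) (x i) (⟨a, Submonoid.mem_powers a⟩ : Submonoid.powers a))

lemma finiteType_affineBlowupAlgebra [Finite ι] (x : ι → A) (a : A) :
    Algebra.FiniteType A (affineBlowupAlgebra x a) :=
  (Subalgebra.fg_iff_finiteType _).mp (Subalgebra.fg_def.mpr ⟨_, Set.finite_range _, rfl⟩)

lemma exists_affineBlowupAlgebra_mul_eq (x : ι → A) (a : A) (i : ι) :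
    ∃ b : affineBlowupAlgebra x a, b.1 = IsLocalization.mk' (Localization.Away a) (x i)
      (⟨a, Submonoid.mem_powers a⟩ : Submonoid.powers a) ∧
      b * algebraMap A _ a = algebraMap A _ (x i) :=
  ⟨⟨_, Algebra.subset_adjoin ⟨i, rfl⟩⟩, rfl, Subtype.ext
    (IsLocalization.mk'_spec (Localization.Away a) (x i) (⟨a, Submonoid.mem_powers a⟩ : Submonoid.powers a))⟩

lemma isAffineBlowup_affineBlowupAlgebra {I : Ideal A} {x : ι → A} (hx : I = Ideal.span (Set.range x))
    {a : A} (ha : a ∈ I) : IsAffineBlowup (B := affineBlowupAlgebra x a) I a where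
  map_eq := by
    refine le_antisymm ?_ ((Ideal.span_singleton_le_iff_mem _).mpr (Ideal.mem_map_of_mem _ ha))
    rw [hx, Ideal.map_span, Ideal.span_le]
    rintro _ ⟨_, ⟨i, rfl⟩, rfl⟩
    obtain ⟨b, -, hb⟩ := exists_affineBlowupAlgebra_mul_eq x a i
    exact Ideal.mem_span_singleton'.mpr ⟨b, hb⟩
  mem_nonZeroDivisors := by
    rw [mem_nonZeroDivisors_iff_right]
    intro b hb
    have h1 : IsUnit (algebraMap A (Localization.Away a) a) :=
      IsLocalization.Away.algebraMap_isUnit a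
    have h2 : b.1 * algebraMap A (Localization.Away a) a = 0 := congr(($hb).1)
    exact Subtype.ext (h1.mul_left_eq_zero.mp h2)
  exists_lift := by
    intro G _ g hg hgI
    let Ga := Localization.Away (g a)
    have hinj : Function.Injective (algebraMap G Ga) :=
      IsLocalization.injective Ga (Submonoid.powers_le.mpr hg)
    let L : Localization.Away a →+* Ga := IsLocalization.Away.map _ _ g a
    have hL (z : A) : L (algebraMap A _ z) = algebraMap G Ga (g z) := IsLocalization.map_eq _ z
    -- The extension of `g` to localizations carries `x i / a` into `G`, because `g a` divides `g (x
    -- i)`; as `g a` is a nonzerodivisor, `G` embeds in its localization.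
    have hrange (b : affineBlowupAlgebra x a) : L b.1 ∈ (algebraMap G Ga).range := by
      refine Algebra.adjoin_induction ?_ ?_ ?_ ?_ b.2
      · rintro _ ⟨i, rfl⟩
        obtain ⟨c, hc⟩ : ∃ c, c * g a = g (x i) := Ideal.mem_span_singleton'.mp
          (hgI ▸ Ideal.mem_map_of_mem _ (hx ▸ Ideal.subset_span ⟨i, rfl⟩))
        refine ⟨c, ?_⟩
        have h1 : IsUnit (algebraMap G Ga (g a)) := IsLocalization.Away.algebraMap_isUnit (g a)
        refine h1.mul_left_injective ?_
        change algebraMap G Ga c * algebraMap G Ga (g a) = L _ * algebraMap G Ga (g a)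
        rw [← map_mul, hc, ← hL, ← hL, ← map_mul]
        exact congrArg L (IsLocalization.mk'_spec (Localization.Away a) (x i)
          (⟨a, Submonoid.mem_powers a⟩ : Submonoid.powers a)).symm
      · exact fun r ↦ ⟨g r, (hL r).symm⟩
      · exact fun y z _ _ hy hz ↦ by rw [map_add]; exact add_mem hy hz
      · exact fun y z _ _ hy hz ↦ by rw [map_mul]; exact mul_mem hy hz
    let e : G ≃+* (algebraMap G Ga).range := RingEquiv.ofBijective (algebraMap G Ga).rangeRestrict
      ⟨fun y z h ↦ hinj congr(($h).1), (algebraMap G Ga).rangeRestrict_surjective⟩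
    refine ⟨(e.symm : _ →+* G).comp ((L.comp (affineBlowupAlgebra x a).val.toRingHom).codRestrict
      _ hrange), ?_⟩
    ext z
    refine e.symm_apply_eq.mpr (Subtype.ext (hL z))
  lift_unique := by
    intro G _ h h' ha h0
    have h0' (z : A) : h (algebraMap A _ z) = h' (algebraMap A _ z) := congr($h0 z)
    ext b
    obtain ⟨b, hb⟩ := b
    refine Algebra.adjoin_induction (p := fun b hb ↦ h ⟨b, hb⟩ = h' ⟨b, hb⟩) ?_ ?_ ?_ ?_ hb
    · rintro _ ⟨i, rfl⟩
      obtain ⟨c, hc, hc'⟩ := exists_affineBlowupAlgebra_mul_eq x a i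
      have h1 : (⟨_, Algebra.subset_adjoin ⟨i, rfl⟩⟩ : affineBlowupAlgebra x a) = c :=
        Subtype.ext hc.symm
      rw [h1]
      have h2 : (h c - h' c) * h (algebraMap A _ a) = 0 := by
        rw [sub_mul, ← map_mul, hc', h0' a, ← map_mul, hc', h0', sub_self]
      exact sub_eq_zero.mp (mem_nonZeroDivisors_iff_right.mp ha _ h2)
    · exact fun r ↦ h0' r
    · intro y z hy hz h1 h2
      have h3 : (⟨y + z, add_mem hy hz⟩ : affineBlowupAlgebra x a) = ⟨y, hy⟩ + ⟨z, hz⟩ := rfl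
      rw [h3, map_add, map_add, h1, h2]
    · intro y z hy hz h1 h2
      have h3 : (⟨y * z, mul_mem hy hz⟩ : affineBlowupAlgebra x a) = ⟨y, hy⟩ * ⟨z, hz⟩ := rfl
      rw [h3, map_mul, map_mul, h1, h2]

end AffineBlowupAlgebra

/-! ### Blowups are of finite type, quasi-compact and separated. -/

section Global

variable {X X' : Scheme.{u}} {π : X' ⟶ X} {Z : X.IdealSheafData}

lemma IsBlowup.exists_charts [IsLocallyNoetherian X] (hπ : IsBlowup π Z) (U : X.affineOpens) :
    ∃ (n : ℕ) (x : Fin n → Γ(X, U.1))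
      (φ : ∀ i, Spec (.of (affineBlowupAlgebra x (x i))) ⟶ X'),
      Z.ideal U = Ideal.span (Set.range x) ∧ (∀ i, IsOpenImmersion (φ i)) ∧
      (∀ i, φ i ≫ π = Spec.map (CommRingCat.ofHom (algebraMap Γ(X, U.1) _)) ≫
        (isAffineOpen_coe U).fromSpec) ∧
      ∀ i, ∀ W : X'.affineOpens, IsChartOpen π Z U (x i) W → (W.1 : Set X') ⊆ Set.range (φ i) := by
  have := IsLocallyNoetherian.component_noetherian U
  obtain ⟨n, x, hx⟩ := (Submodule.fg_iff_exists_fin_generating_family).mp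
    (IsNoetherian.noetherian (Z.ideal U))
  have hx' : Z.ideal U = Ideal.span (Set.range x) := hx.symm
  have h (i : Fin n) := hπ.exists_chart hx' (i := i)
    (isAffineBlowup_affineBlowupAlgebra hx' (hx' ▸ Ideal.subset_span ⟨i, rfl⟩))
  choose φ hφ using h
  exact ⟨n, x, φ, hx', fun i ↦ (hφ i).1, fun i ↦ (hφ i).2.1, fun i ↦ (hφ i).2.2⟩

lemma IsBlowup.exists_mem_range {U : X.affineOpens} {ι : Type*} {x : ι → Γ(X, U.1)}
    (hπ : IsBlowup π Z) (hx : Z.ideal U = Ideal.span (Set.range x)) {Y : ι → Scheme.{u}}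
    {φ : ∀ i, Y i ⟶ X'}
    (hφ : ∀ i, ∀ W : X'.affineOpens, IsChartOpen π Z U (x i) W → (W.1 : Set X') ⊆ Set.range (φ i))
    {q : X'} (hq : π q ∈ U.1) : ∃ i, q ∈ Set.range (φ i) := by
  obtain ⟨i, W, hqW, hW⟩ := exists_isChartOpen hπ.isEffectiveCartier hx hq
  exact ⟨i, hφ i W hW hqW⟩

lemma IsBlowup.locallyOfFiniteType [IsLocallyNoetherian X] (hπ : IsBlowup π Z) :
    LocallyOfFiniteType π := by
  have h (q : X') : ∃ (Y : Scheme.{u}) (i : Y ⟶ X') (_ : IsOpenImmersion i),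
      q ∈ i.opensRange ∧ LocallyOfFiniteType (i ≫ π) := by
    obtain ⟨U, hU⟩ := exists_affineOpen_mem (π q)
    obtain ⟨n, x, φ, hx, hφo, hφ, hφW⟩ := hπ.exists_charts U
    obtain ⟨i, hi⟩ := hπ.exists_mem_range hx hφW hU
    refine ⟨_, φ i, hφo i, hi, ?_⟩
    rw [hφ]
    have h1 : LocallyOfFiniteType (Spec.map (CommRingCat.ofHom
        (algebraMap Γ(X, U.1) (affineBlowupAlgebra x (x i))))) := by
      rw [HasRingHomProperty.Spec_iff (P := @LocallyOfFiniteType)]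
      exact RingHom.finiteType_algebraMap.mpr (finiteType_affineBlowupAlgebra x (x i))
    infer_instance
  choose Y i hi hq h using h
  let 𝒰 : X'.OpenCover := ⟨⟨X', Y, i⟩,
    ⟨by simpa using show ∀ x, ∃ j y, i j y = x from (⟨_, hq ·⟩), by simpa⟩⟩
  have := HasRingHomProperty.instIsZariskiLocalAtSource (P := @LocallyOfFiniteType)
  exact IsZariskiLocalAtSource.of_openCover (P := @LocallyOfFiniteType) 𝒰 h

lemma IsBlowup.quasiCompact [IsLocallyNoetherian X] (hπ : IsBlowup π Z) : QuasiCompact π := by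
  rw [quasiCompact_iff_forall_isAffineOpen]
  intro U hU
  obtain ⟨n, x, φ, hx, hφo, hφ, hφW⟩ := hπ.exists_charts ⟨U, hU⟩
  have h1 : ((π ⁻¹ᵁ U : X'.Opens) : Set X') = ⋃ i, Set.range (φ i) := by
    ext q
    rw [Set.mem_iUnion]
    refine ⟨fun hq ↦ hπ.exists_mem_range hx hφW hq, ?_⟩
    rintro ⟨i, y, rfl⟩
    change (φ i ≫ π) y ∈ U
    rw [hφ]
    exact le_preimage_SpecMap_fromSpec hU _ trivial
  rw [h1]
  exact isCompact_iUnion fun i ↦ isCompact_range (φ i).continuous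

lemma IsChartOpen.mul_eq_one {U : X.affineOpens} {a a' : Γ(X, U.1)} {W W₁ W₂ : X'.affineOpens}
    (h₁ : IsChartOpen π Z U a W₁) (h₂ : IsChartOpen π Z U a' W₂) (hW₁ : W.1 ≤ W₁.1)
    (hW₂ : W.1 ≤ W₂.1) {b : Γ(X', W₁.1)} {b' : Γ(X', W₂.1)}
    (hb : b * π.appLE U.1 W₁.1 h₁.le a = π.appLE U.1 W₁.1 h₁.le a')
    (hb' : b' * π.appLE U.1 W₂.1 h₂.le a' = π.appLE U.1 W₂.1 h₂.le a) :
    X'.presheaf.map (homOfLE hW₂).op b' * X'.presheaf.map (homOfLE hW₁).op b = 1 := by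
  have e1 := congr(X'.presheaf.map (homOfLE hW₁).op $hb)
  have e2 := congr(X'.presheaf.map (homOfLE hW₂).op $hb')
  rw [map_mul, map_appLE_apply, map_appLE_apply] at e1 e2
  refine sub_eq_zero.mp (mem_nonZeroDivisors_iff_right.mp (h₁.mono hW₁).mem_nonZeroDivisors _ ?_)
  rw [sub_mul, mul_assoc, e1, e2, one_mul, sub_self]

lemma appLE_appTop {Y T : Scheme.{u}} (j : T ⟶ Y) (l : Y ⟶ X') (i : T ⟶ X') (h : j ≫ l = i)
    {W : X'.Opens} (hl : ⊤ ≤ l ⁻¹ᵁ W) (hi : ⊤ ≤ i ⁻¹ᵁ W) (b : Γ(X', W)) :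
    j.appTop (l.appLE W ⊤ hl b) = i.appLE W ⊤ hi b := by
  subst h
  have h1 := Scheme.Hom.appLE_comp_appLE j l W ⊤ ⊤ hl le_rfl
  refine Eq.trans ?_ congr(($h1).hom b)
  exact congr(($(Scheme.Hom.appLE_eq_app (f := j) (U := ⊤))).hom (l.appLE W ⊤ hl b)).symm

/-- Valuative criterion: two lifts that agree over the fraction field are shown to land in one
affine chart, where they agree because the valuation ring injects into its fraction field. -/
lemma IsBlowup.isSeparated [IsLocallyNoetherian X] (hπ : IsBlowup π Z) : IsSeparated π := by
  have := hπ.locallyOfFiniteType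
  have := LocallyOfFiniteType.isLocallyNoetherian π
  refine IsSeparated.of_valuativeCriterion π fun S ↦ ⟨fun l₁ l₂ ↦ ?_⟩
  set j : Spec (.of S.K) ⟶ Spec (.of S.R) :=
    Spec.map (CommRingCat.ofHom (algebraMap S.R S.K)) with hj
  have hjinj : Function.Injective j.appTop := by
    have h1 := Scheme.ΓSpecIso_naturality (CommRingCat.ofHom (algebraMap S.R S.K))
    have h2 : Function.Injective (j.appTop ≫ (Scheme.ΓSpecIso (.of S.K)).hom) := by
      rw [hj, h1]
      refine (IsFractionRing.injective S.R S.K).comp ?_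
      exact (Scheme.ΓSpecIso (.of S.R)).commRingCatIsoToRingEquiv.injective
    exact Function.Injective.of_comp h2
  let c : Spec (.of S.R) := IsLocalRing.closedPoint S.R
  have hrange (l : Spec (.of S.R) ⟶ X') {W : X'.Opens} (h : l c ∈ W) : ⊤ ≤ l ⁻¹ᵁ W := fun y _ ↦
    ((IsLocalRing.specializes_closedPoint y).map l.continuous).mem_open W.2 h
  have hπc : π (l₂.l c) = π (l₁.l c) := by
    change (l₂.l ≫ π) c = (l₁.l ≫ π) c
    rw [l₁.fac_right, l₂.fac_right]
  obtain ⟨U, hU⟩ := exists_affineOpen_mem (π (l₁.l c))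
  obtain ⟨n, x, φ, hx, hφo, hφ, hφW⟩ := hπ.exists_charts U
  obtain ⟨i₁, W₁, hc₁, hW₁⟩ := exists_isChartOpen hπ.isEffectiveCartier hx hU
  obtain ⟨i₂, W₂, hc₂, hW₂⟩ := exists_isChartOpen hπ.isEffectiveCartier hx (hπc ▸ hU)
  have hr₁ : (W₁.1 : Set X') ⊆ Set.range (φ i₁) := hφW i₁ W₁ hW₁
  obtain ⟨b₁, hb₁⟩ : ∃ b, b * π.appLE U.1 W₁.1 hW₁.le (x i₁) = π.appLE U.1 W₁.1 hW₁.le (x i₂) :=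
    Ideal.mem_span_singleton'.mp (hW₁.map_eq ▸
      Ideal.mem_map_of_mem _ (hx ▸ Ideal.subset_span ⟨i₂, rfl⟩))
  obtain ⟨b₂, hb₂⟩ : ∃ b, b * π.appLE U.1 W₂.1 hW₂.le (x i₂) = π.appLE U.1 W₂.1 hW₂.le (x i₁) :=
    Ideal.mem_span_singleton'.mp (hW₂.map_eq ▸
      Ideal.mem_map_of_mem _ (hx ▸ Ideal.subset_span ⟨i₁, rfl⟩))
  let w : Spec (.of S.K) := IsLocalRing.closedPoint S.K
  have hw₁ : S.i₁ w ∈ W₁.1 := by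
    rw [← l₁.fac_left]
    exact hrange l₁.l hc₁ trivial
  have hw₂ : S.i₁ w ∈ W₂.1 := by
    rw [← l₂.fac_left]
    exact hrange l₂.l hc₂ trivial
  obtain ⟨W, hwW, hW⟩ := exists_affineOpen_le (S.i₁ w) (W₁.1 ⊓ W₂.1) ⟨hw₁, hw₂⟩
  have hone := hW₁.mul_eq_one hW₂ (hW.trans inf_le_left) (hW.trans inf_le_right) hb₁ hb₂
  have hiW : ⊤ ≤ S.i₁ ⁻¹ᵁ W.1 := fun y _ ↦ by
    have : y = w := (IsLocalRing.specializes_closedPoint y).eq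
    rw [this]
    exact hwW
  have hres {V : X'.Opens} (h : W.1 ≤ V) (b : Γ(X', V)) : S.i₁.appLE W.1 ⊤ hiW
      (X'.presheaf.map (homOfLE h).op b) = S.i₁.appLE V ⊤ (hiW.trans (S.i₁.preimage_mono h)) b :=
    congr($(Scheme.Hom.map_appLE S.i₁ hiW (homOfLE h).op).hom b)
  -- The quotients `x i₂ / x i₁` along the first lift and `x i₁ / x i₂` along the second both lie in
  -- the valuation ring, and their product is `1` over the fraction field. So the second lift also
  -- maps into the chart of `i₁`.
  have hunit : IsUnit (l₂.l.appLE W₂.1 ⊤ (hrange l₂.l hc₂) b₂) := by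
    refine IsUnit.of_mul_eq_one (l₁.l.appLE W₁.1 ⊤ (hrange l₁.l hc₁) b₁) (hjinj ?_)
    rw [map_mul, appLE_appTop j l₂.l S.i₁ l₂.fac_left _ (hiW.trans (S.i₁.preimage_mono
      (hW.trans inf_le_right))), appLE_appTop j l₁.l S.i₁ l₁.fac_left _ (hiW.trans
      (S.i₁.preimage_mono (hW.trans inf_le_left))), 
      ← hres (hW.trans inf_le_right), ← hres (hW.trans inf_le_left), ← map_mul, hone, map_one,
      map_one]
  have hc₂' : l₂.l c ∈ X'.basicOpen b₂ := by
    rw [Scheme.mem_basicOpen X' b₂ _ hc₂, ← isUnit_map_iff (l₂.l.stalkMap c).hom]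
    have h1 := Scheme.Hom.germ_stalkMap_apply l₂.l W₂.1 c hc₂ b₂
    refine (congrArg IsUnit h1).mpr ?_
    have h2 := hunit.map ((Spec (.of S.R)).presheaf.germ ⊤ c trivial).hom
    have h3 := (Spec (.of S.R)).presheaf.germ_res_apply (homOfLE (hrange l₂.l hc₂)) c trivial
      (l₂.l.app W₂.1 b₂)
    rw [← h3]
    exact h2
  have hr₂ := hφW i₁ _ (hW₂.exists_basicOpen (hb₂.symm.trans (mul_comm _ _)))
  have := hφo i₁
  have hl₁ : Set.range l₁.l ⊆ Set.range (φ i₁) := by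
    rintro _ ⟨y, rfl⟩
    exact hr₁ (hrange l₁.l hc₁ (Opens.mem_top y))
  have hl₂ : Set.range l₂.l ⊆ Set.range (φ i₁) := by
    rintro _ ⟨y, rfl⟩
    exact hr₂ (hrange l₂.l hc₂' (Opens.mem_top y))
  have heq : IsOpenImmersion.lift (φ i₁) l₁.l hl₁ = IsOpenImmersion.lift (φ i₁) l₂.l hl₂ := by
    refine ext_of_isAffine ?_
    have h1 : j ≫ IsOpenImmersion.lift (φ i₁) l₁.l hl₁ =
        j ≫ IsOpenImmersion.lift (φ i₁) l₂.l hl₂ := by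
      rw [← cancel_mono (φ i₁), Category.assoc, Category.assoc, IsOpenImmersion.lift_fac,
        IsOpenImmersion.lift_fac, l₁.fac_left, l₂.fac_left]
    have h2 := congr(Scheme.Hom.appTop $h1)
    rw [Scheme.Hom.comp_appTop, Scheme.Hom.comp_appTop] at h2
    ext z
    exact hjinj congr($(h2).hom z)
  ext1
  rw [← IsOpenImmersion.lift_fac (φ i₁) l₁.l hl₁, heq, IsOpenImmersion.lift_fac]

end Global

/-! ### The blowup away from its centre; integrality. -/

section Complement

variable {X X' : Scheme.{u}} {π : X' ⟶ X} {Z : X.IdealSheafData}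

lemma mem_support_comap {Y : Scheme.{u}} (h : Y ⟶ X) {y : Y} :
    y ∈ (Z.comap h).support ↔ h y ∈ Z.support := by
  rw [Scheme.IdealSheafData.support_comap]
  rfl

lemma isEffectiveCartier_top : IsEffectiveCartier (⊤ : X.IdealSheafData) := fun x ↦ by
  obtain ⟨U, hU⟩ := exists_affineOpen_mem x
  exact ⟨U, hU, 1, one_mem _, Ideal.span_singleton_one.symm⟩

lemma isEffectiveCartier_comap_of_disjoint {Y : Scheme.{u}} {h : Y ⟶ X}
    (hh : ∀ y, h y ∉ Z.support) : IsEffectiveCartier (Z.comap h) := by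
  have h1 : Z.comap h = ⊤ := by
    rw [← Scheme.IdealSheafData.support_eq_bot_iff]
    ext y
    simpa using! fun hy ↦ hh y ((mem_support_comap h).mp hy)
  rw [h1]
  exact isEffectiveCartier_top

/-- On the complement of the centre the ideal is the unit ideal, trivially Cartier. The universal
property therefore gives a section there, inverse to `π` by uniqueness. -/
lemma IsBlowup.isOpenImmersion_restrict (hπ : IsBlowup π Z) :
    IsOpenImmersion ((exceptionalCompl π Z).ι ≫ π) ∧
      Set.range ((exceptionalCompl π Z).ι ≫ π) = (Z.support : Set X)ᶜ := by
  set T := exceptionalCompl π Z with hT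
  let V : X.Opens := Z.support.compl
  have hTV (x : T) : π x.1 ∈ V := fun h ↦ x.2 ((mem_support_comap π).mpr h)
  obtain ⟨s, hs, -⟩ := hπ.existsUnique_lift _ V.ι
    (isEffectiveCartier_comap_of_disjoint fun y ↦ y.2)
  let g : T.toScheme ⟶ V := IsOpenImmersion.lift V.ι (T.ι ≫ π) (by
    rw [Scheme.Opens.range_ι]
    rintro _ ⟨x, rfl⟩
    exact hTV x)
  have hg : g ≫ V.ι = T.ι ≫ π := IsOpenImmersion.lift_fac _ _ _
  have hsT (y : V) : s y ∈ T := fun h ↦ by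
    have h1 : (s ≫ π) y ∈ Z.support := (mem_support_comap π).mp h
    rw [hs] at h1
    exact y.2 h1
  let s' : V.toScheme ⟶ T := IsOpenImmersion.lift T.ι s (by
    rw [Scheme.Opens.range_ι]
    rintro _ ⟨y, rfl⟩
    exact hsT y)
  have hs' : s' ≫ T.ι = s := IsOpenImmersion.lift_fac _ _ _
  have h1 : g ≫ s = T.ι := by
    refine (hπ.existsUnique_lift _ (T.ι ≫ π)
      (isEffectiveCartier_comap_of_disjoint fun x ↦ hTV x)).unique ?_ rfl
    rw [Category.assoc, hs, hg]
  have h2 : g ≫ s' = 𝟙 _ := by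
    rw [← cancel_mono T.ι, Category.assoc, hs', h1, Category.id_comp]
  have h3 : s' ≫ g = 𝟙 _ := by
    rw [← cancel_mono V.ι, Category.assoc, hg, reassoc_of% hs', hs, Category.id_comp]
  have : IsIso g := ⟨s', h2, h3⟩
  constructor
  · rw [← hg]
    infer_instance
  · ext p
    constructor
    · rintro ⟨x, rfl⟩
      exact hTV x
    · intro hp
      refine ⟨s' ⟨p, hp⟩, ?_⟩
      change (s' ≫ T.ι ≫ π) _ = _
      rw [reassoc_of% hs', hs]
      rfl

lemma IsBlowup.isIso_stalkMap (hπ : IsBlowup π Z) {q : X'} (hq : π q ∉ Z.support) :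
    IsIso (π.stalkMap q) := by
  have h1 := hπ.isOpenImmersion_restrict.1
  obtain ⟨q', rfl⟩ : ∃ q', (exceptionalCompl π Z).ι q' = q :=
    ⟨⟨q, fun h ↦ hq ((mem_support_comap π).mp h)⟩, rfl⟩
  have h2 := Scheme.Hom.stalkMap_comp (exceptionalCompl π Z).ι π q'
  have h3 : IsIso (π.stalkMap ((exceptionalCompl π Z).ι q') ≫
    (exceptionalCompl π Z).ι.stalkMap q') := by
    rw [← h2]
    exact (IsOpenImmersion.iff_isIso_stalkMap.mp h1).2 q'
  have h4 : IsIso ((exceptionalCompl π Z).ι.stalkMap q') :=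
    (IsOpenImmersion.iff_isIso_stalkMap.mp inferInstance).2 q'
  exact IsIso.of_isIso_comp_right _ ((exceptionalCompl π Z).ι.stalkMap q')

lemma IsBlowup.eq_of_notMem (hπ : IsBlowup π Z) {q q' : X'} (hq : π q ∉ Z.support)
    (h : π q = π q') : q = q' := by
  have h1 := hπ.isOpenImmersion_restrict.1
  have h2 := ((exceptionalCompl π Z).ι ≫ π).isOpenEmbedding.injective
    (a₁ := ⟨q, fun h ↦ hq ((mem_support_comap π).mp h)⟩)
    (a₂ := ⟨q', fun h' ↦ hq (h ▸ (mem_support_comap π).mp h')⟩) h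
  exact congr(($h2).1)

lemma restrict_basicOpen_injective {W : X'.affineOpens} {g : Γ(X', W.1)}
    (hg : g ∈ nonZeroDivisors Γ(X', W.1)) :
    Function.Injective (X'.presheaf.map (homOfLE (X'.basicOpen_le g)).op) := by
  have := (isAffineOpen_coe W).isLocalization_basicOpen g
  exact IsLocalization.injective (M := Submonoid.powers g) Γ(X', X'.basicOpen g)
    (Submonoid.powers_le.mpr hg)

lemma mem_basicOpen_of_mem_exceptionalCompl {D : X'.IdealSheafData} {W : X'.affineOpens}
    {g : Γ(X', W.1)} (hW : D.ideal W = Ideal.span {g}) {x : X'} (hx : x ∈ W.1) :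
    x ∈ X'.basicOpen g ↔ x ∉ D.support := by
  rw [Scheme.mem_basicOpen X' g x hx, ← stalkIdeal_eq_top_iff, stalkIdeal_eq D hx, hW,
    Ideal.map_span, Set.image_singleton, Ideal.span_singleton_eq_top]

/-- The complement of the exceptional divisor is integral, being open in `X`. The equation of the
divisor is a nonzerodivisor, so local sections embed in their restrictions to the complement; this
gives both density and reducedness. -/
lemma IsBlowup.isIntegral [IsIntegral X] (hπ : IsBlowup π Z)
    (hZ : ∃ p, p ∉ Z.support) : IsIntegral X' := by
  have hopen := hπ.isOpenImmersion_restrict.1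
  have hrange := hπ.isOpenImmersion_restrict.2
  obtain ⟨p, hp⟩ := hZ
  have hp' : p ∈ Set.range ((exceptionalCompl π Z).ι ≫ π) := hrange ▸ hp
  obtain ⟨q₀, hq₀⟩ := hp'
  have hirr : IsIntegral (exceptionalCompl π Z) := by
    have : Nonempty (exceptionalCompl π Z) := ⟨q₀⟩
    exact isIntegral_of_isOpenImmersion ((exceptionalCompl π Z).ι ≫ π)
  have hdense : closure (exceptionalCompl π Z : Set X') = Set.univ := by
    refine Set.eq_univ_of_forall fun q ↦ mem_closure_iff.mpr fun O hO hqO ↦ ?_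
    obtain ⟨V, hV, g, hg, hgE⟩ := hπ.isEffectiveCartier q
    obtain ⟨W, hqW, hW⟩ := exists_affineOpen_le q (V.1 ⊓ ⟨O, hO⟩) ⟨hV, hqO⟩
    have hWV : W.1 ≤ V.1 := hW.trans inf_le_left
    set g' := X'.presheaf.map (homOfLE hWV).op g with hg'
    have hgW : (exceptionalDivisor π Z).ideal W = Ideal.span {g'} := by
      rw [← Scheme.IdealSheafData.map_ideal _ (U := W) (V := V) hWV, hgE, Ideal.map_span,
        Set.image_singleton]
      rfl
    have hinj := restrict_basicOpen_injective (map_mem_nonZeroDivisors V.2 hWV hg)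
    by_contra hc
    have hb : X'.basicOpen g' = ⊥ := by
      refine eq_bot_iff.mpr fun x hx ↦ hc ⟨x, ?_, ?_⟩
      · exact (hW (X'.basicOpen_le g' hx)).2
      · exact (mem_basicOpen_of_mem_exceptionalCompl hgW (X'.basicOpen_le g' hx)).mp hx
    have h1 : (1 : Γ(X', W.1)) = 0 := by
      refine hinj ?_
      have : Subsingleton Γ(X', X'.basicOpen g') := by
        rw [hb]
        infer_instance
      exact Subsingleton.elim _ _
    have : Nonempty W.1 := ⟨⟨q, hqW⟩⟩
    exact one_ne_zero h1
  have hirr' : IrreducibleSpace X' := by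
    have h1 : IsIrreducible (exceptionalCompl π Z : Set X') := by
      have h2 : IsIrreducible (Set.range (exceptionalCompl π Z).ι) := by
        rw [← Set.image_univ]
        exact (IrreducibleSpace.isIrreducible_univ _).image _
          (exceptionalCompl π Z).ι.continuous.continuousOn
      rwa [Scheme.Opens.range_ι] at h2
    have h2 := h1.closure
    rw [hdense] at h2
    exact (irreducibleSpace_def X').mpr h2
  have hred : IsReduced X' := by
    have (q : X') : _root_.IsReduced (X'.presheaf.stalk q) := by
      obtain ⟨W, hqW, g, hg, hgE⟩ := hπ.isEffectiveCartier q
      have hinj := restrict_basicOpen_injective hg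
      have h1 : _root_.IsReduced Γ(X', W.1) := by
        refine ⟨fun z hz ↦ hinj ?_⟩
        rw [map_zero]
        refine TopCat.Presheaf.section_ext X'.sheaf _ _ 0 fun x hx ↦ ?_
        have hx' := (mem_basicOpen_of_mem_exceptionalCompl hgE (X'.basicOpen_le g hx)).mp hx
        have := hπ.isIso_stalkMap (q := x) fun h ↦ hx' ((mem_support_comap π).mpr h)
        have h2 : _root_.IsReduced (X'.presheaf.stalk x) :=
          isReduced_of_injective (asIso (π.stalkMap x)).commRingCatIsoToRingEquiv.symm
            (asIso (π.stalkMap x)).commRingCatIsoToRingEquiv.symm.injective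
        have h3 := (hz.map (X'.presheaf.map (homOfLE (X'.basicOpen_le g)).op).hom).map
          (X'.presheaf.germ _ x hx).hom
        exact h3.eq_zero.trans (map_zero _).symm
      letI := (X'.presheaf.germ W.1 q hqW).hom.toAlgebra
      have l1 := isLocalization_germ W.2 hqW
      exact isReduced_localizationPreserves
        ((isAffineOpen_coe W).primeIdealOf ⟨q, hqW⟩).asIdeal.primeCompl _ h1
    exact isReduced_of_isReduced_stalk _
  exact isIntegral_of_irreducibleSpace_of_isReduced _

end Complement

open scoped TensorProduct

/-! ### The standard chart over a ring with parameters. -/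

section ChartAlgebra

/-- The coordinate ring of a standard chart of the blowup of affine space along a coordinate
subspace. -/
@[nolint unusedArguments]
def ChartRing (k : Type*) [Field k] {ι₁ : Type*} (ι₂ : Type*) (_ : ι₁) : Type _ :=
  MvPolynomial (ι₁ ⊕ ι₂) k

variable (k : Type*) [Field k] {ι₁ : Type*} (ι₂ : Type*) [DecidableEq ι₁] (i₀ : ι₁)

instance : CommRing (ChartRing k ι₂ i₀) := inferInstanceAs (CommRing (MvPolynomial (ι₁ ⊕ ι₂) k))

instance : Algebra k (ChartRing k ι₂ i₀) :=
  inferInstanceAs (Algebra k (MvPolynomial (ι₁ ⊕ ι₂) k))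

instance : Algebra.FormallySmooth k (ChartRing k ι₂ i₀) :=
  inferInstanceAs (Algebra.FormallySmooth k (MvPolynomial (ι₁ ⊕ ι₂) k))

/-- The coordinates of the chart. -/
def ChartRing.X (i : ι₁ ⊕ ι₂) : ChartRing k ι₂ i₀ := (MvPolynomial.X i : MvPolynomial (ι₁ ⊕ ι₂) k)

/-- The quotients of the equations of the centre by the equation of the exceptional divisor. -/
def ChartRing.z (j : ι₁) : ChartRing k ι₂ i₀ := if j = i₀ then 1 else ChartRing.X k ι₂ i₀ (.inl j)

/-- The homomorphism of coordinate rings defined by the blowup. -/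
def ChartRing.ofBase : MvPolynomial (ι₁ ⊕ ι₂) k →ₐ[k] ChartRing k ι₂ i₀ :=
  MvPolynomial.aeval (Sum.elim
    (fun j ↦ ChartRing.X k ι₂ i₀ (.inl i₀) * ChartRing.z k ι₂ i₀ j)
    (fun j ↦ ChartRing.X k ι₂ i₀ (.inr j)))

instance : Algebra (MvPolynomial (ι₁ ⊕ ι₂) k) (ChartRing k ι₂ i₀) :=
  (ChartRing.ofBase k ι₂ i₀).toRingHom.toAlgebra

instance : IsScalarTower k (MvPolynomial (ι₁ ⊕ ι₂) k) (ChartRing k ι₂ i₀) :=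
  .of_algebraMap_eq fun c ↦ ((ChartRing.ofBase k ι₂ i₀).commutes c).symm

variable {k ι₂ i₀}

lemma ChartRing.z_self : ChartRing.z k ι₂ i₀ i₀ = 1 := if_pos rfl

lemma ChartRing.algebraMap_X_inl (j : ι₁) : algebraMap (MvPolynomial (ι₁ ⊕ ι₂) k)
    (ChartRing k ι₂ i₀) (.X (.inl j)) = ChartRing.X k ι₂ i₀ (.inl i₀) * ChartRing.z k ι₂ i₀ j :=
  MvPolynomial.aeval_X _ _

lemma ChartRing.algebraMap_X_inr (j : ι₂) : algebraMap (MvPolynomial (ι₁ ⊕ ι₂) k)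
    (ChartRing k ι₂ i₀) (.X (.inr j)) = ChartRing.X k ι₂ i₀ (.inr j) :=
  MvPolynomial.aeval_X _ _

variable (i₀) in
lemma ChartRing.exists_algHom {G : Type*} [CommRing G] [Algebra k G] (t : G) (z : ι₁ → G)
    (hz : z i₀ = 1) (w : ι₂ → G) : ∃ h : ChartRing k ι₂ i₀ →ₐ[k] G,
      h (ChartRing.X k ι₂ i₀ (.inl i₀)) = t ∧ (∀ j, h (ChartRing.z k ι₂ i₀ j) = z j) ∧
        ∀ j, h (ChartRing.X k ι₂ i₀ (.inr j)) = w j := by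
  let h : MvPolynomial (ι₁ ⊕ ι₂) k →ₐ[k] G :=
    MvPolynomial.aeval (Sum.elim (fun j ↦ if j = i₀ then t else z j) w)
  have h1 (i) : h (.X i) = Sum.elim (fun j ↦ if j = i₀ then t else z j) w i :=
    MvPolynomial.aeval_X _ _
  refine ⟨h, (h1 _).trans (if_pos rfl), fun j ↦ ?_, fun j ↦ h1 _⟩
  by_cases hj : j = i₀
  · subst hj
    rw [ChartRing.z_self, hz]
    exact map_one h
  · rw [ChartRing.z, if_neg hj]
    exact (h1 _).trans (if_neg hj)

variable {R : Type*} [CommRing R] [Algebra k R] [Algebra (MvPolynomial (ι₁ ⊕ ι₂) k) R]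
  [IsScalarTower k (MvPolynomial (ι₁ ⊕ ι₂) k) R]

variable (R ι₂ i₀) in
/-- The chart of the blowup of `R` along a part of the coordinates. -/
abbrev ChartAlgebra : Type _ := ChartRing k ι₂ i₀ ⊗[MvPolynomial (ι₁ ⊕ ι₂) k] R

variable (i₀) in
/-- The homomorphism from `R` to the chart of the blowup. -/
def ChartAlgebra.of : R →ₐ[k] ChartAlgebra (k := k) ι₂ i₀ R :=
  Algebra.TensorProduct.includeRight.restrictScalars k

variable (R i₀) in
/-- The coordinates of the chart, in the chart algebra. -/
def ChartAlgebra.z (j : ι₁) : ChartAlgebra (k := k) ι₂ i₀ R := ChartRing.z k ι₂ i₀ j ⊗ₜ 1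

lemma tmul_one_eq_of (p : MvPolynomial (ι₁ ⊕ ι₂) k) :
    (algebraMap _ (ChartRing k ι₂ i₀) p ⊗ₜ 1 : ChartAlgebra (k := k) ι₂ i₀ R) =
      ChartAlgebra.of i₀ (algebraMap _ R p) := by
  rw [Algebra.algebraMap_eq_smul_one, TensorProduct.smul_tmul, ← Algebra.algebraMap_eq_smul_one]
  rfl

variable {x : ι₁ ⊕ ι₂ → R} (hX : ∀ i, algebraMap (MvPolynomial (ι₁ ⊕ ι₂) k) R (.X i) = x i)

include hX

lemma ChartAlgebra.X_inl : (ChartRing.X k ι₂ i₀ (.inl i₀) ⊗ₜ 1 : ChartAlgebra (k := k) ι₂ i₀ R) =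
    ChartAlgebra.of i₀ (x (.inl i₀)) := by
  rw [← hX, ← tmul_one_eq_of, ChartRing.algebraMap_X_inl, ChartRing.z_self, mul_one]

lemma ChartAlgebra.X_inr (j : ι₂) :
    (ChartRing.X k ι₂ i₀ (.inr j) ⊗ₜ 1 : ChartAlgebra (k := k) ι₂ i₀ R) =
      ChartAlgebra.of i₀ (x (.inr j)) := by
  rw [← hX, ← tmul_one_eq_of, ChartRing.algebraMap_X_inr]

lemma ChartAlgebra.of_inl (j : ι₁) : ChartAlgebra.of (k := k) (ι₂ := ι₂) i₀ (x (.inl j)) =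
    ChartAlgebra.of i₀ (x (.inl i₀)) * ChartAlgebra.z i₀ R j := by
  rw [← ChartAlgebra.X_inl hX, ← hX, ← tmul_one_eq_of, ChartRing.algebraMap_X_inl,
    ChartAlgebra.z, Algebra.TensorProduct.tmul_mul_tmul, one_mul]

/-- Maps out of the chart are built from a map on `R` and a choice of quotients of the equations of
the centre; this yields both the comparison with the blowup and its tangent vectors. -/
lemma ChartAlgebra.exists_algHom {G : Type*} [CommRing G] [Algebra k G] (g : R →ₐ[k] G)
    (z : ι₁ → G) (hz : z i₀ = 1) (hgz : ∀ j, g (x (.inl j)) = g (x (.inl i₀)) * z j) :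
    ∃ h : ChartAlgebra (k := k) ι₂ i₀ R →ₐ[k] G, h.comp (ChartAlgebra.of i₀) = g ∧
      ∀ j, h (ChartAlgebra.z i₀ R j) = z j := by
  obtain ⟨h, ht, hhz, hw⟩ := ChartRing.exists_algHom (k := k) i₀ (g (x (.inl i₀))) z hz
    (fun j ↦ g (x (.inr j)))
  let P := MvPolynomial (ι₁ ⊕ ι₂) k
  letI : Algebra P G := (g.toRingHom.comp (algebraMap P R)).toAlgebra
  have hPG (p : P) : algebraMap P G p = g (algebraMap P R p) := rfl
  haveI : IsScalarTower k P G := .of_algebraMap_eq fun c ↦ by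
    rw [hPG, ← IsScalarTower.algebraMap_apply, AlgHom.commutes]
  have hcomp : h.comp (IsScalarTower.toAlgHom k P (ChartRing k ι₂ i₀)) =
      IsScalarTower.toAlgHom k P G := by
    refine MvPolynomial.algHom_ext fun i ↦ ?_
    rw [AlgHom.comp_apply, IsScalarTower.toAlgHom_apply, IsScalarTower.toAlgHom_apply, hPG, hX]
    rcases i with j | j
    · rw [ChartRing.algebraMap_X_inl, map_mul, ht, hhz, hgz j]
    · rw [ChartRing.algebraMap_X_inr, hw]
  let h' : ChartRing k ι₂ i₀ →ₐ[P] G := { h with commutes' := fun p ↦ congr($hcomp p) }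
  let g' : R →ₐ[P] G := { g with commutes' := fun p ↦ rfl }
  have hL (a r) : Algebra.TensorProduct.lift h' g' (fun _ _ ↦ .all _ _) (a ⊗ₜ r) = h a * g r :=
    Algebra.TensorProduct.lift_tmul _ _ _ _ _
  refine ⟨(Algebra.TensorProduct.lift h' g' fun _ _ ↦ .all _ _).restrictScalars k,
    AlgHom.ext fun r ↦ ?_, fun j ↦ ?_⟩
  · refine (hL 1 r).trans ?_
    rw [map_one, one_mul]
  · refine (hL _ 1).trans ?_
    rw [map_one, mul_one, hhz]

lemma ChartAlgebra.ringHom_ext {G : Type*} [CommRing G]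
    {h h' : ChartAlgebra (k := k) ι₂ i₀ R →+* G}
    (hh : ∀ r, h (ChartAlgebra.of i₀ r) = h' (ChartAlgebra.of i₀ r))
    (hz : ∀ j, h (ChartAlgebra.z i₀ R j) = h' (ChartAlgebra.z i₀ R j)) : h = h' := by
  have h1 : h.comp (algebraMap (ChartRing k ι₂ i₀) (ChartAlgebra (k := k) ι₂ i₀ R)) =
      h'.comp (algebraMap (ChartRing k ι₂ i₀) (ChartAlgebra (k := k) ι₂ i₀ R)) := by
    refine MvPolynomial.ringHom_ext (R := k) (σ := ι₁ ⊕ ι₂) (fun c ↦ ?_) fun i ↦ ?_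
    · have h2 := hh (algebraMap k R c)
      rw [AlgHom.commutes] at h2
      exact h2
    · rcases i with j | j
      · by_cases hj : j = i₀
        · subst hj
          have h2 := hh (x (.inl j))
          rw [← ChartAlgebra.X_inl hX] at h2
          exact h2
        · have h2 := hz j
          rw [ChartAlgebra.z, ChartRing.z, if_neg hj] at h2
          exact h2
      · have h2 := hh (x (.inr j))
        rw [← ChartAlgebra.X_inr hX] at h2
        exact h2
  refine RingHom.ext fun y ↦ ?_
  induction y using TensorProduct.induction_on with
  | zero => rw [map_zero, map_zero]
  | add y y' hy hy' => rw [map_add, map_add, hy, hy']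
  | tmul a r =>
    have h2 : (a ⊗ₜ r : ChartAlgebra (k := k) ι₂ i₀ R) =
        algebraMap (ChartRing k ι₂ i₀) _ a * ChartAlgebra.of i₀ r := by
      refine Eq.trans ?_ (Algebra.TensorProduct.tmul_mul_tmul a 1 1 r).symm
      rw [mul_one, one_mul]
    rw [h2, map_mul, map_mul, hh]
    exact congr($(congr($h1 a)) * _)

lemma ChartAlgebra.ringHom_ext_of_mem_nonZeroDivisors {G : Type*} [CommRing G]
    {h h' : ChartAlgebra (k := k) ι₂ i₀ R →+* G}
    (hh : ∀ r, h (ChartAlgebra.of i₀ r) = h' (ChartAlgebra.of i₀ r))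
    (ht : h (ChartAlgebra.of i₀ (x (.inl i₀))) ∈ nonZeroDivisors G) : h = h' := by
  refine ChartAlgebra.ringHom_ext hX hh fun j ↦ sub_eq_zero.mp ?_
  refine mem_nonZeroDivisors_iff_right.mp ht _ ?_
  rw [mul_comm, mul_sub, ← map_mul, ← ChartAlgebra.of_inl hX, hh (x (.inl i₀)), ← map_mul,
    ← ChartAlgebra.of_inl hX, hh, sub_self]

omit hX [Algebra k R] [IsScalarTower k (MvPolynomial (ι₁ ⊕ ι₂) k) R] in
-- Formal smoothness of `R` over the polynomial ring is stable under base change to the chart of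
-- affine space, itself a polynomial ring over `k`.
lemma ChartAlgebra.formallySmooth [Algebra.FormallySmooth (MvPolynomial (ι₁ ⊕ ι₂) k) R] :
    Algebra.FormallySmooth k (ChartAlgebra (k := k) ι₂ i₀ R) :=
  Algebra.FormallySmooth.comp k (ChartRing k ι₂ i₀) _

omit hX in
lemma ChartAlgebra.essFiniteType [Finite ι₁] [Finite ι₂] [Algebra.EssFiniteType k R] :
    Algebra.EssFiniteType k (ChartAlgebra (k := k) ι₂ i₀ R) := by
  have h1 : Algebra.EssFiniteType (MvPolynomial (ι₁ ⊕ ι₂) k) R :=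
    Algebra.EssFiniteType.of_comp k _ _
  have h2 : Algebra.EssFiniteType k (ChartRing k ι₂ i₀) :=
    inferInstanceAs (Algebra.EssFiniteType k (MvPolynomial (ι₁ ⊕ ι₂) k))
  exact Algebra.EssFiniteType.comp k (ChartRing k ι₂ i₀) _

end ChartAlgebra

/-! ### The local ring of a blowup by its universal property. -/

section LocalStructure

variable {X X' : Scheme.{u}} {π : X' ⟶ X} {Z : X.IdealSheafData}

lemma isEffectiveCartier_comap_stalk (Z : X.IdealSheafData) (p : X) {G : CommRingCat.{u}}
    (ρ : X.presheaf.stalk p ⟶ G) {t : G} (ht : t ∈ nonZeroDivisors G)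
    (h : (stalkIdeal Z p).map ρ.hom = Ideal.span {t}) :
    IsEffectiveCartier (Z.comap (Spec.map ρ ≫ X.fromSpecStalk p)) := by
  obtain ⟨U, hU⟩ := exists_affineOpen_mem p
  rw [← (isAffineOpen_coe U).fromSpecStalk_eq_fromSpecStalk hU, IsAffineOpen.fromSpecStalk,
    ← Spec.map_comp_assoc]
  refine isEffectiveCartier_comap Z (U := U) _ ht ?_
  rw [CommRingCat.hom_comp, ← Ideal.map_map, ← h, stalkIdeal_eq Z hU]

/-- The local ring of a blowup is determined by its universal property. -/
lemma IsBlowup.bijective_of_isLocalHom (hπ : IsBlowup π Z) (q : X') {B : CommRingCat.{u}}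
    [IsLocalRing B] (ρ : X.presheaf.stalk (π q) ⟶ B) (γ : B ⟶ X'.presheaf.stalk q)
    [IsLocalHom γ.hom] (hγ : ρ ≫ γ = π.stalkMap q) {s : B} (hs : s ∈ nonZeroDivisors B)
    (hρ : (stalkIdeal Z (π q)).map ρ.hom = Ideal.span {s})
    (hγs : γ s ∈ nonZeroDivisors (X'.presheaf.stalk q))
    (hB : ∀ f : B ⟶ B, ρ ≫ f = ρ → f = 𝟙 B) : Function.Bijective γ := by
  obtain ⟨g, hg, -⟩ := hπ.existsUnique_lift _ _ (isEffectiveCartier_comap_stalk Z (π q) ρ hs hρ)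
  have h1 : Spec.map γ ≫ g = X'.fromSpecStalk q := by
    refine (hπ.existsUnique_lift _ _ (isEffectiveCartier_comap_stalk Z (π q) (π.stalkMap q) hγs
      ?_)).unique ?_ ?_
    · rw [← hγ, CommRingCat.hom_comp, ← Ideal.map_map, hρ, Ideal.map_span, Set.image_singleton]
    · rw [Category.assoc, hg, ← Spec.map_comp_assoc, hγ]
    · exact (Scheme.SpecMap_stalkMap_fromSpecStalk π).symm
  have hgq : g (IsLocalRing.closedPoint B) = q := by
    have h2 : Spec.map γ (IsLocalRing.closedPoint (X'.presheaf.stalk q)) =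
        IsLocalRing.closedPoint B := IsLocalRing.comap_closedPoint γ.hom
    rw [← h2]
    change (Spec.map γ ≫ g) _ = q
    rw [h1]
    exact Scheme.fromSpecStalk_closedPoint
  -- The map `g : Spec B → X'` from the universal property sends the closed point to `q`, because
  -- `γ` is local. It therefore factors through the stalk, and `δ` is the inverse of `γ`.
  obtain ⟨δ, hδ⟩ : ∃ δ : X'.presheaf.stalk q ⟶ B, Spec.map δ ≫ X'.fromSpecStalk q = g := by
    clear h1 hγs hγ hρ hs
    subst hgq
    exact ⟨Scheme.stalkClosedPointTo g, Scheme.Spec_stalkClosedPointTo_fromSpecStalk g⟩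
  have h2 : δ ≫ γ = 𝟙 _ := by
    refine Spec.map_injective ?_
    rw [← cancel_mono (X'.fromSpecStalk q), Spec.map_comp, Category.assoc, hδ, h1, Spec.map_id,
      Category.id_comp]
  have h3 : π.stalkMap q ≫ δ = ρ := by
    refine Spec.map_injective ?_
    rw [← cancel_mono (X.fromSpecStalk (π q)), Spec.map_comp, Category.assoc,
      Scheme.SpecMap_stalkMap_fromSpecStalk, reassoc_of% hδ, hg]
  have h4 : γ ≫ δ = 𝟙 _ := hB _ (by rw [reassoc_of% hγ, h3])
  have : IsIso γ := ⟨δ, h4, h2⟩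
  exact ConcreteCategory.bijective_of_isIso γ

end LocalStructure

open IsLocalRing

/-! ### Evaluation at the closed point and tangent vectors. -/

section RationalLocal

variable {k R : Type*} [Field k] [CommRing R] [Algebra k R]

lemma exists_evaluation (k R : Type*) [Field k] [CommRing R] [Algebra k R] [IsRationalLocal k R] :
    ∃ ev : R →ₐ[k] k, ∀ r, ev r = 0 ↔ r ∈ maximalIdeal R := by
  let e : k ≃ₐ[k] ResidueField R := AlgEquiv.ofBijective (Algebra.ofId k (ResidueField R))
    algebraMap_residueField_bijective
  refine ⟨e.symm.toAlgHom.comp (IsScalarTower.toAlgHom k R (ResidueField R)), fun r ↦ ?_⟩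
  rw [← IsLocalRing.residue_eq_zero_iff]
  exact e.symm.map_eq_zero_iff

/-- Twist evaluation at the point by the dual derivations, with coefficients `w i` times the
infinitesimal. -/
lemma IndepModSq.exists_algHom_dualNumber [IsRationalLocal k R] [Algebra.FormallySmooth k R]
    {ι : Type*} [Fintype ι] {x : ι → R} (hx : IndepModSq k x) (ev : R →ₐ[k] k)
    (hev : ∀ r ∈ maximalIdeal R, ev r = 0) (w : ι → k) :
    ∃ g : R →ₐ[k] DualNumber k, (∀ r, (g r).fst = ev r) ∧
      ∀ i, g (x i) = TrivSqZeroExt.inr (w i) := by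
  classical
  obtain ⟨d, hd⟩ := hx.exists_derivation
  let φ : R →ₐ[k] DualNumber k := (TrivSqZeroExt.inlAlgHom k k k).comp ev
  have ha (i j) : (TrivSqZeroExt.inr (w i) : DualNumber k) * TrivSqZeroExt.inr (w j) = 0 :=
    TrivSqZeroExt.inr_mul_inr _ _ _
  refine ⟨twistHom φ d (fun i ↦ TrivSqZeroExt.inr (w i)) ha, fun r ↦ ?_, fun i ↦ ?_⟩
  · rw [twistHom_apply, TrivSqZeroExt.fst_add]
    have h1 : (∑ i, φ (d i r) * (TrivSqZeroExt.inr (w i) : DualNumber k)).fst = 0 := by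
      rw [TrivSqZeroExt.fst_sum]
      exact Finset.sum_eq_zero fun i _ ↦ by simp
    rw [h1, add_zero]
    rfl
  · rw [twistHom_apply_of_dual _ _ _ _ x hd]
    have h1 : φ (x i) = 0 := by
      change TrivSqZeroExt.inl (ev (x i)) = 0
      rw [hev _ (hx.1 i), TrivSqZeroExt.inl_zero]
    rw [h1, zero_add]

end RationalLocal

/-! ### Coordinates and dual tangent vectors on the blowup. -/

section Coordinates

variable {k R R' : Type u} [Field k] [CommRing R] [Algebra k R] [CommRing R'] [Algebra k R']
  [Algebra R R'] [IsScalarTower k R R'] [IsRationalLocal k R] [IsRationalLocal k R']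
  [Algebra.FormallySmooth k R] [IsLocalHom (algebraMap R R')]

/-- Each local homomorphism to `R'` from a local ring on which the ideal `I` of `R` generates a
Cartier divisor is bijective if it is determined by its restriction to `R`. -/
def HasLocalBlowupProperty (R R' : Type u) [CommRing R] [CommRing R'] [Algebra R R']
    (I : Ideal R) : Prop :=
  ∀ (B : Type u) [CommRing B] [IsLocalRing B] (ρ : R →+* B) (γ : B →+* R') [IsLocalHom γ] (s : B),
    γ.comp ρ = algebraMap R R' → s ∈ nonZeroDivisors B → I.map ρ = Ideal.span {s} →
    γ s ∈ nonZeroDivisors R' → (∀ f : B →+* B, f.comp ρ = ρ → f = RingHom.id B) →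
    Function.Bijective γ

variable {ι₁ ι₂ : Type} [Fintype ι₁] [Fintype ι₂] [DecidableEq ι₁] [DecidableEq ι₂]

omit [IsLocalHom (algebraMap R R')] [DecidableEq ι₂] in
-- The chart algebra maps to `R'`; its localization `B` at the preimage of the maximal ideal is
-- isomorphic to `R'` by the universal property. Formal smoothness passes from `B` to `R'`, and so
-- do tangent vectors, which are easy to construct on the chart.
lemma HasLocalBlowupProperty.exists_coordinates {x : ι₁ ⊕ ι₂ → R} (hx : IndepModSq k x)
    (h : HasLocalBlowupProperty R R' (Ideal.span (Set.range (x ∘ Sum.inl)))) {i₀ : ι₁}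
    (ht : algebraMap R R' (x (.inl i₀)) ∈ nonZeroDivisors R') {z : ι₁ → R'} (hz : z i₀ = 1)
    (hxz : ∀ j, algebraMap R R' (x (.inl j)) = algebraMap R R' (x (.inl i₀)) * z j) :
    Algebra.FormallySmooth k R' ∧
      ∀ (ev : R' →ₐ[k] k) (_ : ∀ r, ev r = 0 ↔ r ∈ maximalIdeal R') (g : R →ₐ[k] DualNumber k)
        (ζ : ι₁ → DualNumber k) (_ : ζ i₀ = 1)
        (_ : ∀ j, g (x (.inl j)) = g (x (.inl i₀)) * ζ j)
        (_ : ∀ r, (g r).fst = ev (algebraMap R R' r)) (_ : ∀ j, (ζ j).fst = ev (z j)),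
        ∃ θ : R' →ₐ[k] DualNumber k, (∀ r, θ (algebraMap R R' r) = g r) ∧ ∀ j, θ (z j) = ζ j := by
  let P := MvPolynomial (ι₁ ⊕ ι₂) k
  let : Algebra P R := (MvPolynomial.aeval x).toRingHom.toAlgebra
  have : IsScalarTower k P R := .of_algebraMap_eq fun c ↦ ((MvPolynomial.aeval x).commutes c).symm
  have hX (i) : algebraMap P R (.X i) = x i := MvPolynomial.aeval_X x i
  have : Algebra.FormallySmooth P R := hx.formallySmooth_mvPolynomial hX
  let T := ChartAlgebra (k := k) ι₂ i₀ R
  have : Algebra.FormallySmooth k T := ChartAlgebra.formallySmooth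
  have : Algebra.EssFiniteType k T := ChartAlgebra.essFiniteType
  obtain ⟨β, hβ, hβz⟩ := ChartAlgebra.exists_algHom (i₀ := i₀) hX (IsScalarTower.toAlgHom k R R')
    z hz hxz
  have hβ' (r : R) : β (ChartAlgebra.of i₀ r) = algebraMap R R' r := congr($hβ r)
  let 𝔮 : Ideal T := (maximalIdeal R').comap β
  have : 𝔮.IsPrime := Ideal.comap_isPrime _ _
  let B := Localization.AtPrime 𝔮
  have hunit (y : 𝔮.primeCompl) : IsUnit (β y) := by
    by_contra hc
    exact y.2 hc
  let γ : B →ₐ[k] R' := IsLocalization.liftAlgHom (M := 𝔮.primeCompl) (f := β) hunit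
  have hγ (y : T) : γ (algebraMap T B y) = β y := IsLocalization.lift_eq hunit y
  have hγl : IsLocalHom γ.toRingHom := ⟨fun b hb ↦ by
    obtain ⟨y, s, rfl⟩ := IsLocalization.exists_mk'_eq 𝔮.primeCompl b
    have h1 := IsLocalization.mk'_spec B y s
    have h2 : IsUnit (β y) := by
      rw [← hγ, ← h1, map_mul]
      exact hb.mul ((hγ s) ▸ hunit s)
    have h3 : IsUnit (algebraMap T B y) :=
      IsLocalization.map_units B (⟨y, fun hy ↦ hy h2⟩ : 𝔮.primeCompl)
    rw [← h1] at h3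
    exact isUnit_of_mul_isUnit_left h3⟩
  have : Algebra.FormallySmooth T B := .of_isLocalization 𝔮.primeCompl
  have : Algebra.FormallySmooth k B := .comp k T B
  have : IsRationalLocal k B :=
    { essFiniteType := by
        have := Algebra.EssFiniteType.of_isLocalization B 𝔮.primeCompl
        exact Algebra.EssFiniteType.comp k T B
      exists_sub_mem := fun r ↦ by
        obtain ⟨c, hc⟩ := IsRationalLocal.exists_sub_mem (k := k) (γ r)
        refine ⟨c, fun hu ↦ hc ?_⟩
        have := hu.map γ
        rwa [map_sub, AlgHom.commutes] at this }
  -- Being a domain is what makes the equation of the exceptional divisor a nonzerodivisor in `B`: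
  -- its image in `R'` is nonzero, so it is nonzero itself.
  have hdom := isDomain_of_formallySmooth k B
  let ρ : R →+* B := (algebraMap T B).comp (ChartAlgebra.of (k := k) (ι₂ := ι₂) i₀).toRingHom
  have hγρ (r : R) : γ (ρ r) = algebraMap R R' r := (hγ _).trans (hβ' r)
  have hs : ρ (x (.inl i₀)) ∈ nonZeroDivisors B := by
    refine mem_nonZeroDivisors_of_ne_zero fun h0 ↦ ?_
    have h1 := hγρ (x (.inl i₀))
    rw [h0, map_zero] at h1
    exact nonZeroDivisors.ne_zero ht h1.symm
  have hbij : Function.Bijective γ := by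
    refine h B ρ γ.toRingHom (ρ (x (.inl i₀))) (RingHom.ext hγρ) hs ?_ ?_ fun f hf ↦ ?_
    · rw [Ideal.map_span]
      refine le_antisymm (Ideal.span_le.mpr ?_) (Ideal.span_mono ?_)
      · rintro _ ⟨_, ⟨j, rfl⟩, rfl⟩
        refine Ideal.mem_span_singleton'.mpr ⟨algebraMap T B (ChartAlgebra.z i₀ R j), ?_⟩
        have h1 := congr(algebraMap T B $(ChartAlgebra.of_inl (i₀ := i₀) hX j))
        rw [map_mul, mul_comm] at h1
        exact h1.symm
      · rintro _ rfl
        exact ⟨_, ⟨i₀, rfl⟩, rfl⟩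
    · exact Set.mem_of_eq_of_mem (hγρ _) ht
    · refine IsLocalization.ringHom_ext 𝔮.primeCompl ?_
      refine ChartAlgebra.ringHom_ext_of_mem_nonZeroDivisors hX (i₀ := i₀)
        (fun r ↦ congr($hf r)) ?_
      exact Set.mem_of_eq_of_mem congr($hf (x (.inl i₀))) hs
  let e : B ≃ₐ[k] R' := AlgEquiv.ofBijective γ hbij
  refine ⟨.of_equiv e, fun ev hev g ζ hζ hgζ hgf hζf ↦ ?_⟩
  obtain ⟨η, hη, hηz⟩ := ChartAlgebra.exists_algHom (i₀ := i₀) hX g ζ hζ hgζ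
  have h1 : (((TrivSqZeroExt.fstHom k k k).comp η : T →ₐ[k] k) : T →+* k) =
      (ev.comp β : T →ₐ[k] k) := by
    refine ChartAlgebra.ringHom_ext hX (fun r ↦ ?_) fun j ↦ ?_
    · change (η.comp (ChartAlgebra.of i₀) r).fst = ev (β (ChartAlgebra.of i₀ r))
      rw [hη, hβ', hgf]
    · change (η (ChartAlgebra.z i₀ R j)).fst = ev (β (ChartAlgebra.z i₀ R j))
      rw [hηz, hβz, hζf]
  have hunit' (y : 𝔮.primeCompl) : IsUnit (η y) := by
    rw [TrivSqZeroExt.isUnit_iff_isUnit_fst]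
    have h2 : (η y).fst = ev (β y) := congr($h1 y)
    rw [h2, isUnit_iff_ne_zero]
    exact fun h0 ↦ y.2 ((hev _).mp h0)
  let η' : B →ₐ[k] DualNumber k := IsLocalization.liftAlgHom (M := 𝔮.primeCompl) (f := η) hunit'
  have hη' (y : T) : η' (algebraMap T B y) = η y := IsLocalization.lift_eq hunit' y
  have he (y : T) : e.symm (β y) = algebraMap T B y := by
    rw [AlgEquiv.symm_apply_eq]
    exact (hγ y).symm
  refine ⟨η'.comp e.symm.toAlgHom, fun r ↦ ?_, fun j ↦ ?_⟩
  · change η' (e.symm _) = _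
    rw [← hβ', he, hη']
    exact congr($hη r)
  · change η' (e.symm _) = _
    rw [← hβz, he, hη', hηz]

lemma HasLocalBlowupProperty.exists_blowupCoordinates {x : ι₁ ⊕ ι₂ → R} (hx : IndepModSq k x)
    (h : HasLocalBlowupProperty R R' (Ideal.span (Set.range (x ∘ Sum.inl)))) {i₀ : ι₁}
    (ht : algebraMap R R' (x (.inl i₀)) ∈ nonZeroDivisors R')
    (hi₀ : (Ideal.span (Set.range (x ∘ Sum.inl))).map (algebraMap R R') =
      Ideal.span {algebraMap R R' (x (.inl i₀))}) :
    Algebra.FormallySmooth k R' ∧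
      ∃ c : BlowupCoordinates k R R' ι₁ ι₂, c.x = x ∧ c.i₀ = i₀ := by
  have hz (j) : ∃ z, algebraMap R R' (x (.inl j)) = algebraMap R R' (x (.inl i₀)) * z :=
    Ideal.mem_span_singleton.mp (hi₀ ▸ Ideal.mem_map_of_mem _ (Ideal.subset_span ⟨j, rfl⟩))
  choose z hz using hz
  have hzi₀ : z i₀ = 1 := by
    refine sub_eq_zero.mp (mem_nonZeroDivisors_iff_right.mp ht _ ?_)
    rw [sub_mul, mul_comm, ← hz, one_mul, sub_self]
  obtain ⟨hfs, hθ⟩ := h.exists_coordinates hx ht hzi₀ hz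
  refine ⟨hfs, ?_⟩
  obtain ⟨ev, hev⟩ := exists_evaluation k R'
  let evR : R →ₐ[k] k := ev.comp (IsScalarTower.toAlgHom k R R')
  have hmap (r) (hr : r ∈ maximalIdeal R) : algebraMap R R' r ∈ maximalIdeal R' :=
    fun hu ↦ hr (isUnit_of_map_unit (algebraMap R R') r hu)
  have hevR (r) (hr : r ∈ maximalIdeal R) : evR r = 0 := (hev _).mpr (hmap r hr)
  have hθ₁ (j : ι₁) : ∃ θ : R' →ₐ[k] DualNumber k,
      (j ≠ i₀ → ∀ l, (θ (z l)).snd = if j = l then 1 else 0) ∧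
      (j ≠ i₀ → ∀ r, (θ (algebraMap R R' r)).snd = 0) ∧
      (j = i₀ → (θ (algebraMap R R' (x (.inl i₀)))).snd = 1) := by
    by_cases hj : j = i₀
    -- The vector transverse to the exceptional divisor: the quotients `z` stay constant and the
    -- base point moves in the direction with coordinates the values of `z`.
    · obtain ⟨g, hgf, hgx⟩ := hx.exists_algHom_dualNumber evR hevR
        (Sum.elim (fun l ↦ ev (z l)) fun _ ↦ 0)
      obtain ⟨θ, hθr, -⟩ := hθ ev hev g (fun l ↦ TrivSqZeroExt.inl (ev (z l)))
        (by simp [hzi₀]) (fun l ↦ by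
          rw [hgx, hgx, Sum.elim_inl, Sum.elim_inl, hzi₀, map_one, TrivSqZeroExt.inr_mul_inl]
          simp)
        hgf fun l ↦ TrivSqZeroExt.fst_inl _ _
      refine ⟨θ, fun h ↦ absurd hj h, fun h ↦ absurd hj h, fun _ ↦ ?_⟩
      rw [hθr, hgx, Sum.elim_inl, hzi₀, map_one, TrivSqZeroExt.snd_inr]
    -- A vector in the fibre over the point: the base stays fixed and only the quotient `z j` moves.
    · obtain ⟨θ, hθr, hθz⟩ := hθ ev hev ((TrivSqZeroExt.inlAlgHom k k k).comp evR)
        (fun l ↦ TrivSqZeroExt.inl (ev (z l)) + TrivSqZeroExt.inr (if j = l then 1 else 0))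
        (by simp [hzi₀, hj]) (fun l ↦ by
          simp [hevR _ (hx.1 _)])
        (fun r ↦ TrivSqZeroExt.fst_inl _ _) fun l ↦ by
          rw [TrivSqZeroExt.fst_add, TrivSqZeroExt.fst_inl, TrivSqZeroExt.fst_inr, add_zero]
      refine ⟨θ, fun _ l ↦ ?_, fun _ r ↦ ?_, fun h ↦ absurd h hj⟩
      · rw [hθz, TrivSqZeroExt.snd_add, TrivSqZeroExt.snd_inl, TrivSqZeroExt.snd_inr, zero_add]
      · rw [hθr]
        exact TrivSqZeroExt.snd_inl _ _
  have hθ₂ (j : ι₂) : ∃ θ : R' →ₐ[k] DualNumber k,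
      (θ (algebraMap R R' (x (.inl i₀)))).snd = 0 ∧
      ∀ l, (θ (algebraMap R R' (x (.inr l)))).snd = if j = l then 1 else 0 := by
    -- A vector along the centre: the parameters of the centre and the quotients stay fixed, and
    -- only the `j`-th remaining parameter moves.
    obtain ⟨g, hgf, hgx⟩ := hx.exists_algHom_dualNumber evR hevR
      (Sum.elim (fun _ ↦ 0) fun l ↦ if j = l then 1 else 0)
    obtain ⟨θ, hθr, -⟩ := hθ ev hev g (fun l ↦ TrivSqZeroExt.inl (ev (z l)))
      (by simp [hzi₀]) (fun l ↦ by simp [hgx]) hgf fun l ↦ TrivSqZeroExt.fst_inl _ _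
    exact ⟨θ, by rw [hθr, hgx, TrivSqZeroExt.snd_inr, Sum.elim_inl],
      fun l ↦ by rw [hθr, hgx, TrivSqZeroExt.snd_inr, Sum.elim_inr]⟩
  choose θ₁ hθ₁ using hθ₁
  choose θ₂ hθ₂ using hθ₂
  exact ⟨{
    x := x
    x_mem := hx.1
    i₀ := i₀
    z := z
    map_x_inl := hz
    z_i₀ := hzi₀
    map_mem := hmap
    θ₁ := θ₁
    θ₁_z := fun j l hj _ ↦ (hθ₁ j).1 hj l
    θ₁_map := fun j hj r ↦ (hθ₁ j).2.1 hj r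
    θ₁_i₀ := (hθ₁ i₀).2.2 rfl
    θ₂ := θ₂
    θ₂_i₀ := fun j ↦ (hθ₂ j).1
    θ₂_inr := fun j l ↦ (hθ₂ j).2 l }, rfl, rfl⟩

end Coordinates

open IsLocalRing

/-! ### Independence and saturation in local rings. -/

section Algebra

variable {k R : Type*} [Field k] [CommRing R] [Algebra k R]

lemma IndepModSq.sumElim [IsRationalLocal k R] {ι₁ ι₂ : Type*} [Fintype ι₁] [Fintype ι₂]
    {x₁ : ι₁ → R} {x₂ : ι₂ → R} (h₁ : IndepModSq k x₁) (h₂ : IndepModSq k x₂)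
    (h : Disjoint (cot k (Ideal.span (Set.range x₁))) (cot k (Ideal.span (Set.range x₂)))) :
    IndepModSq k (Sum.elim x₁ x₂) := by
  rw [cot_span (Set.range_subset_iff.mpr h₁.1), cot_span (Set.range_subset_iff.mpr h₂.1),
    ← Set.range_comp, ← Set.range_comp] at h
  rw [indepModSq_iff_linearIndependent] at h₁ h₂ ⊢
  refine ⟨fun j ↦ by rcases j with j | j; exacts [h₁.1 j, h₂.1 j], ?_⟩
  convert! h₁.2.sum_type h₂.2 h using 1
  ext (j | j) <;> rfl

lemma disjoint_cot_iff [IsLocalRing R] {I J : Ideal R} :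
    Disjoint (cot k I) (cot k J) ↔
      (I ⊔ maximalIdeal R ^ 2) ⊓ (J ⊔ maximalIdeal R ^ 2) ≤ maximalIdeal R ^ 2 := by
  rw [Submodule.disjoint_def]
  constructor
  · intro h r hr
    exact Ideal.Quotient.eq_zero_iff_mem.mp (h _ (mk_mem_cot.mpr hr.1) (mk_mem_cot.mpr hr.2))
  · intro h z hz hz'
    obtain ⟨r, rfl⟩ := Ideal.Quotient.mk_surjective z
    exact Ideal.Quotient.eq_zero_iff_mem.mpr (h ⟨mk_mem_cot.mp hz, mk_mem_cot.mp hz'⟩)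

lemma disjoint_cot_span_singleton [IsRationalLocal k R] {t : R} {J : Ideal R}
    (ht : t ∈ maximalIdeal R) (h : t ∉ J ⊔ maximalIdeal R ^ 2) :
    Disjoint (cot k (Ideal.span {t})) (cot k J) := by
  rw [cot_span (Set.singleton_subset_iff.mpr ht), Set.image_singleton, disjoint_comm]
  have h1 : Ideal.Quotient.mkₐ k (maximalIdeal R ^ 2) t ∉ cot k J := fun h' ↦ h (mk_mem_cot.mp h')
  have h0 : Ideal.Quotient.mkₐ k (maximalIdeal R ^ 2) t ≠ 0 := fun h0 ↦ h1 (by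
    rw [h0]
    exact zero_mem _)
  exact (Submodule.disjoint_span_singleton' h0).mpr h1

/-- The saturation of a principal ideal with respect to a non-member of a prime ideal. -/
lemma exists_pow_mul_mem_span_singleton_iff {t f : R} (hf : IsUnit f ∨
    (Ideal.span {f}).IsPrime ∧ t ∉ Ideal.span {f}) {g : R} (hg : g = f ∨ g = t * f) (b : R) :
    (∃ n : ℕ, t ^ n * b ∈ Ideal.span {g}) ↔ b ∈ Ideal.span {f} := by
  constructor
  · rintro ⟨n, hn⟩
    rcases hf with hf | ⟨hf, ht⟩
    · rw [Ideal.span_singleton_eq_top.mpr hf]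
      trivial
    · have h1 : t ^ n * b ∈ Ideal.span {f} := by
        refine (Ideal.span_singleton_le_iff_mem _).mpr ?_ hn
        rcases hg with rfl | rfl
        · exact Ideal.mem_span_singleton_self g
        · exact Ideal.mul_mem_left _ _ (Ideal.mem_span_singleton_self f)
      exact (hf.mem_or_mem h1).resolve_left fun h2 ↦ ht (hf.mem_of_pow_mem n h2)
  · intro hb
    rcases hg with rfl | rfl
    · exact ⟨0, by simpa using hb⟩
    · obtain ⟨c, rfl⟩ := Ideal.mem_span_singleton'.mp hb
      exact ⟨1, Ideal.mem_span_singleton'.mpr ⟨c, by ring⟩⟩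

end Algebra

/-! ### Coordinates at a closed point of the blowup of a scheme. -/

section Exceptional

variable {k : Type u} [Field k] [IsAlgClosed k] {X X' : Scheme.{u}} [X.Over (Spec (.of k))]
  [X'.Over (Spec (.of k))] {π : X' ⟶ X} [π.IsOver (Spec (.of k))] {Z : X.IdealSheafData}

lemma IsBlowup.exists_blowupCoordinates [LocallyOfFiniteType (X ↘ Spec (.of k))]
    [LocallyOfFiniteType (X' ↘ Spec (.of k))] (hπ : IsBlowup π Z) {q : X'} (hq : IsClosed {q})
    (hp : IsClosed {π q}) [Algebra.FormallySmooth k (X.presheaf.stalk (π q))]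
    {ι₁ ι₂ : Type} [Fintype ι₁] [Fintype ι₂] [DecidableEq ι₁] [DecidableEq ι₂]
    {x : ι₁ ⊕ ι₂ → X.presheaf.stalk (π q)} (hx : IndepModSq k x)
    (hZ : Ideal.span (Set.range (x ∘ Sum.inl)) = stalkIdeal Z (π q)) :
    Algebra.FormallySmooth k (X'.presheaf.stalk q) ∧
      letI := (π.stalkMap q).hom.toAlgebra
      ∃ c : BlowupCoordinates k (X.presheaf.stalk (π q)) (X'.presheaf.stalk q) ι₁ ι₂,
        c.x = x ∧ stalkIdeal (exceptionalDivisor π Z) q =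
          Ideal.span {π.stalkMap q (c.x (.inl c.i₀))} := by
  let := (π.stalkMap q).hom.toAlgebra
  have := isRationalLocal_stalk (k := k) hq
  have := isRationalLocal_stalk (k := k) hp
  have : IsScalarTower k (X.presheaf.stalk (π q)) (X'.presheaf.stalk q) :=
    .of_algebraMap_eq fun c ↦ (stalkMap_algebraMap π q c).symm
  have : IsLocalHom (algebraMap (X.presheaf.stalk (π q)) (X'.presheaf.stalk q)) :=
    inferInstanceAs (IsLocalHom (π.stalkMap q).hom)
  have hprop : HasLocalBlowupProperty (X.presheaf.stalk (π q)) (X'.presheaf.stalk q)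
      (Ideal.span (Set.range (x ∘ Sum.inl))) := by
    intro B _ _ ρ γ _ s h1 h2 h3 h4 h5
    have : IsLocalHom (CommRingCat.ofHom γ).hom := ‹IsLocalHom γ›
    refine hπ.bijective_of_isLocalHom q (CommRingCat.ofHom ρ) (CommRingCat.ofHom γ)
      (CommRingCat.hom_ext h1) h2 (hZ ▸ h3) h4 fun f hf ↦ CommRingCat.hom_ext ?_
    exact h5 f.hom congr(($hf).hom)
  have hE : stalkIdeal (exceptionalDivisor π Z) q = Ideal.span (Set.range fun j ↦
      algebraMap (X.presheaf.stalk (π q)) (X'.presheaf.stalk q) (x (.inl j))) := by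
    rw [exceptionalDivisor, stalkIdeal_comap, ← hZ, Ideal.map_span, ← Set.range_comp]
    rfl
  obtain ⟨t, ht, htE⟩ := hπ.isEffectiveCartier.exists_stalkIdeal_eq q
  -- The index of the chart containing `q`: some generator of the centre generates the exceptional
  -- ideal there.
  obtain ⟨i₀, u, hu, hi₀⟩ := exists_span_singleton_eq ht (hE.symm.trans htE)
  have hspan : stalkIdeal (exceptionalDivisor π Z) q = Ideal.span {algebraMap
      (X.presheaf.stalk (π q)) (X'.presheaf.stalk q) (x (.inl i₀))} := by
    rw [htE, hi₀, Ideal.span_singleton_mul_left_unit hu]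
  have h0 : algebraMap (X.presheaf.stalk (π q)) (X'.presheaf.stalk q) (x (.inl i₀)) ∈
      nonZeroDivisors (X'.presheaf.stalk q) := by
    rw [hi₀]
    exact mul_mem_nonZeroDivisors.mpr ⟨hu.mem_nonZeroDivisors, ht⟩
  have hspan' : (Ideal.span (Set.range (x ∘ Sum.inl))).map (algebraMap (X.presheaf.stalk (π q))
      (X'.presheaf.stalk q)) = Ideal.span {algebraMap
      (X.presheaf.stalk (π q)) (X'.presheaf.stalk q) (x (.inl i₀))} := by
    rw [← hspan, exceptionalDivisor, stalkIdeal_comap, hZ]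
    rfl
  obtain ⟨h1, c, hcx, hci⟩ := hprop.exists_blowupCoordinates hx h0 hspan'
  refine ⟨h1, c, hcx, ?_⟩
  rw [hspan, hcx, hci]
  rfl

end Exceptional

open IsLocalRing

/-! ### Closed points and families of ideals. -/

section ClosedPoint

variable {k : Type u} [Field k] {X X' : Scheme.{u}} [X.Over (Spec (.of k))]
  {π : X' ⟶ X}

lemma span_image_eq_iSup {R ι : Type*} [CommRing R] (f : ι → R) (T : Set ι) :
    Ideal.span (f '' T) = ⨆ i ∈ T, Ideal.span {f i} := by
  refine le_antisymm (Ideal.span_le.mpr ?_) (iSup₂_le fun i hi ↦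
    Ideal.span_mono (Set.singleton_subset_iff.mpr ⟨i, hi, rfl⟩))
  rintro _ ⟨i, hi, rfl⟩
  exact le_iSup₂ (f := fun i (_ : i ∈ T) ↦ Ideal.span {f i}) i hi
    (Ideal.mem_span_singleton_self (f i))

lemma isClosed_singleton_map [LocallyOfFiniteType (X ↘ Spec (.of k))] [LocallyOfFiniteType π]
    {q : X'} (hq : IsClosed {q}) : IsClosed {π q} := by
  have := jacobsonSpace_of_over (k := k) (X := X)
  exact π.closePoints_subset_preimage_closedPoints hq

lemma stalkIdeal_sSup_image {Y : Scheme.{u}} (g : X.IdealSheafData → Y.IdealSheafData)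
    (T : Set X.IdealSheafData) (q : Y) :
    stalkIdeal (sSup (g '' T)) q = ⨆ D ∈ T, stalkIdeal (g D) q := by
  rw [stalkIdeal_sSup, iSup_image]

end ClosedPoint

/-! ### Strict transforms along the exceptional divisor. -/

section Exceptional

variable {k : Type u} [Field k] [IsAlgClosed k] {X X' : Scheme.{u}} [X.Over (Spec (.of k))]
  [X'.Over (Spec (.of k))] {π : X' ⟶ X} [π.IsOver (Spec (.of k))]

/-- The strict transforms at a point of the exceptional divisor. -/
theorem IsBlowup.strictTransform_of_mem_exceptionalDivisor [LocallyOfFiniteType π]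
    [LocallyOfFiniteType (X' ↘ Spec (.of k))] [IsLocallyNoetherian X']
    {S : Set X.IdealSheafData} (hS : IsLocalArrangement k S) (hfin : S.Finite)
    (hCart : ∀ D ∈ S, IsEffectiveCartier D) {C : Set X}
    (hC : Minimal (fun B ↦ B ∈ nonSplayedComponents S) C) (hπ : IsBlowup π (reducedIdeal C))
    {q : X'} (hq : IsClosed {q}) (hqC : π q ∈ C) :
    Algebra.FormallySmooth k (X'.presheaf.stalk q) ∧
    (∀ D ∈ S, ∃ f, stalkIdeal (strictTransform π (reducedIdeal C) D) q = Ideal.span {f}) ∧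
    ∃ t, stalkIdeal (exceptionalDivisor π (reducedIdeal C)) q = Ideal.span {t} ∧
      ∀ T ⊆ S, q ∈ (sSup (strictTransform π (reducedIdeal C) '' T)).support →
        Algebra.FormallySmooth k (X'.presheaf.stalk q ⧸
          stalkIdeal (sSup (strictTransform π (reducedIdeal C) '' T)) q) ∧
        Algebra.FormallySmooth k (X'.presheaf.stalk q ⧸
          (Ideal.span {t} ⊔ stalkIdeal (sSup (strictTransform π (reducedIdeal C) '' T)) q)) ∧
        t ∉ stalkIdeal (sSup (strictTransform π (reducedIdeal C) '' T)) q ⊔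
          maximalIdeal (X'.presheaf.stalk q) ^ 2 := by
  classical
  have := hS.locallyOfFiniteType
  have hp : IsClosed {π q} := isClosed_singleton_map (k := k) hq
  have := hS.isRationalLocal hp
  have := hS.formallySmooth_stalk hp
  have := isRationalLocal_stalk (k := k) hq
  obtain ⟨hCp, hdisj⟩ := hS.minimal_nonSplayed hfin hC hqC hp
  set S₁ : Set X.IdealSheafData := {D ∈ S | C ⊆ D.support}
  set S₂ : Set X.IdealSheafData := {D ∈ S | π q ∈ D.support ∧ ¬ C ⊆ D.support}
  have hp₁ : π q ∈ (sSup S₁).support := mem_support_sSup.mpr fun D hD ↦ hD.2 hqC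
  have hp₂ : π q ∈ (sSup S₂).support := mem_support_sSup.mpr fun D hD ↦ hD.2.1
  have := hS.formallySmooth S₁ (fun D hD ↦ hD.1) (π q) hp₁ hp
  have := hS.formallySmooth S₂ (fun D hD ↦ hD.1) (π q) hp₂ hp
  obtain ⟨n₁, x₁, hx₁, hxs₁⟩ := exists_indepModSq_span_eq' (k := k)
    (mem_support_iff_stalkIdeal_le.mp hp₁)
  obtain ⟨n₂, x₂, hx₂, hxs₂⟩ := exists_indepModSq_span_eq' (k := k)
    (mem_support_iff_stalkIdeal_le.mp hp₂)
  rw [← hxs₁, ← hxs₂] at hdisj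
  obtain ⟨hfs, c, hcx, hcE⟩ := hπ.exists_blowupCoordinates hq hp (hx₁.sumElim hx₂ hdisj)
    (by rw [Sum.elim_comp_inl, hxs₁, hCp])
  let := (π.stalkMap q).hom.toAlgebra
  have : IsScalarTower k (X.presheaf.stalk (π q)) (X'.presheaf.stalk q) :=
    .of_algebraMap_eq fun c ↦ (stalkMap_algebraMap π q c).symm
  refine ⟨hfs, ?_⟩
  let ι := {D : X.IdealSheafData // D ∈ S ∧ π q ∈ D.support}
  have : Finite ι := Set.Finite.to_subtype
    (hfin.subset (t := {D | D ∈ S ∧ π q ∈ D.support}) fun D hD ↦ hD.1)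
  have hfex (i : ι) : ∃ f : (X.presheaf.stalk (π q)), stalkIdeal i.1 (π q) = Ideal.span {f} := by
    obtain ⟨f, -, hf⟩ := (hCart i.1 i.2.1).exists_stalkIdeal_eq (π q)
    exact ⟨f, hf⟩
  choose f hf using hfex
  have hfm (i : ι) : f i ∈ maximalIdeal (X.presheaf.stalk (π q)) :=
    mem_support_iff_stalkIdeal_le.mp i.2.2 (hf i ▸ Ideal.mem_span_singleton_self (f i))
  let K : Set ι := {i | C ⊆ i.1.support}
  have hfx₁ (i : ι) (hi : i ∈ K) : f i ∈ Ideal.span (Set.range fun j ↦ c.x (.inl j)) := by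
    have h1 : (Set.range fun j ↦ c.x (.inl j)) = Set.range x₁ := by rw [hcx]; rfl
    rw [h1, hxs₁]
    refine stalkIdeal_mono (le_sSup (a := i.1) (show i.1 ∈ S₁ from ⟨i.2.1, hi⟩)) (π q) ?_
    exact hf i ▸ Ideal.mem_span_singleton_self (f i)
  have hfx₂ (i : ι) (hi : i ∉ K) : f i ∈ Ideal.span (Set.range fun j ↦ c.x (.inr j)) := by
    have h1 : (Set.range fun j ↦ c.x (.inr j)) = Set.range x₂ := by rw [hcx]; rfl
    rw [h1, hxs₂]
    refine stalkIdeal_mono (le_sSup (a := i.1) (show i.1 ∈ S₂ from ⟨i.2.1, i.2.2, hi⟩)) (π q) ?_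
    exact hf i ▸ Ideal.mem_span_singleton_self (f i)
  have hspan (T : Set ι) : Ideal.span (f '' T) = stalkIdeal (sSup (Subtype.val '' T)) (π q) := by
    rw [stalkIdeal_sSup, iSup_image, span_image_eq_iSup]
    exact iSup_congr fun i ↦ iSup_congr fun _ ↦ (hf i).symm
  have hfsT (T : Set ι) : Algebra.FormallySmooth k ((X.presheaf.stalk (π q)) ⧸ Ideal.span (f '' T)) := by
    rw [hspan]
    refine hS.formallySmooth _ ?_ (π q) (mem_support_sSup.mpr ?_) hp
    · rintro _ ⟨i, -, rfl⟩
      exact i.2.1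
    · rintro _ ⟨i, -, rfl⟩
      exact i.2.2
  have hf'ex (i : ι) : ∃ f' : (X'.presheaf.stalk q),
      (i ∈ K → algebraMap (X.presheaf.stalk (π q)) (X'.presheaf.stalk q) (f i) = c.t * f') ∧
      (i ∉ K → f' = algebraMap (X.presheaf.stalk (π q)) (X'.presheaf.stalk q) (f i)) := by
    by_cases hi : i ∈ K
    · have h1 : algebraMap (X.presheaf.stalk (π q)) (X'.presheaf.stalk q) (f i) ∈
          stalkIdeal (exceptionalDivisor π (reducedIdeal C)) q := by
        rw [exceptionalDivisor, stalkIdeal_comap]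
        refine Ideal.mem_map_of_mem _ ?_
        rw [hCp]
        exact stalkIdeal_mono (le_sSup (a := i.1) (show i.1 ∈ S₁ from ⟨i.2.1, hi⟩)) (π q)
          (hf i ▸ Ideal.mem_span_singleton_self (f i))
      rw [hcE] at h1
      obtain ⟨f', hf'⟩ := Ideal.mem_span_singleton.mp h1
      exact ⟨f', fun _ ↦ hf', fun h ↦ absurd hi h⟩
    · exact ⟨_, fun h ↦ absurd h hi, fun _ ↦ rfl⟩
  choose f' hf'₁ hf'₂ using hf'ex
  have key (T : Set ι) (hT : ∀ i ∈ T, f' i ∈ maximalIdeal (X'.presheaf.stalk q)) :=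
    c.strictTransform_formallySmooth hfm (fun T _ ↦ hfsT T) hfx₁ hfx₂ hf'₁ hf'₂ hT
  -- The pulled back equation is `f'` or `t * f'`. Since `f'` is a unit or generates a prime ideal
  -- not containing `t`, removing powers of `t` leaves exactly `(f')`.
  have hstrict (i : ι) : stalkIdeal (strictTransform π (reducedIdeal C) i.1) q =
      Ideal.span {f' i} := by
    ext b
    rw [mem_stalkIdeal_strictTransform_iff i.1 hπ.isEffectiveCartier hcE]
    have h1 : (stalkIdeal i.1 (π q)).map (π.stalkMap q).hom =
        Ideal.span {algebraMap (X.presheaf.stalk (π q)) (X'.presheaf.stalk q) (f i)} := by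
      refine (congrArg (Ideal.map (π.stalkMap q).hom) (hf i)).trans ?_
      rw [Ideal.map_span, Set.image_singleton]
      rfl
    rw [h1]
    refine exists_pow_mul_mem_span_singleton_iff (t := c.t) ?_ ?_ b
    · by_cases hu : IsUnit (f' i)
      · exact .inl hu
      · have h2 := key {i} (by simpa using hu)
        rw [Set.image_singleton] at h2
        have := h2.1
        refine .inr ⟨isPrime_of_formallySmooth (k := k)
          ((Ideal.span_singleton_le_iff_mem _).mpr hu), fun h3 ↦ h2.2.2 (Ideal.mem_sup_left h3)⟩
    · by_cases hi : i ∈ K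
      · exact .inr (hf'₁ i hi)
      · exact .inl (hf'₂ i hi).symm
  have hstrict' (D : X.IdealSheafData) (hD : π q ∉ D.support) :
      stalkIdeal (strictTransform π (reducedIdeal C) D) q = ⊤ := by
    refine (Ideal.eq_top_iff_one _).mpr ?_
    rw [mem_stalkIdeal_strictTransform_iff D hπ.isEffectiveCartier hcE]
    have h1 : stalkIdeal D (π q) = ⊤ := stalkIdeal_eq_top_iff.mpr hD
    exact ⟨0, by rw [h1, Ideal.map_top]; trivial⟩
  refine ⟨fun D hD ↦ ?_, c.t, hcE, fun T hT hqT ↦ ?_⟩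
  · by_cases hpD : π q ∈ D.support
    · exact ⟨_, hstrict ⟨D, hD, hpD⟩⟩
    · exact ⟨1, by rw [hstrict' D hpD, Ideal.span_singleton_one]⟩
  · have hqT' (D) (hD : D ∈ T) : q ∈ (strictTransform π (reducedIdeal C) D).support :=
      mem_support_sSup.mp hqT _ ⟨D, hD, rfl⟩
    have hTp (D) (hD : D ∈ T) : π q ∈ D.support := by
      by_contra h
      exact stalkIdeal_eq_top_iff.mp (hstrict' D h) (hqT' D hD)
    have h1 : stalkIdeal (sSup (strictTransform π (reducedIdeal C) '' T)) q =
        Ideal.span (f' '' {i | i.1 ∈ T}) := by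
      rw [stalkIdeal_sSup_image, span_image_eq_iSup]
      refine le_antisymm (iSup₂_le fun D hD ↦ ?_) (iSup₂_le fun i hi ↦ ?_)
      · rw [hstrict ⟨D, hT hD, hTp D hD⟩]
        exact le_iSup₂_of_le (⟨D, hT hD, hTp D hD⟩ : ι) hD le_rfl
      · rw [← hstrict i]
        exact le_iSup₂_of_le i.1 hi le_rfl
    rw [h1]
    refine key _ fun i hi ↦ ?_
    exact mem_support_iff_stalkIdeal_le.mp (hqT' i.1 hi)
      (hstrict i ▸ Ideal.mem_span_singleton_self (f' i))

end Exceptional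

open IsLocalRing

/-! ### Strict transforms away from the centre. -/

section AwayFromCentre

lemma disjoint_cot_map {k R R' : Type*} [Field k] [CommRing R] [CommRing R'] [Algebra k R]
    [Algebra k R'] [IsLocalRing R] [IsLocalRing R'] (e : R ≃ₐ[k] R') {I J : Ideal R}
    (h : Disjoint (cot k I) (cot k J)) :
    Disjoint (cot k (I.map (e : R →+* R'))) (cot k (J.map (e : R →+* R'))) := by
  have hm : (maximalIdeal R).map (e : R →+* R') = maximalIdeal R' := by
    ext y
    refine (Ideal.mem_map_of_equiv e y).trans ⟨?_, fun hy ↦ ⟨e.symm y, ?_, e.apply_symm_apply y⟩⟩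
    · rintro ⟨x, hx, rfl⟩
      simpa [mem_maximalIdeal, mem_nonunits_iff] using hx
    · simpa [mem_maximalIdeal, mem_nonunits_iff] using hy
  rw [disjoint_cot_iff, ← hm, ← Ideal.map_pow, ← Ideal.map_sup, ← Ideal.map_sup]
  rw [disjoint_cot_iff] at h
  rintro y ⟨h1, h2⟩
  obtain ⟨x, hx, rfl⟩ := (Ideal.mem_map_of_equiv e y).mp h1
  obtain ⟨x', hx', hxx'⟩ := (Ideal.mem_map_of_equiv e (e x)).mp h2
  obtain rfl := e.injective hxx'
  exact Ideal.mem_map_of_mem _ (h ⟨hx, hx'⟩)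

variable {X X' : Scheme.{u}} {π : X' ⟶ X} {Z : X.IdealSheafData}

lemma IsBlowup.stalkIdeal_sSup_strictTransform [IsLocallyNoetherian X'] (hπ : IsBlowup π Z)
    {q : X'} (hq : π q ∉ Z.support) (T : Set X.IdealSheafData) :
    stalkIdeal (sSup (strictTransform π Z '' T)) q =
      (stalkIdeal (sSup T) (π q)).map (π.stalkMap q).hom := by
  rw [stalkIdeal_sSup_image, stalkIdeal_sSup]
  simp_rw [Ideal.map_iSup]
  exact iSup_congr fun D ↦ iSup_congr fun _ ↦ stalkIdeal_strictTransform_of_notMem D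
    hπ.isEffectiveCartier fun h ↦ hq ((mem_support_comap π).mp h)

lemma IsBlowup.mem_support_sSup_strictTransform [IsLocallyNoetherian X'] (hπ : IsBlowup π Z)
    {q : X'} (hq : π q ∉ Z.support) (T : Set X.IdealSheafData) :
    q ∈ (sSup (strictTransform π Z '' T)).support ↔ π q ∈ (sSup T).support := by
  rw [← mem_support_comap π, ← not_iff_not, ← stalkIdeal_eq_top_iff, ← stalkIdeal_eq_top_iff,
    stalkIdeal_comap, hπ.stalkIdeal_sSup_strictTransform hq]

variable {k : Type u} [Field k] [X.Over (Spec (.of k))] [X'.Over (Spec (.of k))]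
  [π.IsOver (Spec (.of k))]

variable (k) in
/-- Away from the centre a blowup induces isomorphisms of local rings. -/
def IsBlowup.stalkEquiv (hπ : IsBlowup π Z) {q : X'} (hq : π q ∉ Z.support) :
    X.presheaf.stalk (π q) ≃ₐ[k] X'.presheaf.stalk q :=
  have := hπ.isIso_stalkMap hq
  AlgEquiv.ofRingEquiv (f := (asIso (π.stalkMap q)).commRingCatIsoToRingEquiv)
    fun c ↦ stalkMap_algebraMap π q c

lemma IsBlowup.coe_stalkEquiv (hπ : IsBlowup π Z) {q : X'} (hq : π q ∉ Z.support) :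
    (hπ.stalkEquiv k hq : X.presheaf.stalk (π q) →+* X'.presheaf.stalk q) =
      (π.stalkMap q).hom := rfl

lemma IsBlowup.formallySmooth_quotient (hπ : IsBlowup π Z) {q : X'} (hq : π q ∉ Z.support)
    (J : Ideal (X.presheaf.stalk (π q)))
    [Algebra.FormallySmooth k (X.presheaf.stalk (π q) ⧸ J)] :
    Algebra.FormallySmooth k (X'.presheaf.stalk q ⧸ J.map (π.stalkMap q).hom) :=
  .of_equiv (Ideal.quotientEquivAlg J (J.map (π.stalkMap q).hom) (hπ.stalkEquiv k hq) rfl)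

lemma IsBlowup.isSplayedAt_strictTransform [IsAlgClosed k] [LocallyOfFiniteType π]
    [LocallyOfFiniteType (X ↘ Spec (.of k))] [LocallyOfFiniteType (X' ↘ Spec (.of k))]
    [IsLocallyNoetherian X'] (hπ : IsBlowup π Z) {q : X'} (hqc : IsClosed {q})
    (hq : π q ∉ Z.support) {T : Set X.IdealSheafData} (hT : π q ∈ (sSup T).support)
    (h : IsSplayedAt T (π q)) : IsSplayedAt (strictTransform π Z '' T) q := by
  rw [isSplayedAt_iff_disjoint (k := k) (isClosed_singleton_map (k := k) hqc) hT] at h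
  obtain ⟨S₁, S₂, h1, h2, rfl, h3⟩ := h
  refine (isSplayedAt_iff_disjoint (k := k) hqc
    ((hπ.mem_support_sSup_strictTransform hq _).mpr hT)).mpr
    ⟨strictTransform π Z '' S₁, strictTransform π Z '' S₂, h1.image _, h2.image _,
      Set.image_union _ _ _, ?_⟩
  rw [hπ.stalkIdeal_sSup_strictTransform hq, hπ.stalkIdeal_sSup_strictTransform hq,
    ← hπ.coe_stalkEquiv (k := k) hq]
  exact disjoint_cot_map _ h3

end AwayFromCentre

open IsLocalRing

/-! ### Generic points and nonvanishing of strict transforms. -/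

section GenericPoint

variable {X X' : Scheme.{u}} {π : X' ⟶ X} {Z : X.IdealSheafData}

lemma IsEffectiveCartier.genericPoint_notMem [IsIntegral X] {D : X.IdealSheafData}
    (hD : IsEffectiveCartier D) : genericPoint X ∉ D.support := by
  obtain ⟨t, ht, h⟩ := hD.exists_stalkIdeal_eq (genericPoint X)
  rw [← stalkIdeal_eq_top_iff, h, Ideal.span_singleton_eq_top]
  exact (isUnit_iff_ne_zero (G₀ := X.functionField)).mpr (nonZeroDivisors.ne_zero ht)

lemma IsBlowup.exists_map_eq (hπ : IsBlowup π Z) {p : X} (hp : p ∉ Z.support) :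
    ∃ q, π q = p := by
  have h : p ∈ Set.range ((exceptionalCompl π Z).ι ≫ π) := hπ.isOpenImmersion_restrict.2 ▸ hp
  obtain ⟨q, hq⟩ := h
  exact ⟨q.1, hq⟩

lemma IsBlowup.specializes_of_map (hπ : IsBlowup π Z) {q y : X'} (hq : π q ∉ Z.support)
    (h : π y ⤳ π q) : y ⤳ q := by
  have hy : π y ∉ Z.support := fun hy ↦ hq (h.mem_closed Z.support.isClosed hy)
  have := hπ.isOpenImmersion_restrict.1
  have h1 := ((exceptionalCompl π Z).ι ≫ π).isOpenEmbedding.isInducing.specializes_iff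
    (x := ⟨y, fun h ↦ hy ((mem_support_comap π).mp h)⟩)
    (y := ⟨q, fun h ↦ hq ((mem_support_comap π).mp h)⟩)
  exact (h1.mp h).map (exceptionalCompl π Z).ι.continuous

/-- It is enough to look at the generic point, which lies off the exceptional divisor, so that the
strict transform there is the inverse image of `D` under an isomorphism of local rings. -/
lemma IsBlowup.stalkIdeal_strictTransform_ne_bot [IsIntegral X'] [IsLocallyNoetherian X']
    (hπ : IsBlowup π Z) {D : X.IdealSheafData} (hD : IsEffectiveCartier D) (q : X') :
    stalkIdeal (strictTransform π Z D) q ≠ ⊥ := by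
  intro h
  have h0 := hπ.isEffectiveCartier.genericPoint_notMem
  have h1 : stalkIdeal (strictTransform π Z D) (genericPoint X') = ⊥ := by
    rw [stalkIdeal_of_specializes _ (genericPoint_specializes q), h]
    exact Ideal.map_bot
  rw [stalkIdeal_strictTransform_of_notMem D hπ.isEffectiveCartier h0] at h1
  have := hπ.isIso_stalkMap (q := genericPoint X') fun h ↦ h0 ((mem_support_comap π).mpr h)
  obtain ⟨t, ht, h2⟩ := hD.exists_stalkIdeal_eq (π (genericPoint X'))
  have h3 : π.stalkMap (genericPoint X') t = 0 := by
    rw [← Ideal.mem_bot, ← h1]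
    exact Ideal.mem_map_of_mem _ (h2 ▸ Ideal.mem_span_singleton_self t)
  have h4 := (asIso (π.stalkMap (genericPoint X'))).commRingCatIsoToRingEquiv.injective
    (h3.trans (map_zero _).symm)
  have : Nontrivial (X.presheaf.stalk (π (genericPoint X'))) := inferInstance
  exact nonZeroDivisors.ne_zero ht h4

end GenericPoint

/-! ### The transformed arrangement and its non-splayed components. -/

section Transform

variable {k : Type u} [Field k] [IsAlgClosed k] {X X' : Scheme.{u}} [X.Over (Spec (.of k))]
  [X'.Over (Spec (.of k))] {π : X' ⟶ X} [π.IsOver (Spec (.of k))] [LocallyOfFiniteType π]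
  [LocallyOfFiniteType (X' ↘ Spec (.of k))] [IsLocallyNoetherian X'] [IsIntegral X']
  {S : Set X.IdealSheafData} (hS : IsArrangement (X ↘ Spec (.of k)) S) {C : Set X}
  (hC : Minimal (fun B ↦ B ∈ nonSplayedComponents S) C) (hπ : IsBlowup π (reducedIdeal C))

omit [IsAlgClosed k] [X.Over (Spec (.of k))] in
lemma mem_support_reducedIdeal_iff {S : Set X.IdealSheafData} {C : Set X}
    (hC : C ∈ nonSplayedComponents S) {p : X} :
    p ∈ (reducedIdeal C).support ↔ p ∈ C := by
  obtain ⟨I, -, -, hI, -⟩ := hC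
  rw [← SetLike.mem_coe, support_reducedIdeal, hI.isClosed.closure_eq]

include hS hC hπ

omit [IsIntegral X'] in
lemma IsBlowup.formallySmooth_strictTransform {q : X'} (hq : IsClosed {q})
    {T : Set X.IdealSheafData} (hT : T ⊆ S)
    (hqT : q ∈ (sSup (strictTransform π (reducedIdeal C) '' T)).support) :
    Algebra.FormallySmooth k (X'.presheaf.stalk q ⧸
      stalkIdeal (sSup (strictTransform π (reducedIdeal C) '' T)) q) := by
  have hSl := hS.isLocalArrangement
  have := hSl.locallyOfFiniteType
  by_cases hqC : π q ∈ C
  · obtain ⟨-, -, t, -, h⟩ := hπ.strictTransform_of_mem_exceptionalDivisor hSl hS.finite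
      hS.isEffectiveCartier hC hq hqC
    exact (h T hT hqT).1
  · rw [← mem_support_reducedIdeal_iff hC.prop] at hqC
    rw [hπ.mem_support_sSup_strictTransform hqC] at hqT
    rw [hπ.stalkIdeal_sSup_strictTransform hqC]
    have := hSl.formallySmooth T hT _ hqT (isClosed_singleton_map (k := k) hq)
    exact hπ.formallySmooth_quotient hqC _

lemma IsBlowup.isLocalArrangement_strictTransform :
    IsLocalArrangement k (strictTransform π (reducedIdeal C) '' S) where
  locallyOfFiniteType := inferInstance
  formallySmooth T' hT' q hq hqc := by
    obtain ⟨T, hT, rfl⟩ := Set.subset_image_iff.mp hT'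
    exact hπ.formallySmooth_strictTransform hS hC hqc hT hq
  ne_bot := by
    rintro _ ⟨D, hD, rfl⟩ q
    exact hπ.stalkIdeal_strictTransform_ne_bot (hS.isEffectiveCartier D hD) q

lemma IsBlowup.isEffectiveCartier_strictTransform {D : X.IdealSheafData} (hD : D ∈ S) :
    IsEffectiveCartier (strictTransform π (reducedIdeal C) D) := by
  have hSl := hS.isLocalArrangement
  have := hSl.locallyOfFiniteType
  refine isEffectiveCartier_of_stalkIdeal (k := k) fun q hq ↦ ?_
  suffices h : ∃ f, stalkIdeal (strictTransform π (reducedIdeal C) D) q = Ideal.span {f} by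
    obtain ⟨f, hf⟩ := h
    refine ⟨f, ?_, hf⟩
    rintro rfl
    exact hπ.stalkIdeal_strictTransform_ne_bot (hS.isEffectiveCartier D hD) q
      (by rw [hf, Ideal.span_singleton_eq_bot])
  by_cases hqC : π q ∈ C
  · obtain ⟨-, h, -⟩ := hπ.strictTransform_of_mem_exceptionalDivisor hSl hS.finite
      hS.isEffectiveCartier hC hq hqC
    exact h D hD
  · rw [← mem_support_reducedIdeal_iff hC.prop, ← mem_support_comap π] at hqC
    obtain ⟨t, -, ht⟩ := (hS.isEffectiveCartier D hD).exists_stalkIdeal_eq (π q)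
    refine ⟨π.stalkMap q t, ?_⟩
    rw [stalkIdeal_strictTransform_of_notMem D hπ.isEffectiveCartier hqC]
    refine (congrArg (Ideal.map (π.stalkMap q).hom) ht).trans ?_
    rw [Ideal.map_span, Set.image_singleton]

omit [IsIntegral X'] in
lemma IsBlowup.smooth_intersection {T' : Set X'.IdealSheafData}
    (hT' : T' ⊆ insert (exceptionalDivisor π (reducedIdeal C))
      (strictTransform π (reducedIdeal C) '' S)) :
    Smooth ((sSup T').subschemeι ≫ (X' ↘ Spec (.of k))) := by
  have hSl := hS.isLocalArrangement
  have := hSl.locallyOfFiniteType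
  refine (smooth_subscheme_iff _).mpr fun q hqT hq ↦ ?_
  by_cases hE : exceptionalDivisor π (reducedIdeal C) ∈ T'
  · have hqC : π q ∈ C := (mem_support_reducedIdeal_iff hC.prop).mp
      ((mem_support_comap π).mp (mem_support_sSup.mp hqT _ hE))
    obtain ⟨T, hT, h1⟩ := Set.subset_image_iff.mp (Set.sdiff_singleton_subset_iff.mpr hT')
    obtain ⟨-, -, t, ht, h⟩ := hπ.strictTransform_of_mem_exceptionalDivisor hSl hS.finite
      hS.isEffectiveCartier hC hq hqC
    have h2 : q ∈ (sSup (strictTransform π (reducedIdeal C) '' T)).support := by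
      rw [h1]
      exact mem_support_sSup.mpr fun D hD ↦ mem_support_sSup.mp hqT D hD.1
    have h3 : stalkIdeal (sSup T') q =
        Ideal.span {t} ⊔ stalkIdeal (sSup (strictTransform π (reducedIdeal C) '' T)) q := by
      have h4 : T' = insert (exceptionalDivisor π (reducedIdeal C))
          (strictTransform π (reducedIdeal C) '' T) := by
        rw [h1, Set.insert_sdiff_singleton, Set.insert_eq_of_mem hE]
      rw [h4, ← ht, stalkIdeal_sSup, stalkIdeal_sSup, iSup_insert]
    rw [h3]
    exact (h T hT h2).2.1
  · obtain ⟨T, hT, rfl⟩ := Set.subset_image_iff.mp ((Set.subset_insert_iff_of_notMem hE).mp hT')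
    exact hπ.formallySmooth_strictTransform hS hC hq hT hqT

omit [IsIntegral X'] in
-- The decomposition is `E` against all of `U`: the equation `t` is not in the ideal of `⋂ U` modulo
-- `𝔪²`, so its line meets that cotangent image only in zero.
lemma IsBlowup.isSplayed_insert_exceptionalDivisor {U : Set X'.IdealSheafData}
    (hU : U ⊆ strictTransform π (reducedIdeal C) '' S) (hUn : U.Nonempty) :
    IsSplayed (insert (exceptionalDivisor π (reducedIdeal C)) U) := by
  intro q hqU hq
  obtain ⟨T, hT, rfl⟩ := Set.subset_image_iff.mp hU
  have hqE : q ∈ (exceptionalDivisor π (reducedIdeal C)).support :=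
    mem_support_sSup.mp hqU _ (Set.mem_insert _ _)
  have hqC : π q ∈ C := (mem_support_reducedIdeal_iff hC.prop).mp ((mem_support_comap π).mp hqE)
  obtain ⟨-, -, t, ht, h⟩ := hπ.strictTransform_of_mem_exceptionalDivisor hS.isLocalArrangement
    hS.finite hS.isEffectiveCartier hC hq hqC
  have h2 : q ∈ (sSup (strictTransform π (reducedIdeal C) '' T)).support :=
    mem_support_sSup.mpr fun D hD ↦ mem_support_sSup.mp hqU D (Set.mem_insert_of_mem _ hD)
  have := isRationalLocal_stalk (k := k) hq
  refine (isSplayedAt_iff_disjoint (k := k) hq hqU).mpr ⟨{exceptionalDivisor π (reducedIdeal C)},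
    strictTransform π (reducedIdeal C) '' T, Set.singleton_nonempty _, hUn, rfl, ?_⟩
  rw [sSup_singleton, ht]
  exact disjoint_cot_span_singleton (mem_support_iff_stalkIdeal_le.mp hqE
    (ht ▸ Ideal.mem_span_singleton_self t)) (h T hT h2).2.2

/-- A non-splayed component of the strict transforms is the strict transform of a non-splayed
component. -/
lemma IsBlowup.exists_nonSplayedComponent {C' : Set X'}
    (hC' : C' ∈ nonSplayedComponents (strictTransform π (reducedIdeal C) '' S)) :
    ∃ y, closure {y} = C' ∧ π y ∉ C ∧ closure {π y} ∈ nonSplayedComponents S := by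
  have hSl := hS.isLocalArrangement
  have := hSl.locallyOfFiniteType
  have hS' := hπ.isLocalArrangement_strictTransform hS hC
  obtain ⟨I', hI'S, hI'n, hcomp, hns⟩ := hC'
  obtain ⟨I, hI, rfl⟩ := Set.subset_image_iff.mp hI'S
  have hIn : I.Nonempty := Set.image_nonempty.mp hI'n
  have hCc : IsClosed C := by
    obtain ⟨J, -, -, hJ, -⟩ := hC.prop
    exact hJ.isClosed
  have hC'c := hcomp.isClosed
  set y := hcomp.prop.1.genericPoint with hy
  have hyC' : closure {y} = C' := by
    rw [hcomp.prop.1.genericPoint_closure_eq, hC'c.closure_eq]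
  have hymem : y ∈ C' := hyC' ▸ subset_closure rfl
  -- If the generic point lay over `C`, the whole component would lie in `E`. At a closed point of
  -- it `t` would then belong to the prime ideal of the intersection, against transversality.
  have hyC : π y ∉ C := by
    intro hyC
    obtain ⟨q, hyq, hq⟩ := exists_isClosed_specializes (k := k) y
    have hqC' : q ∈ C' := hyq.mem_closed hC'c hymem
    have hqC : π q ∈ C := (hyq.map π.continuous).mem_closed hCc hyC
    obtain ⟨-, -, t, ht, h⟩ := hπ.strictTransform_of_mem_exceptionalDivisor hSl
      hS.finite hS.isEffectiveCartier hC hq hqC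
    have h1 := hcomp.prop.2 hqC'
    have h2 : C' ⊆ (exceptionalDivisor π (reducedIdeal C)).support := by
      rw [← hyC']
      refine closure_minimal (Set.singleton_subset_iff.mpr ?_) (Closeds.isClosed _)
      exact (mem_support_comap π).mpr ((mem_support_reducedIdeal_iff hC.prop).mpr hyC)
    rw [hcomp.subset_support_iff (hS'.isPrime hq hI'S h1) hqC', ht,
      Ideal.span_singleton_le_iff_mem] at h2
    exact (h I hI h1).2.2 (Ideal.mem_sup_left h2)
  have := jacobsonSpace_of_over (k := k) (X := X')
  -- A closed point of the component off `E`; non-splayedness can be transported to `π q` there.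
  obtain ⟨q, ⟨hqC', hqC⟩, hq⟩ := nonempty_inter_closedPoints (Z := C' ∩ (π ⁻¹' C)ᶜ)
    ⟨y, hymem, hyC⟩ (hC'c.isLocallyClosed.inter
      (hCc.preimage π.continuous).isOpen_compl.isLocallyClosed)
  replace hqC : π q ∉ C := hqC
  have hqZ : π q ∉ (reducedIdeal C).support := (mem_support_reducedIdeal_iff hC.prop).not.mpr hqC
  have hyZ : π y ∉ (reducedIdeal C).support := (mem_support_reducedIdeal_iff hC.prop).not.mpr hyC
  have hp := isClosed_singleton_map (k := k) hq (π := π)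
  have hpI := (hπ.mem_support_sSup_strictTransform hqZ I).mp (hcomp.prop.2 hqC')
  have hyq : y ⤳ q := specializes_iff_mem_closure.mpr (hyC' ▸ hqC')
  have hnsp : ¬ IsSplayedAt I (π q) := fun h ↦
    hS'.not_isSplayedAt_of_not_isSplayedAlong hI'S hcomp.prop.1 hcomp.prop.2 hns hqC' hq
      (hπ.isSplayedAt_strictTransform (k := k) hq hqZ hpI h)
  have hprime := hSl.isPrime hp hI hpI
  -- The component of `⋂ I` through `π q` has generic point `z`, which lifts to `z'` off `E`. Since
  -- `z'` specializes to `y` and lies on the strict transforms, maximality of `C'` puts `z'` in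
  -- `C'`; so `π y` and `z` have the same closure.
  set z := localGenericPoint (sSup I) (π q) hprime
  have hzp : z ⤳ π q := localGenericPoint_specializes hprime
  have hzcomp : IsComponent (sSup I) (closure {z}) := isComponent_closure_localGenericPoint hprime
  have hzZ : z ∉ (reducedIdeal C).support := fun h ↦ hqZ (hzp.mem_closed (Closeds.isClosed _) h)
  obtain ⟨z', hz'⟩ := hπ.exists_map_eq hzZ
  have hyI : π y ∈ (sSup I).support :=
    (hπ.mem_support_sSup_strictTransform hyZ I).mp (hcomp.prop.2 hymem)
  have hzy : z ⤳ π y := specializes_iff_mem_closure.mpr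
    (subset_closure_localGenericPoint hprime isIrreducible_singleton.closure
      (hyq.map π.continuous).mem_closure
      (closure_minimal (Set.singleton_subset_iff.mpr hyI) (Closeds.isClosed _))
      (subset_closure rfl))
  have hz'y : z' ⤳ y := hπ.specializes_of_map hyZ (hz' ▸ hzy)
  have hz'I : z' ∈ (sSup (strictTransform π (reducedIdeal C) '' I)).support :=
    (hπ.mem_support_sSup_strictTransform (hz' ▸ hzZ) I).mpr
      (hz' ▸ hzcomp.prop.2 (subset_closure rfl))
  have hz'C' : z' ∈ C' := hcomp.2
    ⟨isIrreducible_singleton.closure, closure_minimal (Set.singleton_subset_iff.mpr hz'I)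
      (Closeds.isClosed _)⟩ (hyC' ▸ hz'y.closure_subset) (subset_closure rfl)
  have hyz : π y ⤳ z := hz' ▸ (specializes_iff_mem_closure.mpr (hyC' ▸ hz'C')).map π.continuous
  have heq : closure {π y} = closure {z} := hzy.closure_subset.antisymm hyz.closure_subset
  refine ⟨y, hyC', hyC, I, hI, hIn, heq ▸ hzcomp, fun h ↦ hnsp (h _ ?_ hp)⟩
  exact (hyq.map π.continuous).mem_closure

/-- Closure of the image is an injection into the non-splayed components of `S` other than `C`: it
is determined by a generic point off `E`, where `π` is injective. -/
lemma IsBlowup.encard_nonSplayedComponents_lt [NoetherianSpace X] :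
    (nonSplayedComponents (strictTransform π (reducedIdeal C) '' S)).encard <
      (nonSplayedComponents S).encard := by
  have key {C' : Set X'} := hπ.exists_nonSplayedComponent hS hC (C' := C')
  have himg (y : X') : closure (π '' closure {y}) = closure {π y} := by
    rw [closure_image_closure π.continuous, Set.image_singleton]
  have hfin := finite_nonSplayedComponents hS.finite
  refine lt_of_le_of_lt (b := (nonSplayedComponents S \ {C}).encard) ?_ ?_
  · refine Set.encard_le_encard_of_injOn (f := fun C' ↦ closure (π '' C')) ?_ ?_
    · intro C' hC'
      obtain ⟨y, rfl, h1, h2⟩ := key hC'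
      simp only [himg]
      exact ⟨h2, fun h ↦ h1 ((h : closure {π y} = C) ▸ subset_closure rfl)⟩
    · intro C₁ hC₁ C₂ hC₂ h
      obtain ⟨y₁, rfl, h1, -⟩ := key hC₁
      obtain ⟨y₂, rfl, h2, -⟩ := key hC₂
      simp only [himg] at h
      have h3 : π y₁ = π y₂ := (inseparable_iff_closure_eq.mpr h).eq
      rw [hπ.eq_of_notMem ((mem_support_reducedIdeal_iff hC.prop).not.mpr h1) h3]
  · exact (hfin.subset Set.sdiff_subset).encard_lt_encard
      (Set.sdiff_singleton_ssubset.mpr hC.prop)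

end Transform

end DivisorArrangement

end

/-! ### The theorem. -/

theorem theorem3p7 {k : Type u} [Field k] [IsAlgClosed k] {X X' : Scheme.{u}}
    (f : X ⟶ Spec (.of k)) (S : Set X.IdealSheafData)
    (hS : DivisorArrangement.IsArrangement f S)
    (C : Set X) (hC : Minimal (fun B => B ∈ DivisorArrangement.nonSplayedComponents S) C)
    (π : X' ⟶ X) (hπ : DivisorArrangement.IsBlowup π (DivisorArrangement.reducedIdeal C))
    (E : X'.IdealSheafData)
    (hE : E = DivisorArrangement.exceptionalDivisor π (DivisorArrangement.reducedIdeal C))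
    (S' : Set X'.IdealSheafData)
    (hS' : S' =
      DivisorArrangement.strictTransform π (DivisorArrangement.reducedIdeal C) '' S) :
    ((DivisorArrangement.nonSplayedComponents S).Finite ∧
      (DivisorArrangement.nonSplayedComponents S').encard <
        (DivisorArrangement.nonSplayedComponents S).encard) ∧
    (∀ U ⊆ S', U.Nonempty → DivisorArrangement.IsSplayed (insert E U)) ∧
    DivisorArrangement.IsArrangement (π ≫ f) (insert E S') := by
  let : X.Over (Spec (.of k)) := ⟨f⟩
  let : X'.Over (Spec (.of k)) := ⟨π ≫ f⟩
  have : π.IsOver (Spec (.of k)) := ⟨rfl⟩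
  subst hE hS'
  obtain ⟨hint, hsep, hlft, hqc⟩ := hS.isVariety
  have hnoeth : IsLocallyNoetherian X := LocallyOfFiniteType.isLocallyNoetherian f
  have : CompactSpace X := QuasiCompact.compactSpace_of_compactSpace f
  have : IsNoetherian X := {}
  have hπlft := hπ.locallyOfFiniteType
  have hπqc := hπ.quasiCompact
  have hπsep := hπ.isSeparated
  have : IsLocallyNoetherian X' := LocallyOfFiniteType.isLocallyNoetherian π
  have : LocallyOfFiniteType (X' ↘ Spec (.of k)) :=
    inferInstanceAs (LocallyOfFiniteType (π ≫ f))
  -- `C` lies in a divisor of a nonempty set `I`, so it is a proper subset of `X`; this is what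
  -- integrality of the blowup needs.
  have hgen : genericPoint X ∉ (DivisorArrangement.reducedIdeal C).support := by
    rw [DivisorArrangement.mem_support_reducedIdeal_iff hC.prop]
    obtain ⟨I, hI, ⟨D, hD⟩, hIC, -⟩ := hC.prop
    exact fun h ↦ (hS.isEffectiveCartier D (hI hD)).genericPoint_notMem
      (DivisorArrangement.mem_support_sSup.mp (hIC.prop.2 h) D hD)
  have : IsIntegral X' := hπ.isIntegral ⟨_, hgen⟩
  have hS₀ : DivisorArrangement.IsArrangement (X ↘ Spec (.of k)) S := hS
  refine ⟨⟨DivisorArrangement.finite_nonSplayedComponents hS.finite,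
    hπ.encard_nonSplayedComponents_lt hS₀ hC⟩,
    fun U hU hUn ↦ hπ.isSplayed_insert_exceptionalDivisor hS₀ hC hU hUn,
    ⟨inferInstance, inferInstance, inferInstance, inferInstance⟩,
    (hS.finite.image _).insert _, ?_, fun T hT ↦ hπ.smooth_intersection hS₀ hC hT⟩
  rintro _ (rfl | ⟨D, hD, rfl⟩)
  · exact hπ.isEffectiveCartier
  · exact hπ.isEffectiveCartier_strictTransform hS₀ hC hD
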